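/- A weighted graph $G=(V,E,\omega,c)$ is a finite simple graph $(V,E)$ with positive integer weights $\omega:V\to\mathbb Z_{>0}$ and $c:E\to\mathbb Z_{>0}$; it is unweighted if all vertex and edge weights are equal to $1$. For $A\subseteq V$ put $\omega(A)=\sum_{u\in A}\omega(u)$ and let $c(A)$ be the total weight of the edges with exactly one end in $A$. A $k$-subpartition of $V$ is a family of $k$ nonempty pairwise disjoint subsets $A_1,\dots,A_k$ of $V$; it is a $k$-partition if moreover $\bigcup_i A_i=V$. Consider the following decision problems. The input is a weighted graph $G$, an integer $k\ge 2$ and a positive rational number $N$ (numbers are encoded in binary, $N$ by its numerator and denominator in lowest terms), and the question is whether there is a $k$-subpartition (problem IPP), respectively a $k$-partition (problem NCP), $\{A_i\}_{i=1}^k$ with $$\max_{1\le i\le k}\frac{c(A_i)}{\omega(A_i)}\le N\quad\text{(max version)},\qquad\text{respectively}\qquad \frac1k\sum_{i=1}^k\frac{c(A_i)}{\omega(A_i)}\le N\quad\text{(mean version)}.$$ For a constant $k\ge 2$, IPP$_k$ and NCP$_k$ (max or mean) are the same problems with $k$ fixed instead of being part of the input. Let $\mathcal{ISO}$ be the class of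 all the problems IPP, NCP, IPP$_k$, NCP$_k$ ($k\ge2$) in the max and mean versions. A problem is NP-complete if it lies in NP and every language in NP is polynomial-time many-one reducible to it. It is NP-complete in the strong sense if it is NP-complete and, for some polynomial $p$, it remains NP-complete when restricted to the instances all of whose numerical parameters (the vertex and edge weights, the numerator and the denominator of $N$, and $k$ if it is part of the input) are at most $p(\ell)$, where $\ell$ is the length of the instance. **Proposition.** If a problem $P\in\mathcal{ISO}$ is NP-complete in the strong sense for weighted graphs, then $P$ is NP-complete for unweighted simple graphs, that is, when restricted to the instances whose graph is unweighted. -/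

import Mathlib

/-! ## Decision problems and NP-completeness, over Mathlib's polynomial-time Turing machines -/

/-- A decision problem: a type of instances, an encoding of the instances as words over a finite
alphabet, and the set of yes-instances. -/
structure DecisionProblem where
  Inst : Type
  Sym : Type
  symFintype : Fintype Sym
  enc : Inst → List Sym
  enc_injective : Function.Injective enc
  Yes : Set Inst

namespace DecisionProblem

/-- The length of the encoding of an instance. -/
def size (P : DecisionProblem) (x : P.Inst) : ℕ := (P.enc x).length

/-- The encoding of pairs (instance, certificate); the certificate is a word of bits. -/
def encWithCertificate (P : DecisionProblem) (x : P.Inst × List Bool) : List (P.Sym ⊕ Bool) :=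
  (P.enc x.1).map Sum.inl ++ x.2.map Sum.inr

/-- Membership in NP: a polynomial-time Turing machine verifies certificates of polynomially
bounded length. -/
def InNP (P : DecisionProblem) : Prop :=
  ∃ (V : P.Inst × List Bool → Bool) (q : Polynomial ℕ),
    Nonempty (Turing.TM2ComputableInPolyTime P.encWithCertificate Computability.encodeBool V) ∧
    ∀ x : P.Inst, x ∈ P.Yes ↔ ∃ y : List Bool, y.length ≤ q.eval (P.size x) ∧ V (x, y) = true

/-- Polynomial-time many-one (Karp) reducibility. -/
def ReducesTo (P Q : DecisionProblem) : Prop :=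
  ∃ f : P.Inst → Q.Inst,
    Nonempty (Turing.TM2ComputableInPolyTime P.enc Q.enc f) ∧ ∀ x, x ∈ P.Yes ↔ f x ∈ Q.Yes

/-- The membership problem of a language over the alphabet of two letters. -/
def ofLanguage (L : Set (List Bool)) : DecisionProblem where
  Inst := List Bool
  Sym := Bool
  symFintype := inferInstance
  enc := id
  enc_injective := Function.injective_id
  Yes := L

/-- `Q` lies in NP and every language in NP is polynomial-time reducible to `Q`. -/
def NPComplete (Q : DecisionProblem) : Prop :=
  Q.InNP ∧ ∀ L : Set (List Bool), (ofLanguage L).InNP → (ofLanguage L).ReducesTo Q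

/-- The same problem with the instances restricted to a subset (and the same encoding). -/
def restrict (P : DecisionProblem) (S : Set P.Inst) : DecisionProblem where
  Inst := {x : P.Inst // x ∈ S}
  Sym := P.Sym
  symFintype := P.symFintype
  enc x := P.enc x.1
  enc_injective := P.enc_injective.comp Subtype.val_injective
  Yes := {x | x.1 ∈ P.Yes}

end DecisionProblem

/-- A decision problem with numerical parameters: `params x` is the set of the integers that occur
as numerical parameters in the instance `x`. -/
structure NumberProblem extends DecisionProblem where
  params : Inst → Set ℕ

/-- NP-completeness in the strong sense: the problem is NP-complete, and for some polynomial `p` it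
remains NP-complete when restricted to the instances all of whose numerical parameters are at most
`p` of the length of the instance. -/
def NumberProblem.StronglyNPComplete (P : NumberProblem) : Prop :=
  P.toDecisionProblem.NPComplete ∧
    ∃ p : Polynomial ℕ,
      (P.toDecisionProblem.restrict
        {x | ∀ m ∈ P.params x, m ≤ p.eval (P.toDecisionProblem.size x)}).NPComplete

/-! ## Weighted graphs, isoperimetric numbers and normalized cuts -/

/-- A finite simple graph with positive integer weights on the vertices and on the edges. -/
structure WeightedGraph where
  n : ℕ
  graph : SimpleGraph (Fin n)
  ω : Fin n → ℕ+
  c : graph.edgeSet → ℕ+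

namespace WeightedGraph

/-- All the vertex and edge weights are equal to 1. -/
def IsUnweighted (G : WeightedGraph) : Prop :=
  (∀ v, G.ω v = 1) ∧ ∀ e, G.c e = 1

open Classical in
/-- The weight of the edge `uv`, and `0` if `u` and `v` are not adjacent. -/
noncomputable def pairWeight (G : WeightedGraph) (u v : Fin G.n) : ℕ :=
  if h : G.graph.Adj u v then (G.c ⟨s(u, v), G.graph.mem_edgeSet.2 h⟩ : ℕ) else 0

/-- `ω(A)`. -/
def vol (G : WeightedGraph) (A : Finset (Fin G.n)) : ℕ := ∑ u ∈ A, (G.ω u : ℕ)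

/-- `c(A)`, the total weight of the edges between `A` and its complement. -/
noncomputable def cut (G : WeightedGraph) (A : Finset (Fin G.n)) : ℕ :=
  ∑ u ∈ A, ∑ v ∈ Aᶜ, G.pairWeight u v

/-- The normalized outgoing flow `c(A) / ω(A)`. -/
noncomputable def flow (G : WeightedGraph) (A : Finset (Fin G.n)) : ℚ≥0 :=
  (G.cut A : ℚ≥0) / (G.vol A : ℚ≥0)

/-- `k`-subpartitions: `k` nonempty pairwise disjoint sets of vertices. -/
def IsSubpartition (G : WeightedGraph) {k : ℕ} (A : Fin k → Finset (Fin G.n)) : Prop :=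
  (∀ i, (A i).Nonempty) ∧ ∀ i j, i ≠ j → Disjoint (A i) (A j)

/-- `k`-partitions: `k`-subpartitions that cover all the vertices. -/
def IsPartition (G : WeightedGraph) {k : ℕ} (A : Fin k → Finset (Fin G.n)) : Prop :=
  G.IsSubpartition A ∧ ∀ v, ∃ i, v ∈ A i

/-- The maximum of the normalized outgoing flows of the parts. -/
noncomputable def maxFlow (G : WeightedGraph) {k : ℕ} (A : Fin k → Finset (Fin G.n)) : ℚ≥0 :=
  Finset.univ.sup fun i => G.flow (A i)

/-- The mean of the normalized outgoing flows of the parts. -/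
noncomputable def meanFlow (G : WeightedGraph) {k : ℕ} (A : Fin k → Finset (Fin G.n)) : ℚ≥0 :=
  (1 / (k : ℚ≥0)) * ∑ i, G.flow (A i)

end WeightedGraph

/-- `IPP` minimizes over `k`-subpartitions, `NCP` over `k`-partitions. -/
inductive CutKind
  | IPP
  | NCP

/-- The max version and the mean version of the problems. -/
inductive CutVersion
  | max
  | mean

/-- Admissible families of vertex sets: subpartitions for `IPP` and partitions for `NCP`. -/
def CutKind.Admissible (T : CutKind) (G : WeightedGraph) {k : ℕ}
    (A : Fin k → Finset (Fin G.n)) : Prop :=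
  match T with
  | .IPP => G.IsSubpartition A
  | .NCP => G.IsPartition A

/-- The quantity that is minimized: the maximum or the mean of the normalized flows. -/
noncomputable def CutVersion.value (m : CutVersion) (G : WeightedGraph) {k : ℕ}
    (A : Fin k → Finset (Fin G.n)) : ℚ≥0 :=
  match m with
  | .max => G.maxFlow A
  | .mean => G.meanFlow A

/-- The minimum over the admissible families of `k` sets is at most `N`, that is, some admissible
family has value at most `N`. -/
def CutAtMost (T : CutKind) (m : CutVersion) (G : WeightedGraph) (k : ℕ) (N : ℚ≥0) : Prop :=
  ∃ A : Fin k → Finset (Fin G.n), T.Admissible G A ∧ m.value G A ≤ N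

/-! ## Encoding of instances, with all numbers in binary -/

namespace InstanceCode

open Computability

/-- A natural number: its binary digits followed by a comma. -/
def encNat (m : ℕ) : List Γ' := (encodeNat m).map Γ'.bit ++ [Γ'.comma]

/-- A list of natural numbers. -/
def encNats (l : List ℕ) : List Γ' := l.flatMap encNat

/-- A table of natural numbers: the rows are enclosed in brackets. -/
def encTable (t : List (List ℕ)) : List Γ' :=
  t.flatMap fun r => Γ'.bra :: (encNats r ++ [Γ'.ket])

/-- The row of the vertex `u` holds `ω(u)` followed by the weights of the pairs `uv` for all `v`
(the weighted adjacency matrix, with `0` for non-adjacent pairs). -/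
noncomputable def table (G : WeightedGraph) : List (List ℕ) :=
  List.ofFn fun u => (G.ω u : ℕ) :: List.ofFn fun v => G.pairWeight u v

/-- A weighted graph followed by a list of further numbers. -/
noncomputable def encGraph (G : WeightedGraph) (l : List ℕ) : List Γ' :=
  encTable (table G) ++ encNats l

theorem bits_append_inj {a b : List Bool} {r s : List Γ'}
    (h : a.map Γ'.bit ++ Γ'.comma :: r = b.map Γ'.bit ++ Γ'.comma :: s) : a = b ∧ r = s := by
  induction a generalizing b with
  | nil => cases b <;> simp_all
  | cons x a ih =>
    cases b with
    | nil => simp at h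
    | cons y b =>
      simp only [List.map_cons, List.cons_append, List.cons.injEq, Γ'.bit.injEq] at h
      obtain ⟨rfl, rfl⟩ := ih h.2
      exact ⟨by rw [h.1], rfl⟩

theorem encNat_append_inj {a b : ℕ} {r s : List Γ'} (h : encNat a ++ r = encNat b ++ s) :
    a = b ∧ r = s := by
  have h' := bits_append_inj (a := encodeNat a) (b := encodeNat b) (r := r) (s := s)
    (by simpa [encNat] using h)
  exact ⟨by rw [← decode_encodeNat a, h'.1, decode_encodeNat], h'.2⟩

theorem encNat_append_ne (a : ℕ) (r s : List Γ') (x : Γ') (hx : x = Γ'.bra ∨ x = Γ'.ket) :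
    encNat a ++ r ≠ x :: s := by
  unfold encNat
  rcases hx with rfl | rfl <;> cases encodeNat a <;> simp

theorem encNat_ne_nil (a : ℕ) (r : List Γ') : encNat a ++ r ≠ [] := by
  simp [encNat]

theorem encNats_inj {a b : List ℕ} (h : encNats a = encNats b) : a = b := by
  induction a generalizing b with
  | nil =>
    cases b with
    | nil => rfl
    | cons y b =>
      simp only [encNats, List.flatMap_nil, List.flatMap_cons] at h
      exact absurd h.symm (encNat_ne_nil _ _)
  | cons x a ih =>
    cases b with
    | nil =>
      simp only [encNats, List.flatMap_nil, List.flatMap_cons] at h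
      exact absurd h (encNat_ne_nil _ _)
    | cons y b =>
      simp only [encNats, List.flatMap_cons] at h
      obtain ⟨rfl, h2⟩ := encNat_append_inj h
      rw [ih h2]

theorem encNats_append_inj {a b : List ℕ} {r s : List Γ'}
    (h : encNats a ++ Γ'.ket :: r = encNats b ++ Γ'.ket :: s) : a = b ∧ r = s := by
  induction a generalizing b with
  | nil =>
    cases b with
    | nil => simpa [encNats] using h
    | cons y b =>
      simp only [encNats, List.flatMap_nil, List.flatMap_cons, List.nil_append,
        List.append_assoc] at h
      exact absurd h.symm (encNat_append_ne _ _ _ _ (Or.inr rfl))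
  | cons x a ih =>
    cases b with
    | nil =>
      simp only [encNats, List.flatMap_nil, List.flatMap_cons, List.nil_append,
        List.append_assoc] at h
      exact absurd h (encNat_append_ne _ _ _ _ (Or.inr rfl))
    | cons y b =>
      simp only [encNats, List.flatMap_cons, List.append_assoc] at h
      obtain ⟨rfl, h2⟩ := encNat_append_inj h
      obtain ⟨rfl, h3⟩ := ih h2
      exact ⟨rfl, h3⟩

theorem encNats_ne_bra (a : List ℕ) (s : List Γ') : encNats a ≠ Γ'.bra :: s := by
  cases a with
  | nil => simp [encNats]
  | cons x a =>
    simp only [encNats, List.flatMap_cons]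
    exact encNat_append_ne _ _ _ _ (Or.inl rfl)

theorem encTable_append_inj {a b : List (List ℕ)} {l m : List ℕ}
    (h : encTable a ++ encNats l = encTable b ++ encNats m) : a = b ∧ l = m := by
  induction a generalizing b with
  | nil =>
    cases b with
    | nil => exact ⟨rfl, encNats_inj (by simpa [encTable] using h)⟩
    | cons y b =>
      simp only [encTable, List.flatMap_nil, List.flatMap_cons, List.nil_append,
        List.cons_append] at h
      exact absurd h (encNats_ne_bra _ _)
  | cons x a ih =>
    cases b with
    | nil =>
      simp only [encTable, List.flatMap_nil, List.flatMap_cons, List.nil_append,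
        List.cons_append] at h
      exact absurd h.symm (encNats_ne_bra _ _)
    | cons y b =>
      simp only [encTable, List.flatMap_cons, List.cons_append, List.append_assoc,
        List.cons.injEq, true_and, List.nil_append] at h
      obtain ⟨rfl, h2⟩ := encNats_append_inj h
      obtain ⟨rfl, h3⟩ := ih h2
      exact ⟨rfl, h3⟩

theorem table_injective : Function.Injective table := by
  rintro ⟨n, g, w, c⟩ ⟨n', g', w', c'⟩ h
  have hn : n = n' := by simpa [table] using congrArg List.length h
  subst hn
  have h1 := List.ofFn_injective h
  have hw : w = w' := by
    funext u
    have := congrFun h1 u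
    simp only [List.cons.injEq] at this
    exact PNat.coe_injective this.1
  have hc : ∀ u v, WeightedGraph.pairWeight ⟨n, g, w, c⟩ u v
      = WeightedGraph.pairWeight ⟨n, g', w', c'⟩ u v := by
    intro u v
    have := congrFun h1 u
    simp only [List.cons.injEq] at this
    exact congrFun (List.ofFn_injective this.2) v
  subst hw
  have hg : g = g' := by
    ext u v
    have := hc u v
    simp only [WeightedGraph.pairWeight] at this
    by_cases p : g.Adj u v <;> by_cases q : g'.Adj u v <;>
      simp only [p, q, dif_pos, dif_neg, not_false_eq_true] at this ⊢
    · exact absurd this (PNat.ne_zero _)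
    · exact absurd this.symm (PNat.ne_zero _)
  subst hg
  have hcc : c = c' := by
    funext ⟨e, he⟩
    induction e with
    | _ u v =>
      have := hc u v
      have he' : g.Adj u v := he
      simp only [WeightedGraph.pairWeight, he', dif_pos] at this
      exact PNat.coe_injective this
  subst hcc
  rfl

theorem encGraph_inj {G H : WeightedGraph} {l m : List ℕ} (h : encGraph G l = encGraph H m) :
    G = H ∧ l = m := by
  obtain ⟨h1, h2⟩ := encTable_append_inj h
  exact ⟨table_injective h1, h2⟩

end InstanceCode

/-! ## The class of isoperimetric and normalized cut problems -/

/-- An instance of the problems with constant `k`: a weighted graph and a positive rational. -/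
@[ext]
structure FixedCutInstance where
  G : WeightedGraph
  N : ℚ≥0
  N_pos : 0 < N

/-- An instance of the problems in which `k` is part of the input. -/
@[ext]
structure CutInstance where
  G : WeightedGraph
  k : ℕ
  two_le : 2 ≤ k
  N : ℚ≥0
  N_pos : 0 < N

/-- The set of all the vertex weights and edge weights of a weighted graph. -/
def WeightedGraph.weights (G : WeightedGraph) : Set ℕ :=
  Set.range (fun v => (G.ω v : ℕ)) ∪ Set.range (fun e => (G.c e : ℕ))

/-- The problems IPP and NCP (max or mean), with `k` in the input. -/
noncomputable def cutProblem (T : CutKind) (m : CutVersion) : NumberProblem where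
  Inst := CutInstance
  Sym := Computability.Γ'
  symFintype := inferInstance
  enc x := InstanceCode.encGraph x.G [x.k, x.N.num, x.N.den]
  enc_injective x y h := by
    obtain ⟨h1, h2⟩ := InstanceCode.encGraph_inj h
    simp only [List.cons.injEq, and_true] at h2
    exact CutInstance.ext h1 h2.1 (NNRat.ext_num_den h2.2.1 h2.2.2)
  Yes := {x | CutAtMost T m x.G x.k x.N}
  params x := x.G.weights ∪ {x.k, x.N.num, x.N.den}

/-- The problems IPP_k and NCP_k (max or mean), with constant `k`. -/
noncomputable def fixedCutProblem (T : CutKind) (m : CutVersion) (k : ℕ) : NumberProblem where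
  Inst := FixedCutInstance
  Sym := Computability.Γ'
  symFintype := inferInstance
  enc x := InstanceCode.encGraph x.G [x.N.num, x.N.den]
  enc_injective x y h := by
    obtain ⟨h1, h2⟩ := InstanceCode.encGraph_inj h
    simp only [List.cons.injEq, and_true] at h2
    exact FixedCutInstance.ext h1 (NNRat.ext_num_den h2.1 h2.2)
  Yes := {x | CutAtMost T m x.G k x.N}
  params x := x.G.weights ∪ {x.N.num, x.N.den}

/-- The class of all the problems IPP, NCP, IPP_k and NCP_k, in the max and mean versions. -/
inductive ISO
  | inputK (T : CutKind) (m : CutVersion)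
  | constK (T : CutKind) (m : CutVersion) (k : ℕ) (hk : 2 ≤ k)

/-- The problem for weighted graphs. -/
noncomputable def ISO.weighted : ISO → NumberProblem
  | .inputK T m => cutProblem T m
  | .constK T m k _ => fixedCutProblem T m k

/-- The problem for unweighted simple graphs, i.e. restricted to the weighted graphs all of whose
weights are equal to 1. -/
noncomputable def ISO.unweighted : ISO → DecisionProblem
  | .inputK T m =>
      (cutProblem T m).toDecisionProblem.restrict {x : CutInstance | x.G.IsUnweighted}
  | .constK T m k _ =>
      (fixedCutProblem T m k).toDecisionProblem.restrict {x : FixedCutInstance | x.G.IsUnweighted}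

/-! Every vertex `v` of the weighted graph is replaced by a clique on `ω(v) * M` vertices, every
edge `uv` by a matching of `c(uv)` edges between the two cliques, and the threshold `N` by `N / M`.
A union of whole cliques keeps its cut weight while its volume is multiplied by `M`, so its flow is
divided by `M` (`IsBlowUp.flow_lift`). Families in the weighted graph therefore correspond to the
families in the unweighted graph whose parts split no clique.

What remains is to exclude parts that split a clique. Such a part cuts at least `M - 1` edges inside
that clique (`IsBlowUp.le_cut_of_splits`), so its flow is at least `(M - 1) / (ω(V) * M)`. Unsplit
parts use disjoint sets of cliques, so there are at most `n` of them; if `s ≥ 1` of the `k` parts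
split cliques, then `k ≤ s * (n + 1)` (`IsBlowUp.card_le_of_splits`). With `M = num(N) * X + 1`, a
sum of flows of at most `k * N / M` would force `X ≤ (n + 1) * ω(V)`, so a larger `X` works
(`IsBlowUp.not_splits`). Only the sum of the flows matters here, which treats the max and the mean
version at once. Since `M` is `1` modulo `num(N)`, the fraction `num(N) / (den(N) * M)` is already
in lowest terms.

Strong NP-completeness enters through the size: it suffices to reduce from instances with
polynomially bounded numbers, for which the cliques have polynomial size. Membership in NP passes to
restrictions.

The other half shows that this map is computable in polynomial time by stack machines. Instances are
treated as words, and `PT` is the relation of polynomial-time transformation between families of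
words. It is closed under composition (`PT.trans`), contains finite-state transducers (`PT.mealy`),
and contains the iteration of a transducer as often as the word has letters, with output either the
last iterate (`PT.iterate`) or all of them (`PT.orbit`). Conversion between binary and unary,
multiplication by `M` and enumeration of all pairs of vertices are each such an iteration;
`PT.reduction` assembles them. -/

/-! ## Bounded-time runs of a partial step function -/

namespace PolyTime

open Turing StateTransition

/-- `StepsIn f n a b`: exactly `n` steps of `f` lead from `a` to `b`. -/
def StepsIn {C : Type*} (f : C → Option C) : ℕ → C → C → Prop
  | 0, a, b => a = b
  | n + 1, a, b => ∃ c, f a = some c ∧ StepsIn f n c b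

/-- Translates to the form used by `EvalsTo`: iterates of `flip bind f`, for which `none` is
absorbing. -/
theorem stepsIn_iff {C : Type*} (f : C → Option C) (n : ℕ) (a b : C) :
    StepsIn f n a b ↔ (flip bind f)^[n] (some a) = some b := by
  induction n generalizing a with
  | zero => simp [StepsIn]
  | succ n ih =>
    have hnone : (flip bind f)^[n] (none : Option C) = none := by
      clear ih
      induction n with
      | zero => rfl
      | succ n ih => rw [Function.iterate_succ_apply]; exact ih
    rw [Function.iterate_succ_apply]
    change (∃ c, f a = some c ∧ StepsIn f n c b) ↔ (flip bind f)^[n] (f a) = some b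
    cases h : f a with
    | none => 
      simp only [reduceCtorEq, false_and, exists_false, false_iff]
      rw [hnone]; simp
    | some c => simp [ih]

theorem StepsIn.trans {C : Type*} {f : C → Option C} {n m : ℕ} {a b c : C}
    (h₁ : StepsIn f n a b) (h₂ : StepsIn f m b c) : StepsIn f (n + m) a c := by
  induction n generalizing a with
  | zero => cases h₁; simpa using h₂
  | succ n ih =>
    obtain ⟨d, hd, h⟩ := h₁
    rw [Nat.add_right_comm]
    exact ⟨d, hd, ih h⟩

/-- A simulation of one step function by another one transports runs. -/
theorem StepsIn.sim {C D : Type*} {f : C → Option C} {g : D → Option D} (R : C → D → Prop)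
    (hR : ∀ a a' b, R a b → f a = some a' → ∃ b', g b = some b' ∧ R a' b') {n : ℕ} {a a' : C}
    {b : D} (h : StepsIn f n a a') (hab : R a b) : ∃ b', StepsIn g n b b' ∧ R a' b' := by
  induction n generalizing a b with
  | zero => cases h; exact ⟨b, rfl, hab⟩
  | succ n ih =>
    obtain ⟨c, hc, h⟩ := h
    obtain ⟨d, hd, hcd⟩ := hR _ _ _ hab hc
    obtain ⟨b', hb', h'⟩ := ih h hcd
    exact ⟨b', ⟨d, hd, hb'⟩, h'⟩

/-- `Within f t a b`: at most `t` steps of `f` lead from `a` to `b`. -/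
def Within {C : Type*} (f : C → Option C) (t : ℕ) (a b : C) : Prop :=
  ∃ n ≤ t, StepsIn f n a b

namespace Within

variable {C : Type*} {f : C → Option C} {t s : ℕ} {a b c : C}

theorem refl (a : C) : Within f t a a := ⟨0, Nat.zero_le _, rfl⟩

theorem mono (h : Within f t a b) (hts : t ≤ s) : Within f s a b := by
  obtain ⟨n, hn, h⟩ := h
  exact ⟨n, hn.trans hts, h⟩

theorem trans (h₁ : Within f t a b) (h₂ : Within f s b c) : Within f (t + s) a c := by
  obtain ⟨n, hn, h₁⟩ := h₁
  obtain ⟨m, hm, h₂⟩ := h₂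
  exact ⟨n + m, add_le_add hn hm, h₁.trans h₂⟩

theorem head (h₁ : f a = some b) (h₂ : Within f t b c) : Within f (t + 1) a c := by
  obtain ⟨n, hn, h₂⟩ := h₂
  exact ⟨n + 1, Nat.succ_le_succ hn, b, h₁, h₂⟩

theorem evals (h : Within f t a b) : Nonempty (EvalsToInTime f a (some b) t) := by
  obtain ⟨n, hn, h⟩ := h
  exact ⟨⟨⟨n, (stepsIn_iff f n a b).1 h⟩, hn⟩⟩

theorem of_evals (h : EvalsToInTime f a (some b) t) : Within f t a b :=
  ⟨h.steps, h.steps_le_m, (stepsIn_iff f _ a b).2 h.evals_in_steps⟩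

end Within

/-- The coefficients are nonnegative. This allows a time bound to be evaluated at an upper bound for
the length of a word. -/
theorem eval_mono (p : Polynomial ℕ) {a b : ℕ} (h : a ≤ b) : p.eval a ≤ p.eval b := by
  rw [Polynomial.eval_eq_sum_range, Polynomial.eval_eq_sum_range]
  exact Finset.sum_le_sum fun i _ => Nat.mul_le_mul_left _ (Nat.pow_le_pow_left h i)

/-! ## Running a stack machine inside a larger one -/

section Lift

variable {K K' : Type} {Γ : K → Type} {Λ Λ' σ σ' : Type}

/-- A statement of a machine with stacks `K'`, labels `Λ'` and states `σ'`, executed on a larger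
machine. The states of the small machine are read by `g` and written by `s`; instead of halting the
large machine goes to the label `e` (or halts, if there is none). -/
def liftStmt (ι : K' → K) (g : σ → σ') (s : σ → σ' → σ) (ℓ : Λ' → Λ) (e : Option Λ) :
    TM2.Stmt (fun k => Γ (ι k)) Λ' σ' → TM2.Stmt Γ Λ σ
  | .push k f q => .push (ι k) (fun v => f (g v)) (liftStmt ι g s ℓ e q)
  | .peek k f q => .peek (ι k) (fun v x => s v (f (g v) x)) (liftStmt ι g s ℓ e q)
  | .pop k f q => .pop (ι k) (fun v x => s v (f (g v) x)) (liftStmt ι g s ℓ e q)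
  | .load f q => .load (fun v => s v (f (g v))) (liftStmt ι g s ℓ e q)
  | .branch f q₁ q₂ => .branch (fun v => f (g v)) (liftStmt ι g s ℓ e q₁) (liftStmt ι g s ℓ e q₂)
  | .goto f => .goto fun v => ℓ (f (g v))
  | .halt => e.elim .halt fun l => .goto fun _ => l

variable [DecidableEq K] [DecidableEq K']

/-- The configurations of the large machine that correspond to one of the small machine; the state
has the form `s w _` and the other stacks are as in `S₀`. -/
structure LiftRel (ι : K' → K) (s : σ → σ' → σ) (ℓ : Λ' → Λ) (e : Option Λ) (w : σ)
    (S₀ : ∀ k, List (Γ k)) (c : TM2.Cfg (fun k => Γ (ι k)) Λ' σ') (C : TM2.Cfg Γ Λ σ) : Prop where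
  label : C.l = c.l.elim e fun l => some (ℓ l)
  var : C.var = s w c.var
  stk : ∀ k, C.stk (ι k) = c.stk k
  rest : ∀ k, (∀ k', ι k' ≠ k) → C.stk k = S₀ k

/-- `g` and `s` form a lens, of which two laws suffice: reading after writing, and overwriting. The
large state always has the form `s w _`, so the law for writing back what was read is not needed.
Injectivity of `ι` keeps an update of one stack from touching another. -/
theorem liftRel_stepAux {ι : K' → K} (hι : Function.Injective ι) {g : σ → σ'} {s : σ → σ' → σ}
    (hgs : ∀ v a, g (s v a) = a) (hss : ∀ v a b, s (s v a) b = s v b) (ℓ : Λ' → Λ)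
    (e : Option Λ) (w : σ) (S₀ : ∀ k, List (Γ k)) (q : TM2.Stmt (fun k => Γ (ι k)) Λ' σ')
    (v : σ') (T : ∀ k, List (Γ (ι k))) (S : ∀ k, List (Γ k)) (hT : ∀ k, S (ι k) = T k)
    (hS : ∀ k, (∀ k', ι k' ≠ k) → S k = S₀ k) :
    LiftRel ι s ℓ e w S₀ (TM2.stepAux q v T)
      (TM2.stepAux (liftStmt ι g s ℓ e q) (s w v) S) := by
  have hupd : ∀ (k : K') (x : List (Γ (ι k))) (T : ∀ k, List (Γ (ι k))) (S : ∀ k, List (Γ k)),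
      (∀ k, S (ι k) = T k) → ∀ k', Function.update S (ι k) x (ι k') = Function.update T k x k' := by
    intro k x T S h k'
    have := Function.update_comp_eq_of_injective' S hι k x
    rw [congrFun this k']
    congr 1
    exact funext h
  have hrest : ∀ (k : K') (x : List (Γ (ι k))) (S : ∀ k, List (Γ k)),
      (∀ k, (∀ k', ι k' ≠ k) → S k = S₀ k) →
      ∀ k₁, (∀ k', ι k' ≠ k₁) → Function.update S (ι k) x k₁ = S₀ k₁ := by
    intro k x S h k₁ hk₁
    rw [Function.update_of_ne (hk₁ k).symm, h k₁ hk₁]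
  induction q generalizing v T S with
  | push k f q ih =>
    simp only [liftStmt, TM2.stepAux, hgs, hT]
    exact ih _ _ _ (hupd _ _ _ _ hT) (hrest _ _ _ hS)
  | peek k f q ih =>
    simp only [liftStmt, TM2.stepAux, hgs, hss, hT]
    exact ih _ _ _ hT hS
  | pop k f q ih =>
    simp only [liftStmt, TM2.stepAux, hgs, hss, hT]
    exact ih _ _ _ (hupd _ _ _ _ hT) (hrest _ _ _ hS)
  | load f q ih =>
    simp only [liftStmt, TM2.stepAux, hgs, hss]
    exact ih _ _ _ hT hS
  | branch f q₁ q₂ ih₁ ih₂ =>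
    simp only [liftStmt, TM2.stepAux, hgs]
    cases f v
    · exact ih₂ _ _ _ hT hS
    · exact ih₁ _ _ _ hT hS
  | goto f => exact ⟨by simp [liftStmt, hgs], rfl, hT, hS⟩
  | halt => cases e <;> exact ⟨rfl, rfl, hT, hS⟩

theorem liftRel_step {ι : K' → K} (hι : Function.Injective ι) {g : σ → σ'} {s : σ → σ' → σ}
    (hgs : ∀ v a, g (s v a) = a) (hss : ∀ v a b, s (s v a) b = s v b) (ℓ : Λ' → Λ)
    (e : Option Λ) (w : σ) (S₀ : ∀ k, List (Γ k)) {m : Λ' → TM2.Stmt (fun k => Γ (ι k)) Λ' σ'}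
    {M : Λ → TM2.Stmt Γ Λ σ} (hM : ∀ l, M (ℓ l) = liftStmt ι g s ℓ e (m l))
    (c c' : TM2.Cfg (fun k => Γ (ι k)) Λ' σ') (C : TM2.Cfg Γ Λ σ)
    (h : LiftRel ι s ℓ e w S₀ c C) (hc : TM2.step m c = some c') :
    ∃ C', TM2.step M C = some C' ∧ LiftRel ι s ℓ e w S₀ c' C' := by
  obtain ⟨l, v, T⟩ := c
  obtain ⟨L, V, S⟩ := C
  obtain ⟨h1, h2, h3, h4⟩ := h
  cases l with
  | none => simp at hc
  | some l =>
    simp only [TM2.step, Option.some.injEq, Option.elim] at h1 h2 h3 h4 hc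
    subst h1 h2 hc
    refine ⟨_, rfl, ?_⟩
    rw [hM]
    exact liftRel_stepAux hι hgs hss ℓ e w S₀ _ _ _ _ h3 h4

end Lift

/-! ## The length of the stacks after a run -/

section Growth

variable {K : Type} {Γ : K → Type} {Λ σ : Type}

/-- The maximal number of symbols pushed by a statement. -/
def pushes : TM2.Stmt Γ Λ σ → ℕ
  | .push _ _ q => pushes q + 1
  | .peek _ _ q => pushes q
  | .pop _ _ q => pushes q
  | .load _ q => pushes q
  | .branch _ q₁ q₂ => max (pushes q₁) (pushes q₂)
  | .goto _ => 0
  | .halt => 0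

variable [DecidableEq K]

theorem length_stepAux_le (q : TM2.Stmt Γ Λ σ) (v : σ) (S : ∀ k, List (Γ k)) (B : ℕ)
    (hB : ∀ k, (S k).length ≤ B) (k : K) :
    ((TM2.stepAux q v S).stk k).length ≤ B + pushes q := by
  induction q generalizing v S B with
  | push k' f q ih =>
    simp only [TM2.stepAux, pushes]
    refine (ih _ _ (B + 1) fun k => ?_).trans (by omega)
    by_cases h : k = k'
    · subst h; simpa using hB k
    · simpa [Function.update_of_ne h] using (hB k).trans (Nat.le_succ _)
  | peek k' f q ih => exact ih _ _ B hB
  | pop k' f q ih =>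
    refine ih _ _ B fun k => ?_
    by_cases h : k = k'
    · subst h; simpa using (Nat.sub_le _ _).trans (hB k)
    · simpa [Function.update_of_ne h] using hB k
  | load f q ih => exact ih _ _ B hB
  | branch f q₁ q₂ ih₁ ih₂ =>
    simp only [TM2.stepAux, pushes]
    cases f v
    · exact (ih₂ _ _ B hB).trans (by simp)
    · exact (ih₁ _ _ B hB).trans (by simp)
  | goto f => exact hB k
  | halt => exact hB k

/-- One step pushes a number of symbols bounded by a constant of the program, so running time bounds
output length. Composition needs this, because the second machine's time is measured in the length
of the first one's output. -/
theorem length_stepsIn_le [Fintype Λ] (M : Λ → TM2.Stmt Γ Λ σ) {n : ℕ} {a b : TM2.Cfg Γ Λ σ}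
    (h : StepsIn (TM2.step M) n a b) (B : ℕ) (hB : ∀ k, (a.stk k).length ≤ B) (k : K) :
    (b.stk k).length ≤ B + n * Finset.univ.sup fun l => pushes (M l) := by
  induction n generalizing a B with
  | zero => cases h; simpa using hB k
  | succ n ih =>
    obtain ⟨c, hc, h⟩ := h
    refine (ih h (B + Finset.univ.sup fun l => pushes (M l)) fun k => ?_).trans
      (le_of_eq (by ring))
    obtain ⟨l, v, S⟩ := a
    cases l with
    | none => simp at hc
    | some l =>
      simp only [TM2.step, Option.some.injEq] at hc
      subst hc
      exact (length_stepAux_le (M l) v S B hB k).trans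
        (Nat.add_le_add_left (Finset.le_sup (f := fun l => pushes (M l)) (Finset.mem_univ l)) _)

end Growth

theorem initList_stk (tm : FinTM2) (s : List (tm.Γ tm.k₀)) :
    (initList tm s).stk = Function.update (fun _ => []) tm.k₀ s := by
  funext k
  by_cases h : k = tm.k₀
  · subst h; simp [initList]
  · simp [initList, h]

/-- A halting configuration has all stacks except the output stack empty and the internal state
reset, so every machine below has to clean up before it halts. -/
theorem haltList_stk (tm : FinTM2) (s : List (tm.Γ tm.k₁)) :
    (haltList tm s).stk = Function.update (fun _ => []) tm.k₁ s := by
  funext k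
  by_cases h : k = tm.k₁
  · subst h; simp [haltList]
  · simp [haltList, h]

/-! ## Polynomial-time transformations of words -/

/-- Some machine computes the word `e' d` from the word `e d`, in polynomial time, for all `d`. -/
def PT {D A B : Type} (e : D → List A) (e' : D → List B) : Prop :=
  Nonempty (TM2ComputableInPolyTime e e' id)

namespace PT

variable {D A B C : Type}

theorem refl [Fintype A] (e : D → List A) : PT e e := ⟨idComputableInPolyTime e⟩

/-- Computability involves `f` only through the words `e' (f d)`, so `f` can be absorbed into the
output encoding. Reductions can thus be handled as transformations of words indexed by one type. -/
theorem of_computable {D' : Type} {e : D → List A} {e' : D' → List B} {f : D → D'}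
    (h : Nonempty (TM2ComputableInPolyTime e e' f)) : PT e (fun d => e' (f d)) := by
  obtain ⟨h⟩ := h
  exact ⟨⟨h.toTM2ComputableAux, h.time, h.outputsFun⟩⟩

theorem to_computable {D' : Type} {e : D → List A} {e' : D' → List B} {f : D → D'}
    (h : PT e (fun d => e' (f d))) : Nonempty (TM2ComputableInPolyTime e e' f) := by
  obtain ⟨h⟩ := h
  exact ⟨⟨h.toTM2ComputableAux, h.time, h.outputsFun⟩⟩

/-- Restriction (or reparametrization) of the domain. -/
theorem comp_right {D' : Type} {e : D → List A} {e' : D → List B} (h : PT e e') (f : D' → D) :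
    PT (fun d => e (f d)) (fun d => e' (f d)) := by
  obtain ⟨h⟩ := h
  exact ⟨⟨h.toTM2ComputableAux, h.time, fun d => h.outputsFun (f d)⟩⟩

/-- A machine gives a polynomial-time transformation if it runs within a polynomial bound. -/
theorem of_within (tm : FinTM2) (i : tm.Γ tm.k₀ ≃ A) (o : tm.Γ tm.k₁ ≃ B) {e : D → List A}
    {e' : D → List B} (p : Polynomial ℕ)
    (h : ∀ d, Within tm.step (p.eval (e d).length) (initList tm ((e d).map i.symm))
      (haltList tm ((e' d).map o.symm))) : PT e e' :=
  ⟨{ tm := tm, inputAlphabet := i, outputAlphabet := o, time := p,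
     outputsFun := fun d => (h d).evals.some }⟩

/-- The stacks enter through equations, so each machine can describe them by its own function
instead of by `Function.update`. -/
theorem of_within_stk (tm : FinTM2) (i : tm.Γ tm.k₀ ≃ A) (o : tm.Γ tm.k₁ ≃ B) {e : D → List A}
    {e' : D → List B} (p : Polynomial ℕ)
    (h : ∀ d, ∃ S T : ∀ k, List (tm.Γ k),
      S = Function.update (fun _ => []) tm.k₀ ((e d).map i.symm) ∧
      T = Function.update (fun _ => []) tm.k₁ ((e' d).map o.symm) ∧
      Within tm.step (p.eval (e d).length) ⟨some tm.main, tm.initialState, S⟩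
        ⟨none, tm.initialState, T⟩) : PT e e' := by
  refine of_within tm i o p fun d => ?_
  obtain ⟨S, T, rfl, rfl, h⟩ := h d
  rw [← initList_stk, ← haltList_stk] at h
  exact h

end PT

/-! ## Composition -/

section Comp

variable {B : Type} (t₁ t₂ : FinTM2) (o : t₁.Γ t₁.k₁ ≃ B) (i : t₂.Γ t₂.k₀ ≃ B)

/-- The program of the composed machine: run `t₁`, move the output word (which is reversed thereby)
to the input stack of `t₂`, run `t₂`. -/
def compProg : t₁.Λ ⊕ t₂.Λ ⊕ Option B →
    TM2.Stmt (fun k : t₁.K ⊕ t₂.K => Sum.elim t₁.Γ t₂.Γ k) (t₁.Λ ⊕ t₂.Λ ⊕ Option B)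
      (t₁.σ × t₂.σ × Option B)
  | .inl l => liftStmt (Γ := fun k : t₁.K ⊕ t₂.K => Sum.elim t₁.Γ t₂.Γ k) Sum.inl (fun v => v.1)
      (fun v a => (a, v.2)) Sum.inl (some (.inr (.inr none))) (t₁.m l)
  | .inr (.inl l) => liftStmt (Γ := fun k : t₁.K ⊕ t₂.K => Sum.elim t₁.Γ t₂.Γ k) Sum.inr
      (fun v => v.2.1) (fun v a => (v.1, a, v.2.2)) (fun l => .inr (.inl l)) none (t₂.m l)
  | .inr (.inr none) => .pop (.inl t₁.k₁) (fun v x => (v.1, v.2.1, x.map o))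
      (.goto fun v => v.2.2.elim (.inr (.inl t₂.main)) fun b => .inr (.inr (some b)))
  | .inr (.inr (some b)) => .push (.inr t₂.k₀) (fun _ => i.symm b)
      (.goto fun _ => .inr (.inr none))

/-- The composed machine. -/
def compTM [Fintype B] [Fintype (t₁.Γ t₁.k₀)] : FinTM2 :=
  letI := t₁.kFin; letI := t₂.kFin; letI := t₁.ΛFin; letI := t₂.ΛFin
  letI := t₁.σFin; letI := t₂.σFin
  { K := t₁.K ⊕ t₂.K
    k₀ := .inl t₁.k₀
    k₁ := .inr t₂.k₁
    Γ := fun k => Sum.elim t₁.Γ t₂.Γ k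
    Λ := t₁.Λ ⊕ t₂.Λ ⊕ Option B
    main := .inl t₁.main
    σ := t₁.σ × t₂.σ × Option B
    initialState := (t₁.initialState, t₂.initialState, none)
    Γk₀Fin := inferInstanceAs (Fintype (t₁.Γ t₁.k₀))
    m := compProg t₁ t₂ o i }

/-- The stacks of the composed machine. -/
def joinStk (S : ∀ k, List (t₁.Γ k)) (T : ∀ k, List (t₂.Γ k)) :
    ∀ k : t₁.K ⊕ t₂.K, List (Sum.elim t₁.Γ t₂.Γ k)
  | .inl k => S k
  | .inr k => T k

theorem update_joinStk_inl (S : ∀ k, List (t₁.Γ k)) (T : ∀ k, List (t₂.Γ k)) (k : t₁.K)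
    (x : List (t₁.Γ k)) : Function.update (joinStk t₁ t₂ S T) (.inl k) x =
      joinStk t₁ t₂ (Function.update S k x) T := by
  funext k'
  rcases k' with k' | k'
  · by_cases h : k' = k
    · subst h
      exact (Function.update_self _ _ _).trans
        (Function.update_self k' x S).symm
    · exact (Function.update_of_ne (by simpa using h) _ _).trans
        (Function.update_of_ne h _ _).symm
  · exact Function.update_of_ne (by simp) _ _

theorem update_joinStk_inr (S : ∀ k, List (t₁.Γ k)) (T : ∀ k, List (t₂.Γ k)) (k : t₂.K)
    (x : List (t₂.Γ k)) : Function.update (joinStk t₁ t₂ S T) (.inr k) x =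
      joinStk t₁ t₂ S (Function.update T k x) := by
  funext k'
  rcases k' with k' | k'
  · exact Function.update_of_ne (by simp) _ _
  · by_cases h : k' = k
    · subst h
      exact (Function.update_self _ _ _).trans
        (Function.update_self k' x T).symm
    · exact (Function.update_of_ne (by simpa using h) _ _).trans
        (Function.update_of_ne h _ _).symm

theorem joinStk_nil : (joinStk t₁ t₂ (fun _ => []) fun _ => []) = fun _ => [] := by
  funext k; cases k <;> rfl

/-- Moving a stack letter by letter onto another one reverses it. Each letter costs a pop and a
push, and one more pop detects the empty stack and resets the buffer in the state. -/
theorem comp_transfer (l : List B) (r : List B) (b : Option B) :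
    Within (TM2.step (compProg t₁ t₂ o i)) (2 * l.length + 1)
      ⟨some (.inr (.inr none)), (t₁.initialState, t₂.initialState, b),
        joinStk t₁ t₂ (Function.update (fun _ => []) t₁.k₁ (l.map o.symm))
          (Function.update (fun _ => []) t₂.k₀ (r.map i.symm))⟩
      ⟨some (.inr (.inl t₂.main)), (t₁.initialState, t₂.initialState, none),
        joinStk t₁ t₂ (fun _ => [])
          (Function.update (fun _ => []) t₂.k₀ ((l.reverse ++ r).map i.symm))⟩ := by
  induction l generalizing r b with
  | nil =>
    refine Within.head (t := 0) (b := _) ?_ (Within.refl _)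
    simp only [TM2.step, compProg, TM2.stepAux]
    erw [update_joinStk_inl]
    simp [joinStk]
  | cons a l ih =>
    have := ih (a :: r) (some a)
    rw [List.reverse_cons, List.append_assoc, List.singleton_append]
    refine (Within.head (b := ⟨some (.inr (.inr (some a))),
      (t₁.initialState, t₂.initialState, some a),
        joinStk t₁ t₂ (Function.update (fun _ => []) t₁.k₁ (l.map o.symm))
          (Function.update (fun _ => []) t₂.k₀ (r.map i.symm))⟩) ?_
      (Within.head ?_ this)).mono (by simp only [List.length_cons]; omega)
    · simp only [TM2.step, compProg, TM2.stepAux]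
      erw [update_joinStk_inl]
      simp [joinStk]
    · simp only [TM2.step, compProg, TM2.stepAux]
      erw [update_joinStk_inr]
      simp [joinStk]

end Comp

namespace PT

variable {D A B C : Type}

/-- Composition, with the intermediate word reversed. -/
theorem trans_reverse {e : D → List A} {e₁ : D → List B} {e₂ : D → List C} (h₁ : PT e e₁)
    (h₂ : PT (fun d => (e₁ d).reverse) e₂) : PT e e₂ := by
  classical
  obtain ⟨⟨⟨t₁, i₁, o₁⟩, p₁, H₁⟩⟩ := h₁
  obtain ⟨⟨⟨t₂, i₂, o₂⟩, p₂, H₂⟩⟩ := h₂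
  let := t₁.kFin; let := t₂.kFin; let := t₁.ΛFin; let := t₂.ΛFin
  let := t₁.σFin; let := t₂.σFin
  let := t₁.Γk₀Fin
  let : Fintype B := @Fintype.ofEquiv _ _ t₂.Γk₀Fin i₂
  dsimp only at i₁ o₁ i₂ o₂ H₁ H₂
  -- `c` bounds the pushes of one step of the first machine, and `L` bounds the length of the
  -- intermediate word. The total time below is that of the first run, of the transfer, and of the
  -- second run on a word of length at most `L`.
  let c : ℕ := Finset.univ.sup fun l => pushes (t₁.m l)
  let L : Polynomial ℕ := Polynomial.X + p₁ * Polynomial.C c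
  refine PT.of_within (compTM t₁ t₂ o₁ i₂) i₁ o₂
    (p₁ + (2 * L + 1 + p₂.comp L)) fun d => ?_
  have W₁ := Within.of_evals (H₁ d)
  have W₂ := Within.of_evals (H₂ d)
  obtain ⟨n₁, hn₁, S₁⟩ := W₁
  obtain ⟨n₂, hn₂, S₂⟩ := W₂
  have hlen : (e₁ d).length ≤ L.eval (e d).length := by
    have := length_stepsIn_le t₁.m S₁ (e d).length (fun k => by
      rw [initList_stk]
      by_cases h : k = t₁.k₀
      · subst h; simp
      · simp [Function.update_of_ne h]) t₁.k₁
    change ((haltList t₁ _).stk _).length ≤ _ at this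
    rw [haltList_stk] at this
    simp only [id, Function.update_self, List.length_map] at this
    refine this.trans ?_
    simp only [L, Polynomial.eval_add, Polynomial.eval_X, Polynomial.eval_mul, Polynomial.eval_C]
    exact Nat.add_le_add_left (Nat.mul_le_mul_right _ hn₁) _
  simp only [Polynomial.eval_add, Polynomial.eval_mul, Polynomial.eval_comp, Polynomial.eval_one]
  have htwo : Polynomial.eval (e d).length (2 : Polynomial ℕ) = 2 := by
    rw [show (2 : Polynomial ℕ) = Polynomial.C 2 from rfl, Polynomial.eval_C]
  rw [htwo]
  -- the run of the first machine
  obtain ⟨C₁, hC₁, R₁⟩ := S₁.sim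
    (LiftRel (Γ := fun k : t₁.K ⊕ t₂.K => Sum.elim t₁.Γ t₂.Γ k) Sum.inl
      (fun (v : t₁.σ × t₂.σ × Option B) a => (a, v.2)) (Sum.inl : _ → t₁.Λ ⊕ t₂.Λ ⊕ Option B)
      (some (.inr (.inr none))) (t₁.initialState, t₂.initialState, none)
      (joinStk t₁ t₂ (fun _ => []) (fun _ => [])))
    (g := TM2.step (compProg t₁ t₂ o₁ i₂))
    (fun a a' b hab ha => liftRel_step
      (Γ := fun k : t₁.K ⊕ t₂.K => Sum.elim t₁.Γ t₂.Γ k) (M := compProg t₁ t₂ o₁ i₂) (m := t₁.m)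
      (s := fun (v : t₁.σ × t₂.σ × Option B) a => (a, v.2)) Sum.inl_injective
      (g := fun v => v.1) (fun _ _ => rfl)
      (fun _ _ _ => rfl) _ _ _ _ (fun l => rfl) _ _ _ hab ha)
    (b := initList (compTM t₁ t₂ o₁ i₂) ((e d).map i₁.symm))
    (by
      refine ⟨rfl, rfl, fun k => ?_, fun k hk => ?_⟩
      · rw [initList_stk, initList_stk]
        have := update_joinStk_inl t₁ t₂ (fun _ => []) (fun _ => []) t₁.k₀ ((e d).map i₁.symm)
        rw [joinStk_nil] at this
        exact congrFun this (Sum.inl k)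
      · rcases k with k | k
        · exact absurd rfl (hk k)
        · rw [initList_stk]
          exact Function.update_of_ne (by simp [compTM]) _ _)
  have hC₁' : C₁ = ⟨some (.inr (.inr none)), (t₁.initialState, t₂.initialState, none),
      joinStk t₁ t₂ (Function.update (fun _ => []) t₁.k₁ ((e₁ d).map o₁.symm))
        (Function.update (fun _ => []) t₂.k₀ (([] : List B).map i₂.symm))⟩ := by
    obtain ⟨l, v, S⟩ := C₁
    obtain ⟨h1, h2, h3, h4⟩ := R₁
    simp only at h1 h2 h3 h4
    congr 1
    funext k
    rcases k with k | k
    · rw [h3, haltList_stk]; rfl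
    · rw [h4 _ (by simp)]; simp [joinStk]
  subst hC₁'
  have T := comp_transfer t₁ t₂ o₁ i₂ (e₁ d) [] none
  rw [List.append_nil] at T
  -- the run of the second machine
  obtain ⟨C₂, hC₂, R₂⟩ := S₂.sim
    (LiftRel (Γ := fun k : t₁.K ⊕ t₂.K => Sum.elim t₁.Γ t₂.Γ k) Sum.inr
      (fun (v : t₁.σ × t₂.σ × Option B) a => (v.1, a, v.2.2))
      (fun l => (.inr (.inl l) : t₁.Λ ⊕ t₂.Λ ⊕ Option B))
      none (t₁.initialState, t₂.initialState, none)
      (joinStk t₁ t₂ (fun _ => []) (fun _ => [])))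
    (g := TM2.step (compProg t₁ t₂ o₁ i₂))
    (fun a a' b hab ha => liftRel_step
      (Γ := fun k : t₁.K ⊕ t₂.K => Sum.elim t₁.Γ t₂.Γ k) (M := compProg t₁ t₂ o₁ i₂) (m := t₂.m)
      (s := fun (v : t₁.σ × t₂.σ × Option B) a => (v.1, a, v.2.2)) Sum.inr_injective
      (g := fun v => v.2.1) (fun _ _ => rfl)
      (fun _ _ _ => rfl) _ _ _ _ (fun l => rfl) _ _ _ hab ha)
    (b := ⟨some (.inr (.inl t₂.main)), (t₁.initialState, t₂.initialState, none),
        joinStk t₁ t₂ (fun _ => [])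
          (Function.update (fun _ => []) t₂.k₀ ((e₁ d).reverse.map i₂.symm))⟩)
    (by
      refine ⟨rfl, rfl, fun k => ?_, fun k hk => ?_⟩
      · rw [initList_stk]; rfl
      · rcases k with k | k
        · rfl
        · exact absurd rfl (hk k))
  have hC₂' : C₂ = haltList (compTM t₁ t₂ o₁ i₂) ((e₂ d).map o₂.symm) := by
    obtain ⟨l, v, S⟩ := C₂
    obtain ⟨h1, h2, h3, h4⟩ := R₂
    simp only at h1 h2 h3 h4
    have hS : S = (haltList (compTM t₁ t₂ o₁ i₂) ((e₂ d).map o₂.symm)).stk := by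
      rw [haltList_stk]
      funext k
      rcases k with k | k
      · rw [h4 _ (by simp)]
        exact (Function.update_of_ne (by simp [compTM]) _ _).symm
      · rw [h3, haltList_stk]
        have := update_joinStk_inr t₁ t₂ (fun _ => []) (fun _ => []) t₂.k₁ ((e₂ d).map o₂.symm)
        rw [joinStk_nil] at this
        exact (congrFun this (Sum.inr k)).symm
    subst h1 h2 hS
    rfl
  subst hC₂'
  have W : Within (TM2.step (compProg t₁ t₂ o₁ i₂)) (n₁ + (2 * (e₁ d).length + 1 + n₂)) _ _ :=
    Within.trans ⟨n₁, le_rfl, hC₁⟩ (T.trans ⟨n₂, le_rfl, hC₂⟩)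
  refine Within.mono (f := (compTM t₁ t₂ o₁ i₂).step) W ?_
  refine add_le_add hn₁ (add_le_add (by omega) (hn₂.trans ?_))
  rw [List.length_reverse]
  exact eval_mono p₂ hlen

/-- Each composition reverses the intermediate word; inserting the identity machine gives two
reversals, which cancel. -/
theorem trans [Fintype B] {e : D → List A} {e₁ : D → List B} {e₂ : D → List C} (h₁ : PT e e₁)
    (h₂ : PT e₁ e₂) : PT e e₂ := by
  refine h₁.trans_reverse ((PT.refl fun d => (e₁ d).reverse).trans_reverse ?_)
  simpa using h₂

theorem reverse [Fintype A] (e : D → List A) : PT e (fun d => (e d).reverse) :=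
  (PT.refl e).trans_reverse (PT.refl _)

end PT

end PolyTime

/-! ## Finite-state transducers -/

namespace PolyTime

open Turing StateTransition

/-- The output word of a finite-state transducer with transition and output function `tr`, started
in the state `s`. -/
def run {S A B : Type} (tr : S → A → S × List B) : S → List A → List B
  | _, [] => []
  | s, a :: l => (tr s a).2 ++ run tr (tr s a).1 l

/-- The statement that pushes the letters of a word one after the other. -/
def pushAll {K : Type} {Γ : K → Type} {Λ σ : Type} (k : K) (l : List (Γ k))
    (q : TM2.Stmt Γ Λ σ) : TM2.Stmt Γ Λ σ :=
  l.foldr (fun a q => .push k (fun _ => a) q) q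

theorem stepAux_pushAll {K : Type} [DecidableEq K] {Γ : K → Type} {Λ σ : Type} (k : K)
    (l : List (Γ k)) (q : TM2.Stmt Γ Λ σ) (v : σ) (S : ∀ k, List (Γ k)) :
    TM2.stepAux (pushAll k l q) v S = TM2.stepAux q v (Function.update S k (l.reverse ++ S k)) := by
  induction l generalizing S with
  | nil => simp [pushAll]
  | cons a l ih =>
    have := ih (Function.update S k (a :: S k))
    simp only [pushAll, List.foldr_cons, TM2.stepAux] at this ⊢
    rw [this]
    simp

section Transducer

variable {S A B : Type} (tr : S → A → S × List B) (s₀ : S) (tail : List B)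

/-- The alphabets of the two stacks of the transducer machine. -/
def MealyΓ (A B : Type) : Bool → Type
  | false => A
  | true => B

/-- The stacks of the transducer machine. -/
def mealyStk (x : List A) (y : List B) : ∀ k, List (MealyΓ A B k)
  | false => x
  | true => y

/-- The program of the transducer machine. -/
def mealyProg : S × Option A → TM2.Stmt (MealyΓ A B) (S × Option A) (Option (S × Option A))
  | (s, none) => .pop (Γ := MealyΓ A B) false (fun _ (x : Option A) => x.map fun a => (s, some a))
      (.branch (fun v => v.isSome) (.goto fun v => v.getD (s, none))
        (pushAll (Γ := MealyΓ A B) true tail .halt))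
  | (s, some a) => pushAll (Γ := MealyΓ A B) true (tr s a).2 (.goto fun _ => ((tr s a).1, none))

/-- The transducer machine. -/
def mealyTM [Fintype S] [Fintype A] : FinTM2 where
  K := Bool
  k₀ := false
  k₁ := true
  Γ := MealyΓ A B
  Λ := S × Option A
  main := (s₀, none)
  σ := Option (S × Option A)
  initialState := none
  Γk₀Fin := inferInstanceAs (Fintype A)
  m := mealyProg tr tail

theorem update_mealyStk_false (x x' : List A) (y : List B) :
    Function.update (mealyStk x y) false x' = mealyStk x' y := by
  funext k
  cases k
  · exact Function.update_self _ _ _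
  · exact Function.update_of_ne (by simp) _ _

theorem update_mealyStk_true (x : List A) (y y' : List B) :
    Function.update (mealyStk x y) true y' = mealyStk x y' := by
  funext k
  cases k
  · exact Function.update_of_ne (by simp) _ _
  · exact Function.update_self _ _ _

/-- Each letter costs one step to pop it and one step to push all of its output, since a single
statement may push a whole word. The output accumulates in reverse order on its stack. -/
theorem mealy_within (l : List A) (r : List B) (s : S) (v : Option (S × Option A)) :
    Within (TM2.step (mealyProg tr tail)) (2 * l.length + 1)
      ⟨some (s, none), v, mealyStk l r⟩
      ⟨none, none, mealyStk [] ((run tr s l ++ tail).reverse ++ r)⟩ := by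
  induction l generalizing r s v with
  | nil =>
    refine Within.head (t := 0) (b := _) ?_ (Within.refl _)
    simp only [TM2.step, mealyProg, TM2.stepAux]
    erw [update_mealyStk_false]
    erw [stepAux_pushAll, update_mealyStk_true]
    simp only [run, List.nil_append]
    rfl
  | cons a l ih =>
    have := ih ((tr s a).2.reverse ++ r) (tr s a).1 (some (s, some a))
    rw [show (run tr s (a :: l) ++ tail).reverse ++ r = (run tr (tr s a).1 l ++ tail).reverse ++
      ((tr s a).2.reverse ++ r) by simp [run]]
    refine (Within.head (b := ⟨some (s, some a), some (s, some a), mealyStk l r⟩) ?_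
      (Within.head (b := _) ?_ this)).mono (by simp only [List.length_cons]; omega)
    · simp only [TM2.step, mealyProg, TM2.stepAux]
      erw [update_mealyStk_false]
      rfl
    · simp only [TM2.step, mealyProg]
      erw [stepAux_pushAll, update_mealyStk_true]
      rfl

end Transducer

namespace PT

variable {D A B S : Type}

theorem mealy_reverse [Fintype S] [Fintype A] (tr : S → A → S × List B) (s₀ : S) (tail : List B)
    (e : D → List A) : PT e (fun d => (run tr s₀ (e d) ++ tail).reverse) := by
  refine PT.of_within_stk (mealyTM tr s₀ tail) (Equiv.refl A) (Equiv.refl B)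
    (Polynomial.C 2 * Polynomial.X + Polynomial.C 1) fun d => ?_
  simp only [Polynomial.eval_add, Polynomial.eval_mul, Polynomial.eval_X, Polynomial.eval_C]
  have h := mealy_within tr tail (e d) [] s₀ none
  have h0 : (fun _ => [] : ∀ k, List (MealyΓ A B k)) = mealyStk [] [] := by
    funext k; cases k <;> rfl
  have h1 := update_mealyStk_false (B := B) [] (e d) []
  have h2 := update_mealyStk_true (A := A) [] [] ((run tr s₀ (e d) ++ tail).reverse)
  rw [← h0] at h1 h2
  rw [List.append_nil] at h
  refine ⟨_, _, h1.symm.trans ?_, h2.symm.trans ?_, h⟩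
  · exact congrArg (Function.update _ _) (List.map_id _).symm
  · exact congrArg (Function.update _ _) (List.map_id _).symm

theorem mealy [Fintype S] [Fintype A] [Fintype B] (tr : S → A → S × List B) (s₀ : S)
    (tail : List B) (e : D → List A) : PT e (fun d => run tr s₀ (e d) ++ tail) := by
  refine (mealy_reverse tr s₀ tail e).trans_reverse ?_
  simpa using PT.refl _

end PT

/-! ## Iterating a transducer on blocks -/

/-- A list of words, each followed by the end marker `none`. -/
def blk {A : Type} (bs : List (List A)) : List (Option A) :=
  bs.flatMap fun b => b.map some ++ [none]

/-- A word followed by its images under the iterates of `h`, as often as the word has letters. -/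
def orb {A : Type} (h : List A → List A) (b : List A) : List (List A) :=
  (List.range (b.length + 1)).map fun i => h^[i] b

section Orbit

variable {S A : Type} (tr : S → A → S × List A) (s₀ : S)

/-- The stacks of the orbit machine: input, counter, two work stacks, output. -/
inductive OrbK
  | i | c | x | y | o
  deriving DecidableEq

instance : Fintype OrbK where
  elems := {.i, .c, .x, .y, .o}
  complete k := by cases k <;> simp

/-- The labels of the orbit machine. -/
inductive OrbΛ (S A : Type)
  | read | readPush (a : A) | readEnd | flip | flipPush (a : A) | check | apply (s : S)
  | applyPush (s : S) (a : A) | applyEnd | clear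
  deriving Fintype

/-- The alphabets of the orbit machine. -/
def OrbΓ (A : Type) : OrbK → Type
  | .i => Option A
  | .c => Unit
  | .x => A
  | .y => A
  | .o => Option A

/-- The stacks of the orbit machine. -/
def orbStk (i : List (Option A)) (c : List Unit) (x y : List A) (o : List (Option A)) :
    ∀ k, List (OrbΓ A k)
  | .i => i
  | .c => c
  | .x => x
  | .y => y
  | .o => o

/-- The program of the orbit machine. -/
def orbProg : OrbΛ S A → TM2.Stmt (OrbΓ A) (OrbΛ S A) (Option (Option A))
  | .read => .pop (Γ := OrbΓ A) .i (fun _ (z : Option (Option A)) => z)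
      (.branch (fun v => v.isSome)
        (.goto fun v => (v.getD none).elim .readEnd .readPush) .halt)
  | .readPush a => .push (Γ := OrbΓ A) .x (fun _ => a)
      (.push (Γ := OrbΓ A) .c (fun _ => ()) (.goto fun _ => .read))
  | .readEnd => .push (Γ := OrbΓ A) .c (fun _ => ()) (.goto fun _ => .flip)
  | .flip => .pop (Γ := OrbΓ A) .x (fun _ (z : Option A) => some z)
      (.goto fun v => (v.getD none).elim .check .flipPush)
  | .flipPush a => .push (Γ := OrbΓ A) .y (fun _ => a) (.goto fun _ => .flip)
  | .check => .pop (Γ := OrbΓ A) .c (fun _ (z : Option Unit) => z.map fun _ => none)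
      (.goto fun v => if v.isSome then .apply s₀ else .clear)
  | .apply s => .pop (Γ := OrbΓ A) .y (fun _ (z : Option A) => some z)
      (.goto fun v => (v.getD none).elim .applyEnd (.applyPush s))
  | .applyPush s a => .push (Γ := OrbΓ A) .o (fun _ => (some a : Option A))
      (pushAll (Γ := OrbΓ A) .x (tr s a).2 (.goto fun _ => .apply (tr s a).1))
  | .applyEnd => .push (Γ := OrbΓ A) .o (fun _ => (none : Option A)) (.goto fun _ => .flip)
  | .clear => .pop (Γ := OrbΓ A) .y (fun _ (z : Option A) => some z)
      (.goto fun v => (v.getD none).elim .read fun _ => .clear)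

/-- The orbit machine. -/
def orbTM [Fintype S] [Fintype A] : FinTM2 where
  K := OrbK
  k₀ := .i
  k₁ := .o
  Γ := OrbΓ A
  Λ := OrbΛ S A
  main := .read
  σ := Option (Option A)
  initialState := none
  Γk₀Fin := inferInstanceAs (Fintype (Option A))
  m := orbProg tr s₀

section Update

variable (i : List (Option A)) (c : List Unit) (x y : List A) (o : List (Option A))

theorem update_orbStk_i (z : List (Option A)) :
    Function.update (orbStk i c x y o) .i z = orbStk z c x y o := by
  funext k
  cases k <;> first | exact Function.update_self _ _ _ | exact Function.update_of_ne (by simp) _ _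

theorem update_orbStk_c (z : List Unit) :
    Function.update (orbStk i c x y o) .c z = orbStk i z x y o := by
  funext k
  cases k <;> first | exact Function.update_self _ _ _ | exact Function.update_of_ne (by simp) _ _

theorem update_orbStk_x (z : List A) :
    Function.update (orbStk i c x y o) .x z = orbStk i c z y o := by
  funext k
  cases k <;> first | exact Function.update_self _ _ _ | exact Function.update_of_ne (by simp) _ _

theorem update_orbStk_y (z : List A) :
    Function.update (orbStk i c x y o) .y z = orbStk i c x z o := by
  funext k
  cases k <;> first | exact Function.update_self _ _ _ | exact Function.update_of_ne (by simp) _ _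

theorem update_orbStk_o (z : List (Option A)) :
    Function.update (orbStk i c x y o) .o z = orbStk i c x y z := by
  funext k
  cases k <;> first | exact Function.update_self _ _ _ | exact Function.update_of_ne (by simp) _ _

end Update

/-- The counter receives one unit per letter and one for the end marker. This is the number of words
in `orb`, where the block itself is included. -/
theorem orb_read (b : List A) (i : List (Option A)) (c : List Unit) (x y : List A)
    (o : List (Option A)) (v : Option (Option A)) :
    Within (TM2.step (orbProg tr s₀)) (2 * b.length + 2)
      ⟨some .read, v, orbStk (b.map some ++ none :: i) c x y o⟩
      ⟨some .flip, some none,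
        orbStk i (List.replicate (b.length + 1) () ++ c) (b.reverse ++ x) y o⟩ := by
  induction b generalizing c x v with
  | nil =>
    refine Within.head (b := ⟨some .readEnd, some none, orbStk i c x y o⟩) ?_
      (Within.head (t := 0) ?_ (Within.refl _))
    · simp only [TM2.step, orbProg, TM2.stepAux]
      erw [update_orbStk_i]
      rfl
    · simp only [TM2.step, orbProg, TM2.stepAux]
      erw [update_orbStk_c]
      rfl
  | cons a b ih =>
    have := ih (() :: c) (a :: x) (some (some a))
    rw [show List.replicate ((a :: b).length + 1) () ++ c =
        List.replicate (b.length + 1) () ++ () :: c by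
      rw [List.length_cons, List.replicate_succ' (n := b.length + 1)]; simp,
      show (a :: b).reverse ++ x = b.reverse ++ a :: x by simp]
    refine (Within.head (b := ⟨some (.readPush a), some (some a),
        orbStk (b.map some ++ none :: i) c x y o⟩) ?_
      (Within.head (b := _) ?_ this)).mono (by simp only [List.length_cons]; omega)
    · simp only [TM2.step, orbProg, TM2.stepAux]
      erw [update_orbStk_i]
      rfl
    · simp only [TM2.step, orbProg, TM2.stepAux]
      erw [update_orbStk_x, update_orbStk_c]
      rfl

theorem orb_flip (x : List A) (i : List (Option A)) (c : List Unit) (y : List A)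
    (o : List (Option A)) (v : Option (Option A)) :
    Within (TM2.step (orbProg tr s₀)) (2 * x.length + 1)
      ⟨some .flip, v, orbStk i c x y o⟩
      ⟨some .check, some none, orbStk i c [] (x.reverse ++ y) o⟩ := by
  induction x generalizing y v with
  | nil =>
    refine Within.head (t := 0) (b := _) ?_ (Within.refl _)
    simp only [TM2.step, orbProg, TM2.stepAux]
    erw [update_orbStk_x]
    rfl
  | cons a x ih =>
    have := ih (a :: y) (some (some a))
    rw [show (a :: x).reverse ++ y = x.reverse ++ a :: y by simp]
    refine (Within.head (b := ⟨some (.flipPush a), some (some a), orbStk i c x y o⟩) ?_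
      (Within.head (b := _) ?_ this)).mono (by simp only [List.length_cons]; omega)
    · simp only [TM2.step, orbProg, TM2.stepAux]
      erw [update_orbStk_x]
      rfl
    · simp only [TM2.step, orbProg, TM2.stepAux]
      erw [update_orbStk_y]
      rfl

/-- One pass copies the current word to the output and simultaneously writes its image to the other
work stack; the image is reversed there, which `orb_flip` undoes. -/
theorem orb_apply (y : List A) (i : List (Option A)) (c : List Unit) (x : List A)
    (o : List (Option A)) (s : S) (v : Option (Option A)) :
    Within (TM2.step (orbProg tr s₀)) (2 * y.length + 2)
      ⟨some (.apply s), v, orbStk i c x y o⟩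
      ⟨some .flip, some none, orbStk i c ((run tr s y).reverse ++ x) []
        (none :: ((y.map some).reverse ++ o))⟩ := by
  induction y generalizing s x o v with
  | nil =>
    refine Within.head (b := ⟨some .applyEnd, some none, orbStk i c x [] o⟩) ?_
      (Within.head (t := 0) (b := _) ?_ (Within.refl _))
    · simp only [TM2.step, orbProg, TM2.stepAux]
      erw [update_orbStk_y]
      rfl
    · simp only [TM2.step, orbProg, TM2.stepAux]
      erw [update_orbStk_o]
      rfl
  | cons a y ih =>
    have := ih ((tr s a).2.reverse ++ x) (some a :: o) (tr s a).1 (some (some a))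
    rw [show (run tr s (a :: y)).reverse ++ x =
        (run tr (tr s a).1 y).reverse ++ ((tr s a).2.reverse ++ x) by simp [run],
      show ((a :: y).map some).reverse ++ o = (y.map some).reverse ++ some a :: o by simp]
    refine (Within.head (b := ⟨some (.applyPush s a), some (some a), orbStk i c x y o⟩) ?_
      (Within.head (b := _) ?_ this)).mono (by simp only [List.length_cons]; omega)
    · simp only [TM2.step, orbProg, TM2.stepAux]
      erw [update_orbStk_y]
      rfl
    · simp only [TM2.step, orbProg, TM2.stepAux]
      erw [stepAux_pushAll, update_orbStk_o, update_orbStk_x]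
      rfl

theorem orb_clear (y : List A) (i : List (Option A)) (c : List Unit) (x : List A)
    (o : List (Option A)) (v : Option (Option A)) :
    Within (TM2.step (orbProg tr s₀)) (y.length + 1)
      ⟨some .clear, v, orbStk i c x y o⟩
      ⟨some .read, some none, orbStk i c x [] o⟩ := by
  induction y generalizing v with
  | nil =>
    refine Within.head (t := 0) (b := _) ?_ (Within.refl _)
    simp only [TM2.step, orbProg, TM2.stepAux]
    erw [update_orbStk_y]
    rfl
  | cons a y ih =>
    refine Within.head (b := ⟨some .clear, some (some a), orbStk i c x y o⟩) ?_ (ih _)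
    simp only [TM2.step, orbProg, TM2.stepAux]
    erw [update_orbStk_y]
    rfl

/-- A round takes one step for the counter, at most `2 * B + 2` to apply the transducer and at most
`2 * B + 1` to flip the result, in total `4 * B + 4`. The final clearing of the work stack fits into
the same bound. -/
theorem orb_check (n B : ℕ) (w : List A) (hB : ∀ j ≤ n, ((run tr s₀)^[j] w).length ≤ B)
    (i : List (Option A)) (o : List (Option A)) :
    Within (TM2.step (orbProg tr s₀)) ((n + 1) * (4 * B + 4))
      ⟨some .check, some none, orbStk i (List.replicate n ()) [] w o⟩
      ⟨some .read, some none, orbStk i [] [] []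
        ((blk ((List.range n).map fun j => (run tr s₀)^[j] w)).reverse ++ o)⟩ := by
  induction n generalizing w o with
  | zero =>
    have hw : w.length ≤ B := hB 0 le_rfl
    refine (Within.head (b := ⟨some .clear, none, orbStk i [] [] w o⟩) ?_
      (orb_clear tr s₀ w i [] [] o none)).mono (by omega)
    · simp only [TM2.step, orbProg, TM2.stepAux]
      erw [update_orbStk_c]
      rfl
  | succ n ih =>
    have hw : w.length ≤ B := hB 0 (Nat.zero_le _)
    have hw' : (run tr s₀ w).length ≤ B := hB 1 (by omega)
    have h1 := orb_apply tr s₀ w i (List.replicate n ()) [] o s₀ (some none)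
    rw [List.append_nil] at h1
    have h2 := orb_flip tr s₀ (run tr s₀ w).reverse i (List.replicate n ()) []
      (none :: ((w.map some).reverse ++ o)) (some none)
    rw [List.append_nil, List.reverse_reverse, List.length_reverse] at h2
    have h3 := ih (run tr s₀ w) (fun j hj => by
      have := hB (j + 1) (by omega)
      rwa [Function.iterate_succ_apply] at this) (none :: ((w.map some).reverse ++ o))
    rw [show blk ((List.range (n + 1)).map fun j => (run tr s₀)^[j] w) = (w.map some ++ [none]) ++
        blk ((List.range n).map fun j => (run tr s₀)^[j] (run tr s₀ w)) by
      rw [List.range_succ_eq_map]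
      simp [-List.range_map_iterate, blk, List.flatMap_map],
      List.reverse_append, List.append_assoc, List.reverse_append, List.reverse_singleton,
      List.singleton_append, List.cons_append]
    refine (Within.head (b := ⟨some (.apply s₀), some none,
        orbStk i (List.replicate n ()) [] w o⟩) ?_ ((h1.trans h2).trans h3)).mono ?_
    · simp only [TM2.step, orbProg, TM2.stepAux]
      erw [update_orbStk_c]
      rfl
    · have : (n + 1 + 1) * (4 * B + 4) = (n + 1) * (4 * B + 4) + (4 * B + 4) := by ring
      omega

theorem orb_main (bs : List (List A)) (N B : ℕ) (hN : ∀ b ∈ bs, b.length ≤ N)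
    (hB : ∀ b ∈ bs, ∀ j ≤ b.length + 1, ((run tr s₀)^[j] b).length ≤ B) (o : List (Option A))
    (v : Option (Option A)) :
    Within (TM2.step (orbProg tr s₀)) (bs.length * (4 * N + 3 + (N + 2) * (4 * B + 4)) + 1)
      ⟨some .read, v, orbStk (blk bs) [] [] [] o⟩
      ⟨none, none, orbStk [] [] [] []
        ((blk (bs.flatMap (orb (run tr s₀)))).reverse ++ o)⟩ := by
  induction bs generalizing o v with
  | nil =>
    refine Within.head (t := _) (b := _) ?_ (Within.refl _)
    simp only [TM2.step, orbProg, TM2.stepAux]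
    erw [update_orbStk_i]
    rfl
  | cons b bs ih =>
    have hb : b.length ≤ N := hN b (by simp)
    have h1 := orb_read tr s₀ b (blk bs) [] [] [] o v
    have h2 := orb_flip tr s₀ b.reverse (blk bs) (List.replicate (b.length + 1) ()) [] o
      (some none)
    have h3 := orb_check tr s₀ (b.length + 1) B b (hB b (by simp)) (blk bs) o
    have h4 := ih (fun b' h => hN b' (by simp [h])) (fun b' h => hB b' (by simp [h]))
      ((blk ((List.range (b.length + 1)).map fun j => (run tr s₀)^[j] b)).reverse ++ o) (some none)
    simp only [List.append_nil, List.reverse_reverse, List.length_reverse] at h1 h2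
    have h := (((h1.trans h2).trans h3).trans h4)
    have e1 : blk (b :: bs) = b.map some ++ none :: blk bs := by simp [blk]
    have e2 : blk ((b :: bs).flatMap (orb (run tr s₀))) =
        blk ((List.range (b.length + 1)).map fun j => (run tr s₀)^[j] b) ++
          blk (bs.flatMap (orb (run tr s₀))) := by simp [blk, orb]
    rw [e1, e2, List.reverse_append, List.append_assoc]
    refine h.mono ?_
    have : (b.length + 1 + 1) * (4 * B + 4) ≤ (N + 2) * (4 * B + 4) :=
      Nat.mul_le_mul_right _ (by omega)
    have e3 : (b :: bs).length * (4 * N + 3 + (N + 2) * (4 * B + 4)) =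
        bs.length * (4 * N + 3 + (N + 2) * (4 * B + 4)) +
          (4 * N + 3 + (N + 2) * (4 * B + 4)) := by
      rw [List.length_cons]; ring
    omega

end Orbit

theorem length_le_blk {A : Type} {bs : List (List A)} {b : List A} (h : b ∈ bs) :
    b.length ≤ (blk bs).length := by
  induction bs with
  | nil => simp at h
  | cons c bs ih =>
    have e : (blk (c :: bs)).length = c.length + 1 + (blk bs).length := by
      simp only [blk, List.flatMap_cons, List.length_append, List.length_map, List.length_singleton]
    rcases List.mem_cons.1 h with rfl | h
    · omega
    · have := ih h; omega

theorem blocks_le_blk {A : Type} (bs : List (List A)) : bs.length ≤ (blk bs).length := by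
  induction bs with
  | nil => simp
  | cons c bs ih =>
    have e : (blk (c :: bs)).length = c.length + 1 + (blk bs).length := by
      simp only [blk, List.flatMap_cons, List.length_append, List.length_map, List.length_singleton]
    simp only [List.length_cons]; omega

namespace PT

variable {D A S : Type}

theorem orbit_reverse [Fintype S] [Fintype A] (tr : S → A → S × List A) (s₀ : S)
    (bs : D → List (List A)) (q : Polynomial ℕ)
    (hq : ∀ d, ∀ b ∈ bs d, ∀ j ≤ b.length + 1,
      ((run tr s₀)^[j] b).length ≤ q.eval (blk (bs d)).length) :
    PT (fun d => blk (bs d)) (fun d => (blk ((bs d).flatMap (orb (run tr s₀)))).reverse) := by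
  -- This is the bound of `orb_main`, with both the number of blocks and their lengths estimated by
  -- the length of the whole word.
  refine PT.of_within_stk (orbTM tr s₀) (Equiv.refl (Option A)) (Equiv.refl (Option A))
    (Polynomial.X * (Polynomial.C 4 * Polynomial.X + Polynomial.C 3 +
      (Polynomial.X + Polynomial.C 2) * (Polynomial.C 4 * q + Polynomial.C 4)) +
      Polynomial.C 1) fun d => ?_
  simp only [Polynomial.eval_add, Polynomial.eval_mul, Polynomial.eval_X, Polynomial.eval_C]
  have h := orb_main tr s₀ (bs d) (blk (bs d)).length (q.eval (blk (bs d)).length)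
    (fun b hb => length_le_blk hb) (hq d) [] none
  have h0 : (fun _ => [] : ∀ k, List (OrbΓ A k)) = orbStk [] [] [] [] [] := by
    funext k; cases k <;> rfl
  have h1 := update_orbStk_i (A := A) [] [] [] [] [] (blk (bs d))
  have h2 := update_orbStk_o (A := A) [] [] [] [] []
    (blk ((bs d).flatMap (orb (run tr s₀)))).reverse
  rw [← h0] at h1 h2
  rw [List.append_nil] at h
  refine ⟨_, _, h1.symm.trans ?_, h2.symm.trans ?_,
    h.mono (Nat.add_le_add_right (Nat.mul_le_mul_right _ (blocks_le_blk _)) _)⟩ <;>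
  exact congrArg (Function.update _ _) (List.map_id _).symm

theorem orbit [Fintype S] [Fintype A] (tr : S → A → S × List A) (s₀ : S)
    (bs : D → List (List A)) (q : Polynomial ℕ)
    (hq : ∀ d, ∀ b ∈ bs d, ∀ j ≤ b.length + 1,
      ((run tr s₀)^[j] b).length ≤ q.eval (blk (bs d)).length) :
    PT (fun d => blk (bs d)) (fun d => blk ((bs d).flatMap (orb (run tr s₀)))) := by
  refine (orbit_reverse tr s₀ bs q hq).trans_reverse ?_
  simpa using PT.refl _

end PT

end PolyTime

/-! ## Iterating a transducer on a word -/

namespace PolyTime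

/-- The state of the transducer after a word. -/
def runState {S A B : Type} (tr : S → A → S × List B) : S → List A → S
  | s, [] => s
  | s, a :: l => runState tr (tr s a).1 l

section Run

variable {S A B : Type} (tr : S → A → S × List B)

@[simp] theorem run_nil (s : S) : run tr s [] = [] := rfl

@[simp] theorem run_cons (s : S) (a : A) (l : List A) :
    run tr s (a :: l) = (tr s a).2 ++ run tr (tr s a).1 l := rfl

@[simp] theorem runState_nil (s : S) : runState tr s [] = s := rfl

@[simp] theorem runState_cons (s : S) (a : A) (l : List A) :
    runState tr s (a :: l) = runState tr (tr s a).1 l := rfl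

theorem run_append (s : S) (l m : List A) :
    run tr s (l ++ m) = run tr s l ++ run tr (runState tr s l) m := by
  induction l generalizing s with
  | nil => rfl
  | cons a l ih => simp [ih]

end Run

/-- A letterwise substitution, as a transducer. -/
def subst {A B : Type} (f : A → List B) : Unit → A → Unit × List B := fun _ a => ((), f a)

theorem run_subst {A B : Type} (f : A → List B) (l : List A) :
    run (subst f) () l = l.flatMap f := by
  induction l with
  | nil => rfl
  | cons a l ih => simp [subst, List.flatMap_cons, ← ih]

/-- The transducer that keeps the letters between the first two end markers. -/
def keepFirst {A : Type} : Fin 3 → Option A → Fin 3 × List A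
  | 0, _ => (1, [])
  | 1, some a => (1, [a])
  | 1, none => (2, [])
  | 2, _ => (2, [])

theorem run_keepFirst_two {A : Type} (l : List (Option A)) : run keepFirst 2 l = [] := by
  induction l with
  | nil => rfl
  | cons a l ih => simpa [keepFirst] using ih

theorem run_keepFirst_one {A : Type} (w : List A) (l : List (Option A)) :
    run keepFirst 1 (w.map some ++ none :: l) = w := by
  induction w with
  | nil => simp [keepFirst, run_keepFirst_two]
  | cons a w ih => simp [keepFirst, ih]

theorem run_keepFirst_one' {A : Type} (w : List A) :
    run keepFirst 1 (w.map some) = w := by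
  induction w with
  | nil => rfl
  | cons a w ih => simp [keepFirst, ih]

theorem blk_append {A : Type} (bs cs : List (List A)) : blk (bs ++ cs) = blk bs ++ blk cs := by
  simp [blk]

namespace PT

variable {D A B S : Type}

theorem subst [Fintype A] [Fintype B] (f : A → List B) (e : D → List A) :
    PT e (fun d => (e d).flatMap f) := by
  have := PT.mealy (PolyTime.subst f) () [] e
  simpa [run_subst] using this

theorem of_eq {e : D → List A} {e₁ e₂ : D → List B} (h : PT e e₁) (h' : ∀ d, e₁ d = e₂ d) :
    PT e e₂ := by
  rwa [← funext h']

theorem block [Fintype A] (w : D → List A) : PT w (fun d => blk [w d]) := by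
  refine (PT.mealy (PolyTime.subst fun a => [some a]) () [none] w).of_eq fun d => ?_
  rw [run_subst]
  simp [blk, List.map_eq_flatMap]

/-- Iterating a transducer as often as the word has letters; the words that occur have to be of
polynomially bounded length. -/
theorem iterate [Fintype S] [Fintype A] (tr : S → A → S × List A) (s₀ : S) (w : D → List A)
    (q : Polynomial ℕ)
    (hq : ∀ d, ∀ j ≤ (w d).length + 1, ((run tr s₀)^[j] (w d)).length ≤ q.eval (w d).length) :
    PT w (fun d => (run tr s₀)^[(w d).length] (w d)) := by
  -- Only the last word of the orbit is wanted. In the reversed orbit it is the first block,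
  -- preceded by its end marker, so `keepFirst` isolates it; the remaining reversal is undone by
  -- `mealy_reverse`.
  refine (PT.block w).trans ((PT.orbit_reverse tr s₀ (fun d => [w d]) q fun d b hb j hj => ?_).trans
    (((PT.mealy_reverse keepFirst 0 [] _)).of_eq fun d => ?_))
  · rw [List.mem_singleton] at hb
    subst hb
    exact (hq d j hj).trans (eval_mono q (length_le_blk (by simp)))
  · have : blk ([w d].flatMap (orb (run tr s₀))) =
        blk ((List.range (w d).length).map fun i => (run tr s₀)^[i] (w d)) ++
          (((run tr s₀)^[(w d).length] (w d)).map some ++ [none]) := by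
      simp only [List.flatMap_cons, List.flatMap_nil, List.append_nil, orb, List.range_succ,
        List.map_append, List.map_cons, List.map_nil, blk_append]
      simp [blk]
    rw [this, List.append_nil, List.reverse_append]
    set u := (run tr s₀)^[(w d).length] (w d)
    have h0 : run keepFirst 0 ((u.map some ++ [none]).reverse ++
        (blk ((List.range (w d).length).map fun i => (run tr s₀)^[i] (w d))).reverse) =
        u.reverse := by
      rw [List.reverse_append, List.reverse_singleton, List.singleton_append, List.cons_append,
        ← List.map_reverse]
      -- For an empty word the orbit is a single block and no second end marker follows it.
      rcases List.eq_nil_or_concat (List.range (w d).length) with h | ⟨l, a, h⟩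
      · rw [h]
        simp [blk, keepFirst, run_keepFirst_one', -List.map_reverse]
      · rw [h, List.concat_eq_append, List.map_append, blk_append, List.reverse_append]
        have : (blk ([a].map fun i => (run tr s₀)^[i] (w d))).reverse =
          none :: (((run tr s₀)^[a] (w d)).map some).reverse := by simp [blk]
        rw [this, List.cons_append]
        simp only [run_cons, keepFirst, List.nil_append, run_keepFirst_one]
    rw [h0, List.reverse_reverse]

end PT

end PolyTime

/-! ## The layout of instances -/

namespace PolyTime

open Computability

/-- The letters of the words that occur in the reduction: binary digits, units `u` of the numbers
that follow the table, the end marker `fin` of a number, the separators of the different kinds of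
numbers, the start `tb` of the table and the delimiters of its rows, the units `q` of the numerator
and the copies `tick` of these units, units `a` of the numbers to be multiplied (denominator and
vertex weights), with the units `x` that are created by the multiplication, units `cu` of edge
weights and vertices `cell` of the unweighted graph. -/
inductive Sy
  | bit (b : Bool) | u | fin | commaN | commaC (m : Bool) | commaW | tb | ket (m : Bool) | bra
  | q | tick | a (t : Bool) | x (t : Bool) | cu | cell (m : Bool)
  deriving Fintype

/-- The roles of the numbers in an instance: denominator, numerator, other numbers outside of the
table, edge weights and vertex weights. -/
inductive Role
  | den | num | pre | c | w

/-- The separator in front of a number. -/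
def Role.comma : Role → Sy
  | .den => .commaN
  | .num => .commaN
  | .pre => .commaN
  | .c => .commaC false
  | .w => .commaW

/-- The numbers in an instance; the vertices, and the numbers in `pre`, are listed in reverse. -/
structure CutData where
  n : ℕ
  ω : ℕ → ℕ
  c : ℕ → ℕ → ℕ
  den : ℕ
  num : ℕ
  pre : List ℕ

/-- The numbers that occur in a certain role. -/
def CutData.Occ (d : CutData) : Role → ℕ → Prop
  | .den, m => m = d.den
  | .num, m => m = d.num
  | .pre, m => m ∈ d.pre
  | .c, m => ∃ i < d.n, ∃ j < d.n, m = d.c i j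
  | .w, m => ∃ i < d.n, m = d.ω i

/-- The word of an instance (in reverse order), where the numbers are written according to `f`. -/
def lay (f : Role → ℕ → List Sy) (d : CutData) : List Sy :=
  f .den d.den ++ f .num d.num ++ d.pre.flatMap (f .pre) ++ Sy.tb ::
    (List.range d.n).flatMap fun i => Sy.ket false ::
      ((List.range d.n).flatMap (fun j => f .c (d.c i j)) ++ f .w (d.ω i) ++ [Sy.bra])

theorem flatMap_congr' {α β : Type} {l : List α} {f g : α → List β} (h : ∀ a ∈ l, f a = g a) :
    l.flatMap f = l.flatMap g := by
  induction l with
  | nil => rfl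
  | cons a l ih =>
    rw [List.flatMap_cons, List.flatMap_cons, h a (by simp), ih fun b hb => h b (by simp [hb])]

theorem lay_congr {f g : Role → ℕ → List Sy} {d : CutData}
    (h : ∀ ρ m, d.Occ ρ m → f ρ m = g ρ m) : lay f d = lay g d := by
  unfold lay
  rw [h .den _ rfl, h .num _ rfl, flatMap_congr' fun m hm => h .pre m hm]
  congr 2
  refine flatMap_congr' fun i hi => ?_
  rw [List.mem_range] at hi
  rw [h .w _ ⟨i, hi, rfl⟩,
    flatMap_congr' fun j hj => h .c _ ⟨i, hi, j, List.mem_range.1 hj, rfl⟩]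

theorem lay_flatMap (f : Role → ℕ → List Sy) (g : Sy → List Sy) (d : CutData)
    (h₁ : g .tb = [.tb]) (h₂ : g (.ket false) = [.ket false]) (h₃ : g .bra = [.bra]) :
    (lay f d).flatMap g = lay (fun ρ m => (f ρ m).flatMap g) d := by
  simp [lay, List.flatMap_append, List.flatMap_assoc, h₁, h₂, h₃]

theorem run_flatMap {S A B α : Type} (tr : S → A → S × List B) {l : List α} {f : α → List A}
    {g : α → List B} (h : ∀ a ∈ l, ∀ s, run tr s (f a) = g a) (s : S) :
    run tr s (l.flatMap f) = l.flatMap g := by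
  induction l generalizing s with
  | nil => rfl
  | cons a l ih =>
    rw [List.flatMap_cons, List.flatMap_cons, run_append, h a (by simp),
      ih fun b hb => h b (by simp [hb])]

/-- The hypothesis for all states `s` suits transducers that are reset by the separator in front of
each number: the numbers are then processed independently. -/
theorem run_lay {S : Type} {tr : S → Sy → S × List Sy} {f g : Role → ℕ → List Sy} {d : CutData}
    (h : ∀ ρ m, d.Occ ρ m → ∀ s, run tr s (f ρ m) = g ρ m) (h₁ : ∀ s, (tr s .tb).2 = [.tb])
    (h₂ : ∀ s, (tr s (.ket false)).2 = [.ket false]) (h₃ : ∀ s, (tr s .bra).2 = [.bra]) (s : S) :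
    run tr s (lay f d) = lay g d := by
  simp only [lay, run_append, run_cons, h .den _ rfl, h .num _ rfl,
    run_flatMap tr (fun m hm => h .pre m hm), h₁, List.singleton_append]
  congr 2
  refine run_flatMap tr (fun i hi s => ?_) _
  rw [List.mem_range] at hi
  rw [run_cons, h₂, run_append, run_append,
    run_flatMap tr fun j hj => h .c _ ⟨i, hi, j, List.mem_range.1 hj, rfl⟩,
    h .w _ ⟨i, hi, rfl⟩, run_cons, h₃, run_nil, List.append_nil, List.singleton_append]

theorem length_flatMap_le {α β γ : Type} {l : List α} {f : α → List β} {g : α → List γ} {B : ℕ}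
    (h : ∀ a ∈ l, (g a).length ≤ (f a).length * B) :
    (l.flatMap g).length ≤ (l.flatMap f).length * B := by
  induction l with
  | nil => simp
  | cons a l ih =>
    rw [List.flatMap_cons, List.flatMap_cons, List.length_append, List.length_append, add_mul]
    exact add_le_add (h a (by simp)) (ih fun b hb => h b (by simp [hb]))

/-- Every nonempty number word of the old layout pays for the at most `B` letters that replace it.
This supplies the length bounds required by `PT.iterate`. -/
theorem length_lay_le {f g : Role → ℕ → List Sy} {d : CutData} {B : ℕ} (hB : 1 ≤ B)
    (hf : ∀ ρ m, f ρ m ≠ []) (h : ∀ ρ m, d.Occ ρ m → (g ρ m).length ≤ B) :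
    (lay g d).length ≤ (lay f d).length * B := by
  have h' : ∀ ρ m, d.Occ ρ m → (g ρ m).length ≤ (f ρ m).length * B := fun ρ m hm =>
    (h ρ m hm).trans (Nat.le_mul_of_pos_left _ (List.length_pos_of_ne_nil (hf ρ m)))
  simp only [lay, List.length_append, List.length_cons, add_mul, one_mul]
  refine add_le_add (add_le_add (add_le_add (h' _ _ rfl) (h' _ _ rfl))
    (length_flatMap_le fun m hm => h' _ _ hm)) (add_le_add (length_flatMap_le fun i hi => ?_) hB)
  rw [List.mem_range] at hi
  simp only [List.length_append, List.length_cons, List.length_nil, add_mul, one_mul,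
    zero_add]
  exact add_le_add (add_le_add (add_le_add (length_flatMap_le fun j hj =>
    h' _ _ ⟨i, hi, j, List.mem_range.1 hj, rfl⟩) (h' _ _ ⟨i, hi, rfl⟩)) hB) hB

theorem length_le_flatMap {α β : Type} {l : List α} {f : α → List β} {a : α} (h : a ∈ l) :
    (f a).length ≤ (l.flatMap f).length := by
  obtain ⟨s, t, rfl⟩ := List.append_of_mem h
  simp only [List.flatMap_append, List.flatMap_cons, List.length_append]
  omega

theorem length_le_lay (f : Role → ℕ → List Sy) {d : CutData} {ρ : Role} {m : ℕ}
    (h : d.Occ ρ m) : (f ρ m).length ≤ (lay f d).length := by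
  simp only [lay, List.length_append, List.length_cons]
  cases ρ with
  | den => cases h; omega
  | num => cases h; omega
  | pre => have := length_le_flatMap (f := f .pre) h; omega
  | c =>
    obtain ⟨i, hi, j, hj, rfl⟩ := h
    have h1 := length_le_flatMap (f := fun j => f .c (d.c i j)) (List.mem_range.2 hj)
    have h2 := length_le_flatMap (f := fun i => Sy.ket false ::
      ((List.range d.n).flatMap (fun j => f .c (d.c i j)) ++ f .w (d.ω i) ++ [Sy.bra]))
      (List.mem_range.2 hi)
    simp only [List.length_append, List.length_cons] at h1 h2
    omega
  | w =>
    obtain ⟨i, hi, rfl⟩ := h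
    have h2 := length_le_flatMap (f := fun i => Sy.ket false ::
      ((List.range d.n).flatMap (fun j => f .c (d.c i j)) ++ f .w (d.ω i) ++ [Sy.bra]))
      (List.mem_range.2 hi)
    simp only [List.length_append, List.length_cons] at h2
    omega

/-! ### Binary digits -/

theorem encodeNat_foldr (m : ℕ) :
    (encodeNat m).foldr (fun b acc => 2 * acc + b.toNat) 0 = m := by
  have key : ∀ p : PosNum, (encodePosNum p).foldr (fun b acc => 2 * acc + b.toNat) 0 = (p : ℕ) := by
    intro p
    induction p with
    | one => rfl
    | bit1 p ih => simp only [encodePosNum, List.foldr_cons, ih, PosNum.cast_bit1]; simp [two_mul]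
    | bit0 p ih => simp only [encodePosNum, List.foldr_cons, ih, PosNum.cast_bit0]; simp [two_mul]
  have h : ((m : Num) : ℕ) = m := Num.to_of_nat m
  unfold encodeNat
  conv_rhs => rw [← h]
  cases (m : Num) with
  | zero => rfl
  | pos p => exact key p

theorem encodeNat_zero : encodeNat 0 = [] := rfl

theorem encodeNat_pos {m : ℕ} (hm : 0 < m) :
    encodeNat m = decide (m % 2 = 1) :: encodeNat (m / 2) := by
  have hpos : ∀ p : PosNum, encodeNat (p : ℕ) = encodePosNum p := by
    intro p
    unfold encodeNat
    rw [PosNum.of_to_nat p]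
    rfl
  have key : ∀ p : PosNum, encodePosNum p =
      decide ((p : ℕ) % 2 = 1) :: encodeNat ((p : ℕ) / 2) := by
    intro p
    cases p with
    | one => rfl
    | bit1 p =>
      have h1 : ((PosNum.bit1 p : PosNum) : ℕ) = p + p + 1 := PosNum.cast_bit1 p
      rw [show ((PosNum.bit1 p : PosNum) : ℕ) / 2 = p by omega, hpos, h1]
      simp only [encodePosNum, List.cons.injEq, and_true]
      symm
      rw [decide_eq_true_eq]; omega
    | bit0 p =>
      have h1 : ((PosNum.bit0 p : PosNum) : ℕ) = p + p := PosNum.cast_bit0 p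
      rw [show ((PosNum.bit0 p : PosNum) : ℕ) / 2 = p by omega, hpos, h1]
      simp only [encodePosNum, List.cons.injEq, and_true]
      symm
      rw [decide_eq_false_iff_not]; omega
  have h : ((m : Num) : ℕ) = m := Num.to_of_nat m
  cases hn : (m : Num) with
  | zero => rw [hn] at h; simp at h; omega
  | pos p =>
    rw [hn] at h
    have h' : (p : ℕ) = m := h
    rw [← h', hpos]
    exact key p

theorem length_encodeNat_le (m : ℕ) : (encodeNat m).length ≤ m := by
  induction m using Nat.strong_induction_on with
  | _ m ih =>
    rcases Nat.eq_zero_or_pos m with rfl | hm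
    · simp [encodeNat_zero]
    · rw [encodeNat_pos hm, List.length_cons]
      have := ih (m / 2) (by omega)
      omega

end PolyTime

/-! ## From binary to unary numbers -/

namespace PolyTime

open Computability InstanceCode

variable {D : Type}

/-- The word of an instance as it is given. -/
def inWord (d : CutData) : List Γ' :=
  (List.range d.n).reverse.flatMap (fun i => Γ'.bra :: (encNat (d.ω i) ++
    (List.range d.n).reverse.flatMap (fun j => encNat (d.c i j)) ++ [Γ'.ket])) ++
  encNats (d.pre.reverse ++ [d.num, d.den])

/-- The part of the word that is read by the first transducer: before a number outside of the
table, after such a number, at a vertex weight, at an edge weight. -/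
inductive Zone
  | before | after | vertex | edge
  deriving DecidableEq

instance : Fintype Zone where
  elems := {.before, .after, .vertex, .edge}
  complete z := by cases z <;> simp

/-- The zone after a number. -/
def Zone.next : Zone → Zone
  | .before => .after
  | .after => .after
  | .vertex => .edge
  | .edge => .edge

/-- The separator of the numbers in a zone. -/
def Zone.comma : Zone → Sy
  | .before => .commaN
  | .after => .commaN
  | .vertex => .commaW
  | .edge => .commaC false

/-- The letters at the beginning of a number. -/
def Zone.start : Zone → List Sy
  | .before => [.tb, .fin]
  | _ => [.fin]

/-- The transducer that marks the ends and the kinds of the numbers; its state holds the zone and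
whether some digits of the current number have been read. -/
def markTr : Zone × Bool → Γ' → (Zone × Bool) × List Sy
  | _, .bra => ((.vertex, false), [.bra])
  | _, .ket => ((.before, false), [.ket false])
  | (z, m), .bit b => ((if z = .before then .after else z, true),
      (if m then [] else z.start) ++ [.bit b])
  | (z, m), .comma => ((z.next, false), (if m then [] else z.start) ++ [z.comma])
  | s, .blank => (s, [])

theorem run_markTr_bits (z : Zone) (hz : z ≠ .before) (bs : List Bool) (l : List Γ') :
    run markTr (z, true) (bs.map Γ'.bit ++ Γ'.comma :: l) =
      bs.map Sy.bit ++ z.comma :: run markTr (z.next, false) l := by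
  induction bs with
  | nil => simp [markTr]
  | cons b bs ih => simp [markTr, hz, ih]

theorem run_markTr_encNat (z : Zone) (m : ℕ) (l : List Γ') :
    run markTr (z, false) (encNat m ++ l) =
      z.start ++ (encodeNat m).map Sy.bit ++ z.comma :: run markTr (z.next, false) l := by
  rw [encNat]
  cases encodeNat m with
  | nil => simp [markTr]
  | cons b bs =>
    rw [List.append_assoc, List.singleton_append, List.map_cons, List.cons_append, run_cons]
    by_cases h : z = .before
    · subst h
      have := run_markTr_bits .after (by simp) bs l
      simp only [markTr, if_true, Bool.false_eq_true, if_false, this]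
      simp [Zone.comma, Zone.next]
    · have := run_markTr_bits z h bs l
      simp [markTr, h, this]

theorem run_markTr_encNats (z : Zone) (h : z = .after ∨ z = .edge) (k : List ℕ) (l : List Γ') :
    run markTr (z, false) (k.flatMap encNat ++ l) =
      k.flatMap (fun m => Sy.fin :: (encodeNat m).map Sy.bit ++ [z.comma]) ++
        run markTr (z, false) l := by
  have h1 : z.start = [.fin] := by rcases h with rfl | rfl <;> rfl
  have h2 : z.next = z := by rcases h with rfl | rfl <;> rfl
  induction k with
  | nil => rfl
  | cons m k ih =>
    rw [List.flatMap_cons, List.append_assoc, run_markTr_encNat, h1, h2, ih]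
    simp

/-- The layout of numbers in binary, with the most significant digit first. -/
def layBin (ρ : Role) (m : ℕ) : List Sy :=
  ρ.comma :: (encodeNat m).reverse.map Sy.bit ++ [.fin]

theorem flatMap_reverse {α β : Type} (l : List α) (f : α → List β) :
    (l.flatMap f).reverse = l.reverse.flatMap fun a => (f a).reverse := by
  rw [List.reverse_flatMap]; rfl

/-- The marker emitted before the digits becomes the end of the number after the reversal, and the
comma behind them becomes its separator. Rows, columns and outer numbers come out in reverse order,
with the most significant digits first, as Horner's rule requires. -/
theorem run_markTr (d : CutData) :
    (run markTr (.before, false) (inWord d)).reverse = lay layBin d := by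
  have rows : ∀ (l : List ℕ) (r : List Γ'), run markTr (.before, false)
      (l.flatMap (fun i => Γ'.bra :: (encNat (d.ω i) ++
        (List.range d.n).reverse.flatMap (fun j => encNat (d.c i j)) ++ [Γ'.ket])) ++ r) =
      l.flatMap (fun i => ((Sy.ket false ::
        ((List.range d.n).flatMap (fun j => layBin .c (d.c i j)) ++ layBin .w (d.ω i) ++
          [Sy.bra]))).reverse) ++ run markTr (.before, false) r := by
    intro l r
    induction l with
    | nil => rfl
    | cons i l ih =>
      have e : (List.range d.n).reverse.flatMap (fun j => encNat (d.c i j)) =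
          ((List.range d.n).reverse.map (d.c i)).flatMap encNat := by rw [List.flatMap_map]
      rw [List.flatMap_cons, List.append_assoc, List.cons_append, run_cons, List.append_assoc,
        List.append_assoc]
      simp only [markTr]
      rw [run_markTr_encNat, e, show Zone.vertex.next = .edge from rfl,
        run_markTr_encNats .edge (Or.inr rfl), List.singleton_append (x := Γ'.ket), run_cons]
      simp only [markTr]
      rw [ih, List.flatMap_map]
      simp [layBin, flatMap_reverse, Zone.start, Zone.comma, Role.comma]
  rw [inWord, rows]
  have nums : run markTr (.before, false) (encNats (d.pre.reverse ++ [d.num, d.den])) =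
      Sy.tb :: (d.pre.reverse ++ [d.num, d.den]).flatMap
        (fun m => Sy.fin :: (encodeNat m).map Sy.bit ++ [.commaN]) := by
    -- The letter `tb` is emitted at the first number outside of the table, so there has to be one;
    -- numerator and denominator are always present.
    have : ∀ k : List ℕ, k ≠ [] → run markTr (.before, false) (encNats k) =
        Sy.tb :: k.flatMap (fun m => Sy.fin :: (encodeNat m).map Sy.bit ++ [.commaN]) := by
      intro k hk
      cases k with
      | nil => exact absurd rfl hk
      | cons m k =>
        have := run_markTr_encNats .after (Or.inl rfl) k []
        simp only [List.append_nil, run_nil] at this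
        rw [encNats, List.flatMap_cons, run_markTr_encNat, show Zone.before.next = .after from rfl,
          this]
        simp [Zone.start, Zone.comma]
    exact this _ (by simp)
  rw [nums]
  simp only [lay, layBin, flatMap_reverse, Role.comma, List.reverse_cons, List.reverse_append,
    List.reverse_reverse, List.flatMap_append, List.flatMap_cons, List.flatMap_nil]
  simp [flatMap_congr' (g := layBin .pre)
    (fun m _ => show Sy.commaN :: (((encodeNat m).map Sy.bit).reverse ++ [Sy.fin]) = _ by
      simp [layBin, Role.comma])]

theorem PT.mark (d : D → CutData) :
    PT (fun x => inWord (d x)) (fun x => lay layBin (d x)) := by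
  refine (PT.mealy_reverse markTr (.before, false) [] _).of_eq fun x => ?_
  rw [List.append_nil, run_markTr]

/-- The transducer that moves the first digit of each binary number to its unary part: `some none`
at the beginning of a number, `some (some b)` after the digit `b` has been removed. -/
def unaryTr : Option (Option Bool) → Sy → Option (Option Bool) × List Sy
  | _, .commaN => (some none, [.commaN])
  | _, .commaC m => (some none, [.commaC m])
  | _, .commaW => (some none, [.commaW])
  | some none, .bit b => (some (some b), [])
  | some (some b), .u => (some (some b), [.u, .u])
  | some (some true), .fin => (none, [.u, .fin])
  | some (some false), .bit b => (some (some false), [.bit b])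
  | some (some true), .bit b => (some (some true), [.bit b])
  | none, .bit b => (none, [.bit b])
  | _, l => (none, [l])

/-- A number whose first digits have been converted to unary. -/
def layMixed (bs : List Bool) (acc : ℕ) (ρ : Role) : List Sy :=
  ρ.comma :: bs.map Sy.bit ++ List.replicate acc .u ++ [.fin]

/-- Horner's rule. -/
def horner (acc : ℕ) (b : Bool) : ℕ := 2 * acc + b.toNat

/-- One pass performs one step of Horner's rule on every number: the first remaining digit is
erased, the units are doubled, and the digit is added at the end marker. Without remaining digits
nothing changes, so surplus passes are harmless. -/
theorem run_unaryTr (s : Option (Option Bool)) (ρ : Role) (bs : List Bool) (acc : ℕ) :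
    run unaryTr s (layMixed bs acc ρ) = layMixed bs.tail ((bs.take 1).foldl horner acc) ρ := by
  have hc : unaryTr s ρ.comma = (some none, [ρ.comma]) := by cases ρ <;> cases s <;> rfl
  have h0 : ∀ acc, run unaryTr none (List.replicate acc .u ++ [.fin]) =
      List.replicate acc .u ++ [.fin] := by
    intro acc
    induction acc with
    | zero => rfl
    | succ acc ih => simp [List.replicate_succ, unaryTr, ih]
  have h1 : ∀ b acc, run unaryTr (some (some b)) (List.replicate acc .u ++ [.fin]) =
      List.replicate (horner acc b) .u ++ [.fin] := by
    intro b acc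
    induction acc with
    | zero => cases b <;> rfl
    | succ acc ih =>
      have : horner (acc + 1) b = horner acc b + 1 + 1 := by unfold horner; ring
      simp [List.replicate_succ, unaryTr, ih, this]
  have h2 : ∀ b (bs : List Bool) l, run unaryTr (some (some b)) (bs.map Sy.bit ++ l) =
      bs.map Sy.bit ++ run unaryTr (some (some b)) l := by
    intro b bs l
    induction bs with
    | nil => rfl
    | cons b' bs ih => cases b <;> simp [unaryTr, ih]
  cases bs with
  | nil =>
    have h3 : run unaryTr (some none) (List.replicate acc .u ++ [.fin]) =
        List.replicate acc .u ++ [.fin] := by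
      cases acc with
      | zero => rfl
      | succ acc => simp [List.replicate_succ, unaryTr, h0]
    simp [layMixed, hc, h3]
  | cons b bs =>
    have : unaryTr (some none) (.bit b) = (some (some b), []) := rfl
    simp [layMixed, hc, this, h2, h1]

theorem iterate_lay {S : Type} {tr : S → Sy → S × List Sy} {s₀ : S}
    {F : ℕ → Role → ℕ → List Sy} {d : CutData}
    (h : ∀ j ρ m, d.Occ ρ m → ∀ s, run tr s (F j ρ m) = F (j + 1) ρ m)
    (h₁ : ∀ s, (tr s .tb).2 = [.tb]) (h₂ : ∀ s, (tr s (.ket false)).2 = [.ket false])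
    (h₃ : ∀ s, (tr s .bra).2 = [.bra]) (j : ℕ) :
    (run tr s₀)^[j] (lay (F 0) d) = lay (F j) d := by
  induction j with
  | zero => rfl
  | succ j ih => rw [Function.iterate_succ_apply', ih, run_lay (h j) h₁ h₂ h₃]

/-- The layout of numbers in unary. -/
def layUnary (ρ : Role) (m : ℕ) : List Sy := ρ.comma :: List.replicate m .u ++ [.fin]

theorem horner_mono (acc : ℕ) (bs : List Bool) : acc ≤ bs.foldl horner acc := by
  induction bs generalizing acc with
  | nil => exact le_rfl
  | cons b bs ih => exact (show acc ≤ horner acc b by unfold horner; omega).trans (ih _)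

theorem horner_encodeNat (m : ℕ) : (encodeNat m).reverse.foldl horner 0 = m := by
  rw [List.foldl_reverse]; exact encodeNat_foldr m

/-- This is where strong NP-completeness is used: `hp` keeps the unary words polynomially long. The
word has at least as many letters as any of its numbers has digits, so as many passes as there are
letters suffice. -/
theorem PT.unary (d : D → CutData) (p : Polynomial ℕ)
    (hp : ∀ x ρ m, (d x).Occ ρ m → m ≤ p.eval (lay layBin (d x)).length) :
    PT (fun x => lay layBin (d x)) (fun x => lay layUnary (d x)) := by
  let F : ℕ → Role → ℕ → List Sy := fun j ρ m =>
    layMixed ((encodeNat m).reverse.drop j) (((encodeNat m).reverse.take j).foldl horner 0) ρ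
  have hF0 : F 0 = layBin := by
    funext ρ m
    simp [F, layMixed, layBin]
  have hit : ∀ x j, (run unaryTr none)^[j] (lay layBin (d x)) = lay (F j) (d x) := by
    intro x j
    rw [← hF0]
    refine iterate_lay (fun j ρ m _ s => ?_) (fun s => ?_) (fun s => ?_) (fun s => ?_) j
    · simp only [F]
      rw [run_unaryTr, List.tail_drop, ← List.foldl_append]
      congr 2
      rw [List.take_add]
    all_goals rcases s with _ | _ | _ | _ <;> rfl
  have hlen : ∀ j ρ m, (F j ρ m).length ≤ 2 * m + 2 := by
    intro j ρ m
    have h1 : ((encodeNat m).reverse.take j).foldl horner 0 ≤ m := by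
      refine (horner_mono _ ((encodeNat m).reverse.drop j)).trans ?_
      rw [← List.foldl_append, List.take_append_drop, horner_encodeNat]
    have h2 := length_encodeNat_le m
    simp only [F, layMixed, List.length_append, List.length_cons, List.length_map,
      List.length_drop, List.length_reverse, List.length_replicate, List.length_nil]
    omega
  refine (PT.iterate unaryTr none _ (Polynomial.X * (Polynomial.C 2 * p + Polynomial.C 2))
    fun x j _ => ?_).of_eq fun x => ?_
  · rw [hit]
    simp only [Polynomial.eval_add, Polynomial.eval_mul, Polynomial.eval_X, Polynomial.eval_C]
    refine length_lay_le (by omega) (by simp [layBin]) fun ρ m hm => (hlen j ρ m).trans ?_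
    have := hp x ρ m hm
    omega
  · rw [hit]
    refine lay_congr fun ρ m hm => ?_
    have h1 := length_le_lay layBin hm
    have h2 : (encodeNat m).reverse.length ≤ (lay layBin (d x)).length := by
      simp only [layBin, List.length_append, List.length_cons, List.length_map] at h1
      omega
    simp only [F]
    rw [List.drop_eq_nil_of_le h2, List.take_of_length_le h2, horner_encodeNat]
    simp [layMixed, layUnary]

/-! ## Multiplication of the vertex weights and of the denominator -/

/-- The part of the word that is read by the second transducer: before the denominator, at the
denominator, at the numerator, at other numbers, between the numbers of the table, at an edge
weight, at a vertex weight. -/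
inductive Part
  | start | den | num | pre | table | edge | vertex
  deriving DecidableEq

instance : Fintype Part where
  elems := {.start, .den, .num, .pre, .table, .edge, .vertex}
  complete z := by cases z <;> simp

/-- The transducer that gives names to the units of the numbers. -/
def tagTr : Part → Sy → Part × List Sy
  | .start, .commaN => (.den, [.commaN])
  | .den, .commaN => (.num, [.commaN])
  | _, .commaN => (.pre, [.commaN])
  | _, .commaC m => (.edge, [.commaC m])
  | _, .commaW => (.vertex, [.commaW])
  | .den, .u => (.den, [.a false])
  | .num, .u => (.num, [.q])
  | .pre, .u => (.pre, [.u])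
  | .edge, .u => (.edge, [.cu])
  | .vertex, .u => (.vertex, [.a true])
  | .edge, .fin => (.edge, [])
  | .vertex, .fin => (.vertex, [])
  | s, .fin => (s, [.fin])
  | _, l => (.table, [l])

/-- The name of the units of a number. -/
def Role.unit : Role → Sy
  | .den => .a false
  | .num => .q
  | .pre => .u
  | .c => .cu
  | .w => .a true

/-- The end of a number. -/
def Role.closing : Role → List Sy
  | .den => [.fin]
  | .num => [.fin]
  | .pre => [.fin]
  | .c => []
  | .w => []

/-- The layout of numbers in unary, with different kinds of units. -/
def layTag (ρ : Role) (m : ℕ) : List Sy := ρ.comma :: List.replicate m ρ.unit ++ ρ.closing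

/-- The part of the word at a number. -/
def Role.part : Role → Part
  | .den => .den
  | .num => .num
  | .pre => .pre
  | .c => .edge
  | .w => .vertex

theorem run_tagTr (ρ : Role) (m : ℕ) (s : Part) (h : tagTr s ρ.comma = (ρ.part, [ρ.comma]))
    (l : List Sy) : run tagTr s (layUnary ρ m ++ l) = layTag ρ m ++ run tagTr ρ.part l := by
  have h0 : run tagTr ρ.part (List.replicate m .u ++ Sy.fin :: l) =
      List.replicate m ρ.unit ++ ρ.closing ++ run tagTr ρ.part l := by
    induction m with
    | zero => cases ρ <;> rfl
    | succ m ih =>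
      rw [List.replicate_succ, List.replicate_succ, List.cons_append, run_cons]
      cases ρ <;> simp only [Role.part, tagTr, List.cons_append, List.nil_append] <;>
        exact congrArg _ ih
  simp only [layUnary, layTag, List.cons_append, run_cons, h, List.append_assoc,
    List.nil_append, h0]

theorem run_tagTr_flatMap (ρ : Role) {α : Type} (g : α → ℕ) (k : List α) (s : Part)
    (hs : tagTr s ρ.comma = (ρ.part, [ρ.comma]))
    (hs' : tagTr ρ.part ρ.comma = (ρ.part, [ρ.comma])) (l : List Sy) :
    ∃ s', run tagTr s (k.flatMap (fun m => layUnary ρ (g m)) ++ l) =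
      k.flatMap (fun m => layTag ρ (g m)) ++ run tagTr s' l ∧ (s' = s ∨ s' = ρ.part) := by
  induction k generalizing s with
  | nil => exact ⟨s, rfl, Or.inl rfl⟩
  | cons m k ih =>
    obtain ⟨s', h, h'⟩ := ih ρ.part hs'
    refine ⟨s', ?_, Or.inr (by tauto)⟩
    rw [List.flatMap_cons, List.append_assoc, run_tagTr ρ _ s hs, h, List.flatMap_cons,
      List.append_assoc]

/-- The outer numbers carry the same separator and are told apart by position only: first the
denominator, then the numerator, then the rest. The state is therefore not reset by separators, and
`run_lay` does not apply. -/
theorem run_tagTr_lay (d : CutData) : run tagTr .start (lay layUnary d) = lay layTag d := by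
  have rows : ∀ s, run tagTr s ((List.range d.n).flatMap fun i => Sy.ket false ::
      ((List.range d.n).flatMap (fun j => layUnary .c (d.c i j)) ++ layUnary .w (d.ω i) ++
        [Sy.bra])) = (List.range d.n).flatMap fun i => Sy.ket false ::
      ((List.range d.n).flatMap (fun j => layTag .c (d.c i j)) ++ layTag .w (d.ω i) ++
        [Sy.bra]) := by
    intro s
    refine run_flatMap tagTr (fun i _ s => ?_) s
    have h1 : tagTr s (.ket false) = (.table, [.ket false]) := by cases s <;> rfl
    obtain ⟨s', h, hs'⟩ := run_tagTr_flatMap .c (d.c i) (List.range d.n) .table rfl rfl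
      (layUnary .w (d.ω i) ++ [Sy.bra])
    have h2 : tagTr s' Role.w.comma = (Role.w.part, [Role.w.comma]) := by
      rcases hs' with rfl | rfl <;> rfl
    rw [run_cons, h1, List.append_assoc, h, run_tagTr .w _ s' h2]
    simp [Role.part, tagTr]
  obtain ⟨s', h, -⟩ := run_tagTr_flatMap .pre id d.pre .num rfl rfl
    (Sy.tb :: (List.range d.n).flatMap fun i => Sy.ket false ::
      ((List.range d.n).flatMap (fun j => layUnary .c (d.c i j)) ++ layUnary .w (d.ω i) ++
        [Sy.bra]))
  have h1 : (tagTr s' .tb).2 = [.tb] := by cases s' <;> rfl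
  simp only [id] at h
  rw [lay, lay, List.append_assoc, List.append_assoc, run_tagTr .den _ .start rfl,
    run_tagTr .num _ Role.den.part rfl, show Role.num.part = .num from rfl,
    show (fun m => layUnary .pre m) = layUnary .pre from rfl] at *
  rw [h, run_cons, h1, rows]
  simp

/-- The output stays reversed because `PT.pump` appends the ticks at the end, while the
multiplication wants them in front. -/
theorem PT.tag (d : D → CutData) :
    PT (fun x => lay layUnary (d x)) (fun x => (lay layTag (d x)).reverse) := by
  refine (PT.mealy_reverse tagTr .start [] _).of_eq fun x => ?_
  rw [List.append_nil, run_tagTr_lay]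

end PolyTime

/-! ## Multiplication by a multiple of the numerator -/

namespace PolyTime

open Computability InstanceCode

variable {D : Type}

/-- Copies of the units of the numerator. -/
def tickOf : Sy → List Sy
  | .q => [.tick]
  | .tick => [.tick]
  | _ => []

/-- The number of units of the numerator and of their copies. -/
def ticks (w : List Sy) : ℕ := (w.flatMap tickOf).length

theorem flatMap_tickOf (w : List Sy) : w.flatMap tickOf = List.replicate (ticks w) .tick := by
  refine List.eq_replicate_of_mem fun b hb => ?_
  obtain ⟨a, -, h⟩ := List.mem_flatMap.1 hb
  cases a <;> simp_all [tickOf]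

theorem ticks_le (w : List Sy) : ticks w ≤ w.length := by
  have := length_flatMap_le (l := w) (f := fun a => [a]) (g := tickOf) (B := 1) fun a _ => by
    cases a <;> simp [tickOf]
  simpa [ticks, ← List.map_eq_flatMap] using this

theorem ticks_append (v w : List Sy) : ticks (v ++ w) = ticks v + ticks w := by
  simp [ticks]

theorem ticks_replicate (n : ℕ) : ticks (List.replicate n .tick) = n := by
  induction n with
  | zero => rfl
  | succ n ih =>
    rw [List.replicate_succ', ticks_append, ih]; rfl

/-- The first pass erases everything but the ticks, and further passes change nothing. Concatenating
the orbit of `w` thus gives `w` followed by `w.length` copies of its ticks, which is a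
multiplication of two lengths. -/
theorem iterate_flatMap_tickOf (w : List Sy) (j : ℕ) :
    (run (subst tickOf) ())^[j + 1] w = List.replicate (ticks w) .tick := by
  induction j with
  | zero => simp [run_subst, flatMap_tickOf]
  | succ j ih =>
    rw [Function.iterate_succ_apply', ih, run_subst, flatMap_tickOf, ticks_replicate]

theorem flatMap_toList_blk {A : Type} (bs : List (List A)) :
    (blk bs).flatMap Option.toList = bs.flatten := by
  induction bs with
  | nil => rfl
  | cons b bs ih =>
    have : blk (b :: bs) = b.map some ++ none :: blk bs := by simp [blk]
    rw [this, List.flatMap_append, List.flatMap_cons, ih, List.flatMap_map, List.flatten_cons]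
    congr 1
    exact List.flatMap_singleton' b

/-- A word can be extended by copies of the units of the numerator. -/
theorem PT.pump (e : D → List Sy) :
    PT e (fun x => e x ++ List.replicate ((e x).length * ticks (e x)) .tick) := by
  refine (PT.block e).trans ((PT.orbit (PolyTime.subst tickOf) () (fun x => [e x]) Polynomial.X
    fun x b hb j _ => ?_).trans ((PT.subst Option.toList _).of_eq fun x => ?_))
  · rw [List.mem_singleton] at hb
    subst hb
    rw [Polynomial.eval_X]
    refine le_trans ?_ (length_le_blk (List.mem_singleton_self (e x)))
    cases j with
    | zero => exact le_rfl
    | succ j => rw [iterate_flatMap_tickOf, List.length_replicate]; exact ticks_le _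
  · rw [flatMap_toList_blk, List.flatMap_cons, List.flatMap_nil, List.append_nil, orb,
      List.range_succ_eq_map, List.map_cons, List.flatten_cons, List.map_map]
    congr 1
    have : ∀ n, (List.map ((fun i => (run (PolyTime.subst tickOf) ())^[i] (e x)) ∘ Nat.succ)
        (List.range n)).flatten = List.replicate (n * ticks (e x)) .tick := by
      intro n
      induction n with
      | zero => simp
      | succ n ih =>
        rw [List.range_succ, List.map_append, List.flatten_append, ih]
        simp only [List.map_cons, List.map_nil, List.flatten_cons, List.flatten_nil,
          List.append_nil, Function.comp_apply, iterate_flatMap_tickOf, ← List.replicate_add]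
        congr 1
        ring
    exact this _

theorem ticks_lay (d : CutData) : ticks (lay layTag d) = d.num := by
  have h0 : ∀ ρ : Role, ρ ≠ .num → ∀ m, (layTag ρ m).flatMap tickOf = [] := by
    intro ρ hρ m
    simp only [layTag, List.flatMap_append, List.flatMap_cons, List.append_eq_nil_iff,
      List.flatMap_eq_nil_iff, List.mem_replicate]
    refine ⟨⟨by cases ρ <;> rfl, fun a ha => ?_⟩, fun a ha => ?_⟩
    · rw [ha.2]; cases ρ <;> first | rfl | exact absurd rfl hρ
    · cases ρ <;> simp_all [Role.closing, tickOf]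
  have h1 : (layTag .num d.num).flatMap tickOf = List.replicate d.num .tick := by
    have : ∀ m, (List.replicate m Sy.q).flatMap tickOf = List.replicate m .tick := by
      intro m
      induction m with
      | zero => rfl
      | succ m ih => rw [List.replicate_succ, List.flatMap_cons, ih]; rfl
    simp [layTag, Role.comma, Role.unit, Role.closing, tickOf, this]
  have h2 : d.pre.flatMap (fun m => (layTag .pre m).flatMap tickOf) = [] := by
    simp [h0 .pre]
  rw [ticks, lay]
  simp only [List.flatMap_append, List.flatMap_cons, List.flatMap_assoc, h0 .den (by simp),
    h0 .c (by simp), h0 .w (by simp), h1, h2]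
  simp [tickOf]

theorem ticks_reverse (w : List Sy) : ticks w.reverse = ticks w := by
  induction w with
  | nil => rfl
  | cons a w ih =>
    rw [List.reverse_cons, ticks_append, ih, add_comm]
    exact (ticks_append [a] w).symm

/-- The number of copies of the units of the numerator that are used. -/
def tickCount (d : CutData) : ℕ :=
  d.num * ((lay layTag d).length +
    (lay layTag d).length * (1 + d.num) * (1 + (lay layTag d).length))

/-- With `w` the length of the word, the first pump adds `w * num` ticks; the word then has length
`w * (1 + num)` and tick count `num * (1 + w)`, and the second pump adds their product. All counts
are multiples of `num`, and the second pump makes the cofactor exceed `w * w`. -/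
theorem PT.ticks (d : D → CutData) : PT (fun x => (lay layTag (d x)).reverse)
    (fun x => List.replicate (tickCount (d x)) .tick ++ lay layTag (d x)) := by
  refine (PT.pump _).trans ((PT.pump _).trans ((PT.reverse _).of_eq fun x => ?_))
  simp only [ticks_append, ticks_reverse, ticks_lay, ticks_replicate, List.length_append,
    List.length_reverse, List.length_replicate, List.reverse_append, List.reverse_replicate,
    List.reverse_reverse]
  rw [← List.append_assoc, ← List.replicate_add]
  congr 2
  simp only [tickCount]
  ring

/-- The transducer that removes the first `tick` and then adds a new unit to every unit of the
numbers to be multiplied. -/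
def mulTr : Bool → Sy → Bool × List Sy
  | false, .tick => (true, [])
  | true, .a t => (true, [.a t, .x t])
  | s, l => (s, [l])

/-- The effect of `j` rounds on a letter. -/
def mulLetter (j : ℕ) : Sy → List Sy
  | .a t => .a t :: List.replicate j (.x t)
  | l => [l]

theorem run_mulTr_true (w : List Sy) : run mulTr true w = w.flatMap (mulLetter 1) := by
  induction w with
  | nil => rfl
  | cons a w ih =>
    rw [run_cons, List.flatMap_cons, ← ih]
    cases a <;> rfl

theorem run_mulTr_false {w : List Sy} (h : Sy.tick ∉ w) : run mulTr false w = w := by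
  induction w with
  | nil => rfl
  | cons a w ih =>
    rw [List.mem_cons, not_or] at h
    rw [run_cons]
    have h1 : mulTr false a = (false, [a]) := by
      cases a <;> first | rfl | exact absurd rfl h.1
    rw [h1, ih h.2, List.singleton_append]

theorem mulLetter_zero (w : List Sy) : w.flatMap (mulLetter 0) = w := by
  have : mulLetter 0 = fun a => [a] := by funext a; cases a <;> rfl
  rw [this]; exact List.flatMap_singleton' w

theorem mulLetter_succ (w : List Sy) (j : ℕ) :
    (w.flatMap (mulLetter j)).flatMap (mulLetter 1) = w.flatMap (mulLetter (j + 1)) := by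
  have hx : ∀ (t : Bool) (j : ℕ), (List.replicate j (Sy.x t)).flatMap (mulLetter 1) =
      List.replicate j (Sy.x t) := by
    intro t j
    induction j with
    | zero => rfl
    | succ j ih => rw [List.replicate_succ, List.flatMap_cons, ih]; rfl
  rw [List.flatMap_assoc]
  refine flatMap_congr' fun a _ => ?_
  cases a <;> simp [mulLetter, hx, List.replicate_succ]

theorem tick_notMem_flatMap {w : List Sy} (h : Sy.tick ∉ w) (j : ℕ) :
    Sy.tick ∉ w.flatMap (mulLetter j) := by
  simp only [List.mem_flatMap, not_exists, not_and]
  intro a ha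
  cases a <;> simp_all [mulLetter]

/-- Each pass consumes one tick and inserts one `x` behind every `a`. The letters `x` are not
multiplied themselves, so growth is linear in the number of passes, and without ticks the word is
stationary. -/
theorem iterate_mulTr {w : List Sy} (h : Sy.tick ∉ w) (Z j : ℕ) :
    (run mulTr false)^[j] (List.replicate Z .tick ++ w) =
      List.replicate (Z - j) .tick ++ w.flatMap (mulLetter (min j Z)) := by
  induction j with
  | zero => simp [mulLetter_zero]
  | succ j ih =>
    rw [Function.iterate_succ_apply', ih]
    rcases Nat.lt_or_ge j Z with hj | hj
    · obtain ⟨k, hk⟩ : ∃ k, Z - j = k + 1 := ⟨Z - j - 1, by omega⟩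
      have h1 : (List.replicate k Sy.tick).flatMap (mulLetter 1) = List.replicate k Sy.tick := by
        have : mulLetter 1 Sy.tick = [Sy.tick] := rfl
        clear hk
        induction k with
        | zero => rfl
        | succ k ih => rw [List.replicate_succ, List.flatMap_cons, ih, this]; rfl
      rw [hk, List.replicate_succ, List.cons_append, run_cons,
        show mulTr false .tick = (true, []) from rfl, List.nil_append, run_mulTr_true,
        List.flatMap_append, h1, mulLetter_succ, show Z - (j + 1) = k by omega,
        min_eq_left (by omega : j ≤ Z), min_eq_left (by omega : j + 1 ≤ Z)]
    · rw [show Z - j = 0 by omega, show Z - (j + 1) = 0 by omega, min_eq_right hj,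
        min_eq_right (by omega : Z ≤ j + 1), List.replicate_zero, List.nil_append,
        run_mulTr_false (tick_notMem_flatMap h Z)]

theorem PT.mul (w : D → List Sy) (Z : D → ℕ) (h : ∀ x, Sy.tick ∉ w x) :
    PT (fun x => List.replicate (Z x) .tick ++ w x) (fun x => (w x).flatMap (mulLetter (Z x))) := by
  refine (PT.iterate mulTr false _ (Polynomial.X + Polynomial.X * (Polynomial.X + Polynomial.C 1))
    fun x j _ => ?_).of_eq fun x => ?_
  · rw [iterate_mulTr (h x)]
    simp only [List.length_append, List.length_replicate, Polynomial.eval_add,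
      Polynomial.eval_mul, Polynomial.eval_X, Polynomial.eval_C]
    refine add_le_add (by omega) ?_
    have h1 := length_flatMap_le (l := w x) (f := fun a => [a]) (g := mulLetter (min j (Z x)))
      (B := Z x + 1) fun a _ => by cases a <;> simp [mulLetter]
    rw [← List.map_eq_flatMap (f := fun a => a), List.length_map] at h1
    exact h1.trans (Nat.mul_le_mul (by omega) (by omega))
  · rw [iterate_mulTr (h x)]
    have : Z x ≤ (List.replicate (Z x) Sy.tick ++ w x).length := by simp
    rw [min_eq_right this, Nat.sub_eq_zero_of_le this, List.replicate_zero, List.nil_append]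

theorem tick_notMem_lay (d : CutData) : Sy.tick ∉ lay layTag d := by
  have h0 : ∀ ρ m, Sy.tick ∉ layTag ρ m := by
    intro ρ m
    cases ρ <;> simp [layTag, Role.comma, Role.unit, Role.closing]
  simp [lay, h0]

/-- The new names of the units after the multiplication. -/
def relabel : Sy → List Sy
  | .a false => [.u]
  | .x false => [.u]
  | .a true => [.cell false]
  | .x true => [.cell false]
  | .q => [.u]
  | l => [l]

/-- The layout of numbers in unary after a multiplication of the denominator and of the vertex
weights by `M`. -/
def layMul (M : ℕ) : Role → ℕ → List Sy
  | .den, m => .commaN :: List.replicate (m * M) .u ++ [.fin]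
  | .num, m => .commaN :: List.replicate m .u ++ [.fin]
  | .pre, m => .commaN :: List.replicate m .u ++ [.fin]
  | .c, m => .commaC false :: List.replicate m .cu
  | .w, m => .commaW :: List.replicate (m * M) (.cell false)

theorem flatMap_replicate_replicate {A B : Type} (f : A → List B) (a : A) (b : B) (k m : ℕ)
    (h : f a = List.replicate k b) :
    (List.replicate m a).flatMap f = List.replicate (m * k) b := by
  induction m with
  | zero => simp
  | succ m ih =>
    rw [List.replicate_succ, List.flatMap_cons, ih, h, ← List.replicate_add]
    congr 1; ring

/-- Each `a` together with its `Z` letters `x` becomes `Z + 1` units. This `+ 1` is what makes the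
factor congruent to `1` modulo the numerator. -/
theorem PT.relabel (d : D → CutData) (Z : D → ℕ) :
    PT (fun x => (lay layTag (d x)).flatMap (mulLetter (Z x)))
      (fun x => lay (layMul (Z x + 1)) (d x)) := by
  refine (PT.subst PolyTime.relabel _).of_eq fun x => ?_
  rw [lay_flatMap _ _ _ rfl rfl rfl, lay_flatMap _ _ _ rfl rfl rfl]
  congr 1
  funext ρ m
  rw [List.flatMap_assoc]
  have hrep : ∀ (n : ℕ) (t : Bool) (b : Sy), PolyTime.relabel (.x t) = [b] →
      (List.replicate n (Sy.x t)).flatMap PolyTime.relabel = List.replicate n b := by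
    intro n t b h
    simpa using flatMap_replicate_replicate PolyTime.relabel (.x t) b 1 n (by simpa using h)
  have ha : ∀ (t : Bool) (b : Sy), PolyTime.relabel (.x t) = [b] → PolyTime.relabel (.a t) = [b] →
      (mulLetter (Z x) (.a t)).flatMap PolyTime.relabel = List.replicate (Z x + 1) b := by
    intro t b h h'
    rw [mulLetter, List.flatMap_cons, hrep _ t b h, h', List.replicate_succ, List.singleton_append]
  have hl : ∀ l b : Sy, mulLetter (Z x) l = [l] → PolyTime.relabel l = [b] →
      (mulLetter (Z x) l).flatMap PolyTime.relabel = List.replicate 1 b := by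
    intro l b h h'
    rw [h, List.flatMap_singleton, h']; rfl
  let F : Sy → List Sy := fun a => (mulLetter (Z x) a).flatMap PolyTime.relabel
  have key : ∀ ρ, (layTag ρ m).flatMap F = F ρ.comma ++ (List.replicate m ρ.unit).flatMap F ++
      ρ.closing.flatMap F := by
    intro ρ
    rw [layTag, List.flatMap_append, List.flatMap_cons]
  have hrepF := fun (l b : Sy) k (h : F l = List.replicate k b) =>
    flatMap_replicate_replicate F l b k m h
  refine (key ρ).trans ?_
  cases ρ with
  | den => simp only [Role.unit, hrepF _ _ _ (ha false .u rfl rfl)]; rfl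
  | num => simp only [Role.unit, hrepF _ _ _ (hl .q .u rfl rfl), mul_one]; rfl
  | pre => simp only [Role.unit, hrepF _ _ _ (hl .u .u rfl rfl), mul_one]; rfl
  | c =>
    simp only [Role.unit, hrepF _ _ _ (hl .cu .cu rfl rfl), mul_one]
    exact List.append_nil _
  | w =>
    simp only [Role.unit, hrepF _ _ _ (ha true (.cell false) rfl rfl)]
    exact List.append_nil _

/-! ## From unary to binary numbers outside of the table -/

/-- The transducer that halves the unary numbers outside of the table and records the remainder:
the state is the parity of the number of units that have been read, if there are any. -/
def halfTr : Option Bool → Sy → Option Bool × List Sy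
  | none, .u => (some true, [])
  | some true, .u => (some false, [.u])
  | some false, .u => (some true, [])
  | some b, .fin => (none, [.fin, .bit b])
  | _, l => (none, [l])

/-- A number part of which has been converted to binary. -/
def layHalf (m : ℕ) (bs : List Bool) : List Sy :=
  .commaN :: List.replicate m .u ++ .fin :: bs.map Sy.bit

theorem run_halfTr_none {w : List Sy} (h : Sy.u ∉ w) : run halfTr none w = w := by
  induction w with
  | nil => rfl
  | cons a w ih =>
    rw [List.mem_cons, not_or] at h
    have h1 : halfTr none a = (none, [a]) := by
      cases a <;> first | rfl | exact absurd rfl h.1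
    rw [run_cons, h1, ih h.2, List.singleton_append]

theorem run_halfTr_some (m : ℕ) (b : Bool) (w : List Sy) :
    run halfTr (some b) (List.replicate m .u ++ .fin :: w) =
      List.replicate ((m + b.toNat) / 2) .u ++ .fin :: .bit (decide ((m + b.toNat) % 2 = 1)) ::
        run halfTr none w := by
  induction m generalizing b with
  | zero => cases b <;> rfl
  | succ m ih =>
    rw [List.replicate_succ, List.cons_append, run_cons]
    cases b with
    | false =>
      rw [show halfTr (some false) .u = (some true, []) from rfl, List.nil_append, ih]
      rfl
    | true =>
      rw [show halfTr (some true) .u = (some false, [.u]) from rfl, ih]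
      simp only [Bool.toNat_true, Bool.toNat_false, add_zero]
      rw [show (m + 1 + 1) / 2 = m / 2 + 1 by omega]
      simp only [show (m + 1 + 1) % 2 = m % 2 by omega]
      rfl

/-- One pass splits off the least significant digit not yet recorded and inserts it directly behind
`fin`, in front of the earlier ones. When no unit is left the state at `fin` is still `none`, so no
superfluous leading zero is written. -/
theorem run_halfTr (s : Option Bool) (m : ℕ) (bs : List Bool) :
    run halfTr s (layHalf m bs) = layHalf (m / 2) (((encodeNat m).take 1).reverse ++ bs) := by
  have hc : halfTr s .commaN = (none, [.commaN]) := by rcases s with _ | _ | _ <;> rfl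
  have hbs : run halfTr none (bs.map Sy.bit) = bs.map Sy.bit := run_halfTr_none (by simp)
  rw [layHalf, List.cons_append, run_cons, hc]
  rcases m with _ | m
  · have : run halfTr none (.fin :: bs.map Sy.bit) = .fin :: bs.map Sy.bit :=
      run_halfTr_none (by simp)
    simp [this, layHalf, encodeNat_zero]
  · change [Sy.commaN] ++ run halfTr (some true) (List.replicate m Sy.u ++ .fin :: bs.map Sy.bit) = _
    rw [run_halfTr_some, encodeNat_pos (Nat.succ_pos m), hbs]
    simp [layHalf]

theorem half_step (m j : ℕ) : (encodeNat (m / 2 ^ j)).take 1 = ((encodeNat m).drop j).take 1 := by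
  induction j generalizing m with
  | zero => simp
  | succ j ih =>
    rcases Nat.eq_zero_or_pos m with rfl | hm
    · simp [encodeNat_zero]
    · rw [encodeNat_pos hm, List.drop_succ_cons, ← ih (m / 2), Nat.div_div_eq_div_mul,
        pow_succ, mul_comm (2 ^ j) 2]

/-- The layout after `j` rounds of the conversion to binary. -/
def layRound (M j : ℕ) : Role → ℕ → List Sy
  | .den, m => layHalf (m * M / 2 ^ j) ((encodeNat (m * M)).take j).reverse
  | .num, m => layHalf (m / 2 ^ j) ((encodeNat m).take j).reverse
  | .pre, m => layHalf (m / 2 ^ j) ((encodeNat m).take j).reverse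
  | .c, m => .commaC false :: List.replicate m .cu
  | .w, m => .commaW :: List.replicate (m * M) (.cell false)

/-- The layout with binary numbers outside of the table. -/
def layOut (M : ℕ) : Role → ℕ → List Sy
  | .den, m => .commaN :: .fin :: (encodeNat (m * M)).reverse.map Sy.bit
  | .num, m => .commaN :: .fin :: (encodeNat m).reverse.map Sy.bit
  | .pre, m => .commaN :: .fin :: (encodeNat m).reverse.map Sy.bit
  | .c, m => .commaC false :: List.replicate m .cu
  | .w, m => .commaW :: List.replicate (m * M) (.cell false)

theorem layHalf_final {m j : ℕ} (h : m ≤ j) :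
    layHalf (m / 2 ^ j) ((encodeNat m).take j).reverse =
      .commaN :: .fin :: (encodeNat m).reverse.map Sy.bit := by
  have h1 : m / 2 ^ j = 0 :=
    Nat.div_eq_of_lt (h.trans_lt Nat.lt_two_pow_self)
  rw [h1, List.take_of_length_le ((length_encodeNat_le m).trans h)]
  rfl

/-- A number has at most as many binary digits as it has units in the word, so as many passes as
letters suffice. The weights inside the table stay unary, because they are turned into vertices and
edges. -/
theorem PT.binary (d : D → CutData) (M : D → ℕ) :
    PT (fun x => lay (layMul (M x)) (d x)) (fun x => lay (layOut (M x)) (d x)) := by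
  have h0 : ∀ M, layRound M 0 = layMul M := by
    intro M; funext ρ m
    cases ρ <;> simp [layRound, layMul, layHalf]
  have hit : ∀ x j, (run halfTr none)^[j] (lay (layMul (M x)) (d x)) =
      lay (layRound (M x) j) (d x) := by
    intro x j
    rw [← h0]
    have step : ∀ j m s, run halfTr s (layHalf (m / 2 ^ j) ((encodeNat m).take j).reverse) =
        layHalf (m / 2 ^ (j + 1)) ((encodeNat m).take (j + 1)).reverse := by
      intro j m s
      rw [run_halfTr, half_step, ← List.reverse_append, ← List.take_add, Nat.div_div_eq_div_mul,
        pow_succ]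
    refine iterate_lay (fun j ρ m _ s => ?_) (fun s => ?_) (fun s => ?_) (fun s => ?_) j
    · cases ρ with
      | den => exact step j _ s
      | num => exact step j _ s
      | pre => exact step j _ s
      | c =>
        have hc : halfTr s (.commaC false) = (none, [.commaC false]) := by
          rcases s with _ | _ | _ <;> rfl
        rw [layRound, run_cons, hc, run_halfTr_none (by simp)]; rfl
      | w =>
        have hc : halfTr s .commaW = (none, [.commaW]) := by rcases s with _ | _ | _ <;> rfl
        rw [layRound, run_cons, hc, run_halfTr_none (by simp)]; rfl
    all_goals rcases s with _ | _ | _ <;> rfl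
  have hhalf : ∀ m j, (layHalf (m / 2 ^ j) ((encodeNat m).take j).reverse).length ≤ 2 * m + 2 := by
    intro m j
    have h1 := length_encodeNat_le m
    have h2 : m / 2 ^ j ≤ m := Nat.div_le_self _ _
    simp only [layHalf, List.length_append, List.length_cons, List.length_replicate,
      List.length_map, List.length_reverse, List.length_take]
    omega
  refine (PT.iterate halfTr none _ (Polynomial.X * (Polynomial.C 2 * Polynomial.X + Polynomial.C 2))
    fun x j _ => ?_).of_eq fun x => ?_
  · rw [hit]
    simp only [Polynomial.eval_add, Polynomial.eval_mul, Polynomial.eval_X, Polynomial.eval_C]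
    refine length_lay_le (by omega) (by intro ρ m; cases ρ <;> simp [layMul]) fun ρ m hm => ?_
    have h1 := length_le_lay (layMul (M x)) hm
    set L := (lay (layMul (M x)) (d x)).length
    cases ρ with
    | den =>
      have := hhalf (m * M x) j
      simp only [layMul, List.length_append, List.length_cons, List.length_replicate] at h1
      simp only [layRound]
      omega
    | num =>
      have := hhalf m j
      simp only [layMul, List.length_append, List.length_cons, List.length_replicate] at h1
      simp only [layRound]
      omega
    | pre =>
      have := hhalf m j
      simp only [layMul, List.length_append, List.length_cons, List.length_replicate] at h1
      simp only [layRound]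
      omega
    | c => exact h1.trans (by omega)
    | w => exact h1.trans (by omega)
  · rw [hit]
    refine lay_congr fun ρ m hm => ?_
    have h1 := length_le_lay (layMul (M x)) hm
    cases ρ with
    | c => rfl
    | w => rfl
    | _ =>
      simp only [layMul, List.length_append, List.length_cons, List.length_replicate] at h1
      exact layHalf_final (by omega)

end PolyTime

/-! ## Enumerating the pairs of vertices of the unweighted graph -/

namespace PolyTime

open Computability InstanceCode

variable {D : Type}

/-! ### General facts on transducers -/

theorem length_run_le {S A B : Type} (tr : S → A → S × List B) (h : ∀ s a, (tr s a).2.length ≤ 1)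
    (s : S) (w : List A) : (run tr s w).length ≤ w.length := by
  induction w generalizing s with
  | nil => simp
  | cons a w ih =>
    have := h s a
    have := ih (tr s a).1
    simp only [run_cons, List.length_append, List.length_cons]
    omega

/-- The orbits of blocks under a transducer that does not lengthen words. -/
theorem PT.orbit_of_length_le {S A : Type} [Fintype S] [Fintype A] (tr : S → A → S × List A)
    (s₀ : S) (h : ∀ s a, (tr s a).2.length ≤ 1) (bs : D → List (List A)) :
    PT (fun x => blk (bs x)) (fun x => blk ((bs x).flatMap (orb (run tr s₀)))) := by
  refine PT.orbit tr s₀ bs Polynomial.X fun x b hb j hj => ?_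
  rw [Polynomial.eval_X]
  refine le_trans ?_ (length_le_blk hb)
  clear hb hj
  induction j with
  | zero => exact le_rfl
  | succ j ih =>
    rw [Function.iterate_succ_apply']
    exact (length_run_le tr h _ _).trans ih

/-- The transducer that treats each block separately and extends it by `tail`. -/
def blockTr {S A B : Type} (tr : S → A → S × List B) (s₀ : S) (tail : List B) :
    S → Option A → S × List (Option B)
  | s, some a => ((tr s a).1, (tr s a).2.map some)
  | _, none => (s₀, tail.map some ++ [none])

theorem run_blockTr {S A B : Type} (tr : S → A → S × List B) (s₀ : S) (tail : List B)
    (bs : List (List A)) :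
    run (blockTr tr s₀ tail) s₀ (blk bs) = blk (bs.map fun b => run tr s₀ b ++ tail) := by
  have h : ∀ (b : List A) (s : S) (l : List (Option A)),
      run (blockTr tr s₀ tail) s (b.map some ++ none :: l) =
        (run tr s b ++ tail).map some ++ none :: run (blockTr tr s₀ tail) s₀ l := by
    intro b
    induction b with
    | nil => intro s l; simp [blockTr]
    | cons a b ih => intro s l; simp [blockTr, ih]
  induction bs with
  | nil => rfl
  | cons b bs ih =>
    have e : ∀ {A : Type} (b : List A) bs, blk (b :: bs) = b.map some ++ none :: blk bs := by
      intros; simp [blk]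
    rw [e, h, ih, List.map_cons, e]

theorem PT.mapBlocks {S A B : Type} [Fintype S] [Fintype A] [Fintype B]
    (tr : S → A → S × List B) (s₀ : S) (tail : List B) (bs : D → List (List A)) :
    PT (fun x => blk (bs x)) (fun x => blk ((bs x).map fun b => run tr s₀ b ++ tail)) := by
  refine (PT.mealy (blockTr tr s₀ tail) s₀ [] _).of_eq fun x => ?_
  rw [List.append_nil, run_blockTr]

theorem run_replicate_append {S A B : Type} (tr : S → A → S × List B) {s : S} {a : A} {o : List B}
    (h : tr s a = (s, o)) (k : ℕ) (l : List A) :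
    run tr s (List.replicate k a ++ l) =
      (List.replicate k o).flatten ++ run tr s l := by
  induction k with
  | zero => rfl
  | succ k ih => simp [List.replicate_succ, h, ih]

theorem run_replicate_keep {S A : Type} (tr : S → A → S × List A) {s : S} {a : A}
    (h : tr s a = (s, [a])) (k : ℕ) (l : List A) :
    run tr s (List.replicate k a ++ l) = List.replicate k a ++ run tr s l := by
  rw [run_replicate_append tr h]; simp

theorem run_replicate_drop {S A B : Type} (tr : S → A → S × List B) {s : S} {a : A}
    (h : tr s a = (s, [])) (k : ℕ) (l : List A) :
    run tr s (List.replicate k a ++ l) = run tr s l := by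
  rw [run_replicate_append tr h]; simp

/-- A transducer that gives to every item the mark of the preceding item moves the mark on. -/
theorem run_shift {S A B : Type} {tr : S → A → S × List B} (st : Bool → S)
    (f : ℕ → Bool → List A) (g : ℕ → Bool → List B)
    (h : ∀ i m p l, run tr (st p) (f i m ++ l) = g i p ++ run tr (st m) l) (n s : ℕ)
    (l : List A) :
    run tr (st (decide (s = 0)))
      ((List.range n).flatMap (fun i => f i (decide (i + 1 = s))) ++ l) =
      (List.range n).flatMap (fun i => g i (decide (i + 1 = s + 1))) ++
        run tr (st (decide (n = s))) l := by
  induction n generalizing l with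
  | zero => simp [eq_comm]
  | succ n ih =>
    simp only [List.range_succ, List.flatMap_append, List.flatMap_cons, List.flatMap_nil,
      List.append_nil, List.append_assoc]
    rw [ih, h]
    simp

/-- The letters of the words for numbers outside of the table. -/
def IsNum (w : List Sy) : Prop := ∀ a ∈ w, a = .commaN ∨ a = .fin ∨ ∃ b, a = .bit b

theorem run_isNum {S : Type} {tr : S → Sy → S × List Sy} {s : S} {w : List Sy} (hw : IsNum w)
    (h : ∀ a, (a = .commaN ∨ a = .fin ∨ ∃ b, a = .bit b) → tr s a = (s, [])) (l : List Sy) :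
    run tr s (w ++ l) = run tr s l := by
  induction w with
  | nil => rfl
  | cons a w ih =>
    rw [List.cons_append, run_cons, h a (hw a (by simp)), ih fun b hb => hw b (by simp [hb]),
      List.nil_append]

/-! ### The vertex of the row -/

section

variable (n : ℕ) (a : ℕ → ℕ) (c : ℕ → ℕ → ℕ)

/-- The row of the vertex `i`, which may be marked; the column before `s` is marked. -/
def tabRow (s i : ℕ) (m : Bool) : List Sy :=
  .ket m :: ((List.range n).flatMap
    (fun j => .commaC (decide (j + 1 = s)) :: List.replicate (c i j) .cu) ++
      .commaW :: (List.replicate (a i) (.cell false) ++ [.bra]))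

/-- The table in which the row and the column before `s` are marked. -/
def tabMark (s : ℕ) : List Sy :=
  .tb :: (List.range n).flatMap fun i => tabRow n a c s i (decide (i + 1 = s))

/-- The transducer that moves the marks to the next row and to the next column and erases the
numbers outside of the table. The first component of the state tells if there are such numbers. -/
def shiftTr : Bool × Bool × Bool → Sy → (Bool × Bool × Bool) × List Sy
  | _, .commaN => ((true, false, false), [])
  | s, .fin => (s, [])
  | s, .bit _ => (s, [])
  | (f, _, _), .tb => ((f, f, false), [.tb])
  | (f, p, _), .ket m => ((f, m, f), [.ket p])
  | (f, p, r), .commaC m => ((f, p, m), [.commaC r])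
  | (f, p, _), .commaW => ((f, p, false), [.commaW])
  | s, l => (s, [l])

theorem length_shiftTr (s : Bool × Bool × Bool) (l : Sy) : (shiftTr s l).2.length ≤ 1 := by
  cases l <;> simp [shiftTr]

/-- The first component of the state is true exactly in the first round. It acts as a mark in front
of the first row and of the first column, so a mark enters the table once, then moves on by one
place per round and finally leaves it. -/
theorem run_shiftTr_row (s i : ℕ) (m p : Bool) (l : List Sy) :
    run shiftTr (decide (s = 0), p, false) (tabRow n a c s i m ++ l) =
      tabRow n a c (s + 1) i p ++ run shiftTr (decide (s = 0), m, false) l := by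
  have h := run_shift (tr := shiftTr) (fun b => (decide (s = 0), m, b))
    (fun j b => .commaC b :: List.replicate (c i j) .cu)
    (fun j b => .commaC b :: List.replicate (c i j) .cu)
    (fun j b b' l => by
      simp only [List.cons_append, run_cons, shiftTr]
      rw [run_replicate_keep]
      · rfl
      · rfl) n s
    (.commaW :: (List.replicate (a i) (.cell false) ++ [.bra]) ++ l)
  simp only [tabRow, List.cons_append, run_cons, List.append_assoc] at h ⊢
  simp only [show ∀ q, shiftTr (decide (s = 0), p, q) (.ket m) =
    ((decide (s = 0), m, decide (s = 0)), [.ket p]) from fun _ => rfl, h,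
    show ∀ f p q, shiftTr (f, p, q) .commaW = ((f, p, false), [.commaW]) from fun _ _ _ => rfl]
  rw [run_replicate_keep _ rfl]
  simp [shiftTr]

theorem run_shiftTr_tabMark (s : ℕ) (q : Bool × Bool) :
    run shiftTr (decide (s = 0), q) (tabMark n a c s) = tabMark n a c (s + 1) := by
  have h := run_shift (tr := shiftTr) (fun b => (decide (s = 0), b, false))
    (tabRow n a c s) (tabRow n a c (s + 1)) (fun i m p l => run_shiftTr_row n a c s i m p l) n s []
  simp only [List.append_nil, run_nil] at h
  rw [tabMark, run_cons, show shiftTr (decide (s = 0), q) .tb =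
    ((decide (s = 0), decide (s = 0), false), [.tb]) from rfl, h]
  rfl

/-- The outer numbers survive only in the initial word. There they signal the first round, and they
end up in exactly one block, hence once in the output. -/
theorem iterate_shiftTr {nums : List Sy} (h : IsNum nums) (s : ℕ) :
    (run shiftTr (false, false, false))^[s] (.commaN :: nums ++ tabMark n a c 0) =
      (if s = 0 then .commaN :: nums else []) ++ tabMark n a c s := by
  induction s with
  | zero => rfl
  | succ s ih =>
    rw [Function.iterate_succ_apply', ih, if_neg (Nat.succ_ne_zero s), List.nil_append]
    rcases Nat.eq_zero_or_pos s with rfl | hs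
    · rw [if_pos rfl, List.cons_append, run_cons]
      simp only [shiftTr]
      rw [run_isNum h (by rintro _ (rfl | rfl | ⟨b, rfl⟩) <;> rfl)]
      exact run_shiftTr_tabMark n a c 0 _
    · rw [if_neg hs.ne', List.nil_append]
      have := run_shiftTr_tabMark n a c s (false, false)
      rwa [decide_eq_false hs.ne'] at this

end

/-- The blocks of the first enumeration. -/
def shiftBlocks (n : ℕ) (a : ℕ → ℕ) (c : ℕ → ℕ → ℕ) (nums : List Sy) : List (List Sy) :=
  (List.range ((.commaN :: nums ++ tabMark n a c 0).length + 1)).map fun s =>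
    (if s = 0 then .commaN :: nums else []) ++ tabMark n a c s

theorem PT.shift (n : D → ℕ) (a : D → ℕ → ℕ) (c : D → ℕ → ℕ → ℕ) (nums : D → List Sy)
    (h : ∀ x, IsNum (nums x)) :
    PT (fun x => .commaN :: nums x ++ tabMark (n x) (a x) (c x) 0)
      (fun x => blk (shiftBlocks (n x) (a x) (c x) (nums x))) := by
  refine (PT.block _).trans ((PT.orbit_of_length_le shiftTr (false, false, false) length_shiftTr
    _).of_eq fun x => ?_)
  congr 1
  rw [List.flatMap_singleton, orb, shiftBlocks]
  refine List.map_congr_left fun s _ => ?_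
  exact iterate_shiftTr (n x) (a x) (c x) (h x) s

/-! ### Extraction of the column of the marked vertex -/

/-- The entries of the column before `s`. -/
def colBefore (n : ℕ) (c : ℕ → ℕ → ℕ) (s i : ℕ) : ℕ :=
  if 1 ≤ s ∧ s ≤ n then c i (s - 1) else 0

/-- The row of the vertex `v`, which is marked if it is the vertex before `s`, with the entry in
the column before `s` reduced by `i`, and the vertices of the clique, of which number `i` is
marked. -/
def colRow (n : ℕ) (a : ℕ → ℕ) (c : ℕ → ℕ → ℕ) (s i v : ℕ) : List Sy :=
  .ket (decide (v + 1 = s)) :: (List.replicate (colBefore n c s v - i) .cu ++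
    (List.range (a v)).flatMap fun j => [.cell (decide (j = i))])

/-- The table of the rows `colRow`. -/
def colTab (n : ℕ) (a : ℕ → ℕ) (c : ℕ → ℕ → ℕ) (s i : ℕ) : List Sy :=
  .tb :: ((List.range n).flatMap (colRow n a c s i) ++ [.bra])

/-- The transducer that extracts the marked column and marks the first cells of the rows; the state
tells if the next units are kept and if the next cell is marked. -/
def colTr : Bool × Bool → Sy → (Bool × Bool) × List Sy
  | _, .ket m => ((false, true), [.ket m])
  | (_, f), .commaC m => ((m, f), [])
  | (k, f), .cu => ((k, f), if k then [.cu] else [])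
  | (k, f), .cell _ => ((k, false), [.cell f])
  | s, .bra => (s, [])
  | (_, f), .commaW => ((false, f), [])
  | s, l => (s, [l])

theorem run_colTr_cols (cs : List ℕ) (g : ℕ → ℕ) (p : ℕ → Bool) (k f : Bool) (l : List Sy) :
    run colTr (k, f) (cs.flatMap (fun j => .commaC (p j) :: List.replicate (g j) .cu) ++
      .commaW :: l) =
      cs.flatMap (fun j => if p j then List.replicate (g j) .cu else []) ++
        run colTr (false, f) l := by
  induction cs generalizing k with
  | nil => simp [colTr]
  | cons j cs ih =>
    rw [List.flatMap_cons, List.flatMap_cons, List.append_assoc, List.cons_append, run_cons,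
      show colTr (k, f) (.commaC (p j)) = ((p j, f), []) from rfl, List.nil_append]
    cases p j with
    | true => rw [run_replicate_keep colTr (s := (true, f)) rfl, ih]; simp
    | false => rw [run_replicate_drop colTr (s := (false, f)) rfl, ih]; simp

theorem flatMap_range_eq_colBefore (n : ℕ) (c : ℕ → ℕ → ℕ) (s i : ℕ) :
    (List.range n).flatMap (fun j => if decide (j + 1 = s) = true then
      List.replicate (c i j) Sy.cu else []) = List.replicate (colBefore n c s i) .cu := by
  induction n with
  | zero =>
    rw [colBefore, if_neg (by omega)]; rfl
  | succ n ih =>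
    rw [List.range_succ, List.flatMap_append, ih, List.flatMap_singleton]
    by_cases h : n + 1 = s
    · have h1 : colBefore n c s i = 0 := if_neg (by omega)
      have h2 : colBefore (n + 1) c s i = c i n := by
        rw [colBefore, if_pos (by omega), ← h, Nat.add_sub_cancel]
      rw [h1, h2, if_pos (decide_eq_true h)]
      rfl
    · have h1 : colBefore (n + 1) c s i = colBefore n c s i := by
        unfold colBefore
        congr 1
        exact propext (by omega)
      simp [h1, h]

theorem run_colTr_cells (m : ℕ) (k : Bool) : run colTr (k, true)
    (List.replicate m (.cell false) ++ [.bra]) =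
      (List.range m).flatMap fun j => [.cell (decide (j = 0))] := by
  cases m with
  | zero => rfl
  | succ m =>
    rw [List.replicate_succ, List.cons_append, run_cons,
      show colTr (k, true) (.cell false) = ((k, false), [.cell true]) from rfl,
      run_replicate_keep _ rfl, List.range_succ_eq_map, List.flatMap_cons, List.flatMap_map]
    simp [colTr, ← List.map_eq_flatMap]

theorem run_colTr_row (n : ℕ) (a : ℕ → ℕ) (c : ℕ → ℕ → ℕ) (s i : ℕ) (q : Bool × Bool) :
    run colTr q (tabRow n a c s i (decide (i + 1 = s))) = colRow n a c s 0 i := by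
  rw [tabRow, run_cons]
  simp only [colTr]
  rw [run_colTr_cols, run_colTr_cells, flatMap_range_eq_colBefore]
  rfl

/-- The delimiters `bra` of the single rows are erased; the one appended here marks the end of the
table, where it is later decided whether the block describes a vertex. -/
theorem run_colTr (n : ℕ) (a : ℕ → ℕ) (c : ℕ → ℕ → ℕ) (s : ℕ) (q : Bool × Bool) {w : List Sy}
    (hw : IsNum w) :
    run colTr q (w ++ tabMark n a c s) ++ [.bra] = w ++ colTab n a c s 0 := by
  have h1 : ∀ l, run colTr q (w ++ l) = w ++ run colTr q l := by
    intro l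
    induction w with
    | nil => rfl
    | cons x w ih =>
      have : colTr q x = (q, [x]) := by
        rcases hw x (by simp) with rfl | rfl | ⟨b, rfl⟩ <;> rfl
      rw [List.cons_append, run_cons, this, ih fun b hb => hw b (by simp [hb])]
      rfl
  rw [h1, tabMark, run_cons, show colTr q .tb = (q, [.tb]) from rfl,
    run_flatMap colTr (fun i _ q => run_colTr_row n a c s i q)]
  simp [colTab]

/-- The blocks after the extraction. -/
def colBlocks (n : ℕ) (a : ℕ → ℕ) (c : ℕ → ℕ → ℕ) (nums : List Sy) : List (List Sy) :=
  (List.range ((.commaN :: nums ++ tabMark n a c 0).length + 1)).map fun s =>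
    (if s = 0 then .commaN :: nums else []) ++ colTab n a c s 0

theorem PT.col (n : D → ℕ) (a : D → ℕ → ℕ) (c : D → ℕ → ℕ → ℕ) (nums : D → List Sy)
    (h : ∀ x, IsNum (nums x)) :
    PT (fun x => blk (shiftBlocks (n x) (a x) (c x) (nums x)))
      (fun x => blk (colBlocks (n x) (a x) (c x) (nums x))) := by
  refine (PT.mapBlocks colTr (false, false) [.bra] _).of_eq fun x => ?_
  rw [shiftBlocks, colBlocks, List.map_map]
  congr 1
  refine List.map_congr_left fun s _ => run_colTr _ _ _ _ _ ?_
  intro a ha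
  split_ifs at ha with hs
  · rcases List.mem_cons.1 ha with rfl | ha
    · exact Or.inl rfl
    · exact h x a ha
  · simp at ha

/-! ### The number of the vertex in its clique -/

/-- The transducer that removes a unit from each row, moves the marks of the cells, and erases the
numbers outside of the table. -/
def cellTr : Bool × Bool → Sy → (Bool × Bool) × List Sy
  | s, .commaN => (s, [])
  | s, .fin => (s, [])
  | s, .bit _ => (s, [])
  | _, .ket m => ((true, false), [.ket m])
  | (true, m), .cu => ((false, m), [])
  | (d, m), .cell b => ((d, b), [.cell m])
  | s, l => (s, [l])

theorem length_cellTr (s : Bool × Bool) (l : Sy) : (cellTr s l).2.length ≤ 1 := by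
  rcases s with ⟨_ | _, _⟩ <;> cases l <;> simp [cellTr]

theorem run_cellTr_cells (m i : ℕ) (d : Bool) : run cellTr (d, false)
    ((List.range m).flatMap fun j => [.cell (decide (j = i))]) =
      (List.range m).flatMap fun j => [.cell (decide (j = i + 1))] := by
  have h := run_shift (tr := cellTr) (fun b => (d, b)) (fun _ b => [.cell b])
    (fun _ b => [.cell b]) (fun i m p l => by cases d <;> rfl) m (i + 1) []
  simpa using h

/-- After `i` rounds the number of units left is the edge weight minus `i`, while cell `i` is marked
in each clique. Units remain exactly if `i` is below the edge weight, which is the condition for a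
matching edge at position `i`. -/
theorem run_cellTr_row (n : ℕ) (a : ℕ → ℕ) (c : ℕ → ℕ → ℕ) (s i v : ℕ) (q : Bool × Bool) :
    run cellTr q (colRow n a c s i v) = colRow n a c s (i + 1) v := by
  rw [colRow, run_cons, show ∀ m, cellTr q (.ket m) = ((true, false), [.ket m]) from
    fun m => by rcases q with ⟨_ | _, _⟩ <;> rfl]
  obtain h | ⟨k, hk⟩ : colBefore n c s v - i = 0 ∨ ∃ k, colBefore n c s v - i = k + 1 := by
    rcases Nat.eq_zero_or_pos (colBefore n c s v - i) with h | h
    · exact Or.inl h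
    · exact Or.inr ⟨_, (Nat.succ_pred_eq_of_pos h).symm⟩
  · rw [h, List.replicate_zero, List.nil_append, run_cellTr_cells, colRow,
      show colBefore n c s v - (i + 1) = 0 by omega]
    rfl
  · have h (l : List Sy) : run cellTr (true, false) (List.replicate (k + 1) .cu ++ l) =
        List.replicate k .cu ++ run cellTr (false, false) l := by
      rw [← run_replicate_keep cellTr (s := (false, false)) rfl]
      rfl
    rw [hk, h, run_cellTr_cells, colRow, show colBefore n c s v - (i + 1) = k by omega]
    rfl

theorem run_cellTr (n : ℕ) (a : ℕ → ℕ) (c : ℕ → ℕ → ℕ) (s i : ℕ) (q : Bool × Bool) {w : List Sy}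
    (hw : IsNum w) :
    run cellTr q (w ++ colTab n a c s i) = colTab n a c s (i + 1) := by
  have h1 : ∀ l, (l = .tb ∨ l = .bra) → ∀ q, cellTr q l = (q, [l]) := by
    rintro _ (rfl | rfl) ⟨_ | _, _⟩ <;> rfl
  rw [run_isNum hw (by rintro _ (rfl | rfl | ⟨b, rfl⟩) <;> rcases q with ⟨_ | _, _⟩ <;> rfl),
    colTab, run_cons, h1 _ (Or.inl rfl), run_append,
    run_flatMap cellTr (fun v _ q => run_cellTr_row n a c s i v q), run_cons, h1 _ (Or.inr rfl)]
  rfl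

/-- The blocks of the second enumeration. -/
def cellBlocks (n : ℕ) (a : ℕ → ℕ) (c : ℕ → ℕ → ℕ) (nums : List Sy) : List (List Sy) :=
  (List.range ((.commaN :: nums ++ tabMark n a c 0).length + 1)).flatMap fun s =>
    (List.range (((if s = 0 then .commaN :: nums else []) ++ colTab n a c s 0).length + 1)).map
      fun i => (if s = 0 ∧ i = 0 then .commaN :: nums else []) ++ colTab n a c s i

/-- Every block `s` is expanded into its iterates `i`, so all pairs `(s, i)` occur, including
surplus ones that name no vertex. The outer numbers remain only in the block with `s = 0` and `i =
0`. -/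
theorem PT.cell (n : D → ℕ) (a : D → ℕ → ℕ) (c : D → ℕ → ℕ → ℕ) (nums : D → List Sy)
    (h : ∀ x, IsNum (nums x)) :
    PT (fun x => blk (colBlocks (n x) (a x) (c x) (nums x)))
      (fun x => blk (cellBlocks (n x) (a x) (c x) (nums x))) := by
  refine (PT.orbit_of_length_le cellTr (false, false) length_cellTr _).of_eq fun x => ?_
  rw [colBlocks, cellBlocks, List.flatMap_map]
  congr 1
  refine flatMap_congr' fun s _ => ?_
  rw [orb]
  refine List.map_congr_left fun i hi => ?_
  clear hi
  induction i with
  | zero => simp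
  | succ i ih =>
    rw [Function.iterate_succ_apply', ih, run_cellTr, if_neg (by omega), List.nil_append]
    intro a ha
    split_ifs at ha with hs
    · rcases List.mem_cons.1 ha with rfl | ha
      · exact Or.inl rfl
      · exact h x a ha
    · simp at ha

end PolyTime

/-! ## Writing the unweighted graph -/

namespace PolyTime

open Computability InstanceCode

variable {D : Type}

/-- Adjacency of the vertex number `i` of the clique of `t` and number `j` of the clique of `v`. -/
def blowAdj (c : ℕ → ℕ → ℕ) (p q : ℕ × ℕ) : Prop :=
  if q.1 = p.1 then p.2 ≠ q.2 else p.2 = q.2 ∧ p.2 < c q.1 p.1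

instance (c : ℕ → ℕ → ℕ) (p q : ℕ × ℕ) : Decidable (blowAdj c p q) := by
  unfold blowAdj; infer_instance

/-- The transducer that computes the entries of a row: the state tells if the current vertex is
marked, if there are units left, and if a marked vertex with a marked cell has been seen. -/
def entryTr : Bool × Bool × Bool → Sy → (Bool × Bool × Bool) × List Sy
  | _, .tb => ((false, false, false), [.tb])
  | (_, _, g), .ket m => ((m, false, g), [])
  | (d, _, g), .cu => ((d, true, g), [])
  | (d, h, g), .cell m => ((d, h, g || (d && m)), [.commaC (if d then !m else m && h)])
  | (d, h, g), .bra => ((d, h, g), [.ket g])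
  | s, l => (s, [l])

/-- The entry of the cell `j` in the clique of `v` in the row given by `s` and `i`. -/
def entry (n : ℕ) (c : ℕ → ℕ → ℕ) (s i v j : ℕ) : Bool :=
  if v + 1 = s then decide (j ≠ i) else decide (j = i ∧ i < colBefore n c s v)

theorem run_entryTr_cells (d h g : Bool) (i : ℕ) (k : List ℕ) (l : List Sy) :
    run entryTr (d, h, g) (k.flatMap (fun j => [.cell (decide (j = i))]) ++ l) =
      k.flatMap (fun j => [.commaC (if d then !decide (j = i) else decide (j = i) && h)]) ++
        run entryTr (d, h, g || (d && k.any fun j => decide (j = i))) l := by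
  induction k generalizing g with
  | nil => simp
  | cons j k ih =>
    rw [List.flatMap_cons, List.flatMap_cons, List.append_assoc, List.singleton_append, run_cons]
    simp only [entryTr]
    rw [ih]
    cases d <;> simp [Bool.or_assoc]

/-- In its own clique a vertex is adjacent to all cells except the marked one; in another clique
only to the marked cell, and only if units are left. The last flag records whether the marked row
has a marked cell, that is, whether `(s, i)` names a vertex. -/
theorem run_entryTr_row (n : ℕ) (a : ℕ → ℕ) (c : ℕ → ℕ → ℕ) (s i v : ℕ) (d h g : Bool)
    (l : List Sy) :
    ∃ d' h', run entryTr (d, h, g) (colRow n a c s i v ++ l) =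
      (List.range (a v)).flatMap (fun j => [.commaC (entry n c s i v j)]) ++
        run entryTr (d', h', g || decide (v + 1 = s ∧ i < a v)) l := by
  have hcu : ∀ (m : ℕ) (d g : Bool) (l : List Sy),
      run entryTr (d, false, g) (List.replicate m .cu ++ l) =
        run entryTr (d, decide (0 < m), g) l := by
    intro m d g l
    cases m with
    | zero => rfl
    | succ m => exact run_replicate_drop entryTr (s := (d, true, g)) rfl m l
  refine ⟨decide (v + 1 = s), decide (0 < colBefore n c s v - i), ?_⟩
  rw [colRow, List.cons_append, run_cons, show entryTr (d, h, g) (.ket (decide (v + 1 = s))) =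
    ((decide (v + 1 = s), false, g), []) from rfl, List.nil_append, List.append_assoc, hcu,
    run_entryTr_cells]
  congr 1
  · refine flatMap_congr' fun j _ => ?_
    congr 2
    unfold entry
    by_cases hv : v + 1 = s
    · simp [hv]
    · simp only [hv, decide_false, Bool.false_eq_true, if_false, Bool.decide_and]
      congr 2
      exact propext (by omega)
  · congr 3
    have : ((List.range (a v)).any fun j => decide (j = i)) = decide (i < a v) := by
      rw [Bool.eq_iff_iff]; simp
    rw [this, Bool.decide_and]

/-- The entries of a row. -/
def entryRow (n : ℕ) (a : ℕ → ℕ) (c : ℕ → ℕ → ℕ) (s i : ℕ) : List Sy :=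
  (List.range n).flatMap fun v =>
    (List.range (a v)).flatMap fun j => [.commaC (entry n c s i v j)]

theorem run_entryTr (n : ℕ) (a : ℕ → ℕ) (c : ℕ → ℕ → ℕ) (s i : ℕ) {w : List Sy}
    (hw : IsNum w) (q : Bool × Bool × Bool) :
    run entryTr q (w ++ colTab n a c s i) =
      w ++ .tb :: (entryRow n a c s i ++
        [.ket (decide (∃ v < n, v + 1 = s ∧ i < a v))]) := by
  have h1 : ∀ l, run entryTr q (w ++ l) = w ++ run entryTr q l := by
    intro l
    induction w with
    | nil => rfl
    | cons x w ih =>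
      have : entryTr q x = (q, [x]) := by
        rcases hw x (by simp) with rfl | rfl | ⟨b, rfl⟩ <;> rfl
      rw [List.cons_append, run_cons, this, ih fun b hb => hw b (by simp [hb])]
      rfl
  have h2 : ∀ (k : List ℕ) (d h g : Bool) (l : List Sy), ∃ d' h',
      run entryTr (d, h, g) (k.flatMap (colRow n a c s i) ++ l) =
        k.flatMap (fun v => (List.range (a v)).flatMap fun j => [.commaC (entry n c s i v j)]) ++
          run entryTr (d', h', g || k.any fun v => decide (v + 1 = s ∧ i < a v)) l := by
    intro k
    induction k with
    | nil => intro d h g l; exact ⟨d, h, by simp⟩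
    | cons v k ih =>
      intro d h g l
      obtain ⟨d₁, h₁, e₁⟩ := run_entryTr_row n a c s i v d h g (k.flatMap (colRow n a c s i) ++ l)
      obtain ⟨d₂, h₂, e₂⟩ := ih d₁ h₁ (g || decide (v + 1 = s ∧ i < a v)) l
      refine ⟨d₂, h₂, ?_⟩
      rw [List.flatMap_cons, List.append_assoc, e₁, e₂, List.flatMap_cons, List.append_assoc,
        List.any_cons, Bool.or_assoc]
  obtain ⟨d', h', e⟩ := h2 (List.range n) false false false [.bra]
  rw [h1, colTab, run_cons, show entryTr q .tb = ((false, false, false), [.tb]) from rfl, e]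
  have : ((List.range n).any fun v => decide (v + 1 = s ∧ i < a v)) =
      decide (∃ v < n, v + 1 = s ∧ i < a v) := by
    rw [Bool.eq_iff_iff]; simp
  simp only [entryTr, run_cons, run_nil, List.append_nil, List.singleton_append, Bool.false_or,
    this, entryRow]

/-- The transducer that writes the final word, in reverse order; the state tells if the row is
kept. -/
def writeTr : Bool → Sy → Bool × List Γ'
  | _, .ket g => (g, if g then [.bra, .bit true, .comma] else [])
  | k, .commaC v => (k, if k then (if v then [.bit true, .comma] else [.comma]) else [])
  | k, .tb => (k, if k then [.ket] else [])
  | k, .commaN => (k, [.comma])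
  | k, .bit b => (k, [.bit b])
  | k, _ => (k, [])

/-- The letters of a number outside of the table. -/
def numLetter : Sy → List Γ'
  | .commaN => [.comma]
  | .bit b => [.bit b]
  | _ => []

theorem encNat_ite (b : Bool) : encNat (if b then 1 else 0) =
    if b then [.bit true, .comma] else [.comma] := by
  cases b <;> rfl

/-- The block is read backwards, so the flag at its end comes first and decides whether the row is
written. The reversal also restores the order of the outer numbers and of their digits. -/
theorem run_writeTr (n : ℕ) (a : ℕ → ℕ) (c : ℕ → ℕ → ℕ) (s i : ℕ) {w : List Sy}
    (hw : IsNum w) (g : Bool) (q : Bool) :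
    run writeTr q (w ++ Sy.tb :: (entryRow n a c s i ++ [Sy.ket g])).reverse =
      (if g then .bra :: (encNat 1 ++ (List.range n).reverse.flatMap (fun v =>
        (List.range (a v)).reverse.flatMap fun j =>
          encNat (if entry n c s i v j then 1 else 0)) ++ [.ket]) else []) ++
        w.reverse.flatMap numLetter := by
  have h1 : ∀ k : Bool, run writeTr k w.reverse = w.reverse.flatMap numLetter := by
    intro k
    have hw' : IsNum w.reverse := fun b hb => hw b (List.mem_reverse.1 hb)
    generalize w.reverse = u at *
    induction u with
    | nil => rfl
    | cons x u ih =>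
      have : writeTr k x = (k, numLetter x) := by
        rcases hw' x (by simp) with rfl | rfl | ⟨b, rfl⟩ <;> rfl
      rw [run_cons, this, ih fun b hb => hw' b (by simp [hb]), List.flatMap_cons]
  have h2 : ∀ (u : List Bool) (k : Bool) (l : List Sy),
      run writeTr k (u.flatMap (fun b => [.commaC b]) ++ l) =
        (if k then u.flatMap (fun b => encNat (if b then 1 else 0)) else []) ++
          run writeTr k l := by
    intro u k l
    induction u with
    | nil => simp
    | cons b u ih =>
      rw [List.flatMap_cons, List.append_assoc, List.singleton_append, run_cons,
        List.flatMap_cons, encNat_ite]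
      simp only [writeTr]
      rw [ih]
      cases k <;> simp
  have h3 : (entryRow n a c s i).reverse = ((List.range n).reverse.flatMap fun v =>
      (List.range (a v)).reverse.map fun j => entry n c s i v j).flatMap
        fun b => [.commaC b] := by
    simp only [entryRow, flatMap_reverse, List.flatMap_assoc, List.flatMap_map,
      List.reverse_singleton]
  rw [List.reverse_append, List.reverse_cons, List.reverse_append, List.reverse_singleton, h3,
    List.singleton_append, List.cons_append, List.cons_append, run_cons,
    show writeTr q (.ket g) = (g, if g then [.bra, .bit true, .comma] else []) from rfl,
    List.append_assoc, h2,
    List.singleton_append, run_cons,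
    show writeTr g .tb = (g, if g then [.ket] else []) from rfl, h1]
  simp only [List.flatMap_assoc, List.flatMap_map]
  cases g <;> simp [show encNat 1 = [.bit true, .comma] from rfl]

/-! ### The output word and the whole transformation of words -/

/-- The vertices of the unweighted graph. -/
def blowVertices (n : ℕ) (a : ℕ → ℕ) : List (ℕ × ℕ) :=
  (List.range n).reverse.flatMap fun t => (List.range (a t)).reverse.map fun i => (t, i)

/-- The table of the unweighted graph. -/
def blowTable (n : ℕ) (a : ℕ → ℕ) (c : ℕ → ℕ → ℕ) : List Γ' :=
  (blowVertices n a).flatMap fun p => .bra :: (encNat 1 ++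
    (blowVertices n a).flatMap (fun q => encNat (if blowAdj c p q then 1 else 0)) ++ [.ket])

theorem flatMap_range_ite {B : Type} (f : ℕ → List B) {k N : ℕ} (h : k ≤ N) :
    (List.range N).reverse.flatMap (fun i => if i < k then f i else []) =
      (List.range k).reverse.flatMap f := by
  obtain ⟨m, rfl⟩ := Nat.exists_eq_add_of_le h
  rw [List.range_add, List.reverse_append, List.flatMap_append]
  have h1 : ((List.range m).map (fun x => k + x)).reverse.flatMap
      (fun i => if i < k then f i else []) = [] := by
    simp
  rw [h1, List.nil_append]
  exact flatMap_congr' fun i hi => if_pos (by simpa using hi)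

theorem length_le_length_flatMap {A : Type} (n : ℕ) (f : ℕ → List A) (h : ∀ i, f i ≠ []) :
    n ≤ ((List.range n).flatMap f).length := by
  have := length_flatMap_le (l := List.range n) (f := f) (g := fun i => [i]) (B := 1)
    fun i _ => by
      rw [List.length_singleton, mul_one]
      exact List.length_pos_of_ne_nil (h i)
  rw [List.flatMap_singleton'] at this
  simpa using this

/-- Surplus pairs contribute nothing, and `hL` and `hK` say that the enumeration is long enough to
reach every vertex. The pairs with `s = 0` come last and yield only the outer numbers, so these
follow the table. -/
theorem blowTable_eq {n : ℕ} {a : ℕ → ℕ} {c : ℕ → ℕ → ℕ} {L : ℕ} {K : ℕ → ℕ} (hL : n ≤ L)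
    (hK : ∀ t < n, a t ≤ K (t + 1)) {w : List Γ'} :
    ((List.range (L + 1)).reverse.flatMap fun s => (List.range (K s + 1)).reverse.flatMap fun i =>
      (if decide (∃ v < n, v + 1 = s ∧ i < a v) then
        .bra :: (encNat 1 ++ (List.range n).reverse.flatMap (fun v =>
        (List.range (a v)).reverse.flatMap fun j =>
          encNat (if entry n c s i v j then 1 else 0)) ++ [.ket]) else []) ++
        if s = 0 ∧ i = 0 then w else []) = blowTable n a c ++ w := by
  have h0 : ((List.range (K 0 + 1)).reverse.flatMap fun i =>
      (if decide (∃ v < n, v + 1 = 0 ∧ i < a v) then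
        .bra :: (encNat 1 ++ (List.range n).reverse.flatMap (fun v =>
        (List.range (a v)).reverse.flatMap fun j =>
          encNat (if entry n c 0 i v j then 1 else 0)) ++ [.ket]) else []) ++
        if 0 = 0 ∧ i = 0 then w else []) = w := by
    rw [List.range_succ_eq_map, List.reverse_cons, List.flatMap_append, ← List.map_reverse,
      List.flatMap_map]
    simp
  rw [List.range_succ_eq_map, List.reverse_cons, List.flatMap_append, List.flatMap_singleton, h0,
    ← List.map_reverse, List.flatMap_map]
  congr 1
  rw [blowTable]
  conv_rhs => enter [2]; unfold blowVertices
  rw [List.flatMap_assoc, ← flatMap_range_ite _ hL]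
  refine flatMap_congr' fun t _ => ?_
  by_cases ht : t < n
  · rw [if_pos ht, List.flatMap_map, ← flatMap_range_ite _ ((hK t ht).trans (Nat.le_succ _))]
    refine flatMap_congr' fun i _ => ?_
    have h1 : (∃ v < n, v + 1 = t.succ ∧ i < a v) ↔ i < a t :=
      ⟨by rintro ⟨v, -, hv, h⟩; obtain rfl : v = t := by omega
          exact h, fun h => ⟨t, ht, rfl, h⟩⟩
    simp only [h1, decide_eq_true_eq, Nat.succ_ne_zero, false_and, if_false, List.append_nil]
    congr 4
    rw [blowVertices, List.flatMap_assoc]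
    refine flatMap_congr' fun v _ => ?_
    rw [List.flatMap_map]
    refine flatMap_congr' fun j _ => ?_
    congr 2
    unfold entry blowAdj colBefore
    by_cases hv : v = t
    · subst hv
      rw [if_pos rfl, if_pos rfl, decide_eq_true_eq, ne_comm]
    · rw [if_neg (by omega), if_neg hv, if_pos (by omega), decide_eq_true_eq,
        eq_comm (a := j)]
      rfl
  · rw [if_neg ht]
    have h1 : ∀ i, ¬ ∃ v < n, v + 1 = t.succ ∧ i < a v := by
      rintro i ⟨v, hv, h, -⟩; omega
    refine List.flatMap_eq_nil_iff.2 fun i _ => ?_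
    rw [decide_eq_false (h1 i), if_neg (by simp), if_neg (by simp)]
    rfl

theorem PT.write (n : D → ℕ) (a : D → ℕ → ℕ) (c : D → ℕ → ℕ → ℕ) (nums : D → List Sy)
    (h : ∀ x, IsNum (nums x)) :
    PT (fun x => blk (cellBlocks (n x) (a x) (c x) (nums x)))
      (fun x => blowTable (n x) (a x) (c x) ++
        (Sy.commaN :: nums x).reverse.flatMap numLetter) := by
  refine (PT.subst Option.toList _).trans ((PT.mealy_reverse entryTr (false, false, false) []
    _).trans ((PT.mealy writeTr false [] _).of_eq fun x => ?_))
  have hN : IsNum (.commaN :: nums x) := by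
    intro a ha
    rcases List.mem_cons.1 ha with rfl | ha
    · exact Or.inl rfl
    · exact h x a ha
  have hif : ∀ p : Prop, [Decidable p] → IsNum (if p then .commaN :: nums x else []) := by
    intro p _
    split_ifs
    · exact hN
    · intro a ha; simp at ha
  rw [List.append_nil, List.append_nil, flatMap_toList_blk, cellBlocks, ← List.flatMap_id,
    List.flatMap_assoc]
  simp only [List.flatMap_map, id]
  rw [run_flatMap entryTr fun s _ q => run_flatMap entryTr (fun i _ q =>
    run_entryTr (n x) (a x) (c x) s i (hif (s = 0 ∧ i = 0)) q) q, flatMap_reverse]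
  simp only [flatMap_reverse]
  rw [run_flatMap writeTr fun s _ q => run_flatMap writeTr (fun i _ q =>
    run_writeTr (n x) (a x) (c x) s i (hif (s = 0 ∧ i = 0)) _ q) q]
  have e : ∀ s i : ℕ, (if s = 0 ∧ i = 0 then Sy.commaN :: nums x else []).reverse.flatMap
      numLetter = if s = 0 ∧ i = 0 then (Sy.commaN :: nums x).reverse.flatMap numLetter else [] := by
    intro s i; split_ifs <;> rfl
  simp only [e]
  refine blowTable_eq (K := fun s => ((if s = 0 then Sy.commaN :: nums x else []) ++
    colTab (n x) (a x) (c x) s 0).length) ?_ fun t ht => ?_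
  · have := length_le_length_flatMap (n x) (fun i => tabRow (n x) (a x) (c x) 0 i
      (decide (i + 1 = 0))) fun i => by simp [tabRow]
    simp only [tabMark, List.length_append, List.length_cons]
    omega
  · have h1 := length_le_flatMap (f := colRow (n x) (a x) (c x) (t + 1) 0) (List.mem_range.2 ht)
    have h2 := length_le_length_flatMap (a x t) (fun j => [Sy.cell (decide (j = 0))])
      fun i => by simp
    simp only [colRow, List.length_append, List.length_cons] at h1
    simp only [colTab, List.length_append, List.length_cons]
    omega

/-- The word of the unweighted graph can be computed from the unary word of the weighted graph. -/
theorem PT.blowUp (n : D → ℕ) (a : D → ℕ → ℕ) (c : D → ℕ → ℕ → ℕ) (nums : D → List Sy)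
    (h : ∀ x, IsNum (nums x)) :
    PT (fun x => .commaN :: nums x ++ tabMark (n x) (a x) (c x) 0)
      (fun x => blowTable (n x) (a x) (c x) ++
        (Sy.commaN :: nums x).reverse.flatMap numLetter) :=
  (PT.shift n a c nums h).trans ((PT.col n a c nums h).trans
    ((PT.cell n a c nums h).trans (PT.write n a c nums h)))

/-- The new word of an instance. -/
def outWord (M : ℕ) (d : CutData) : List Γ' :=
  blowTable d.n (fun v => d.ω v * M) d.c ++ encNats (d.pre.reverse ++ [d.num, d.den * M])

/-- The reduction, as a transformation of words. -/
theorem PT.reduction (d : D → CutData) (p : Polynomial ℕ)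
    (hp : ∀ x ρ m, (d x).Occ ρ m → m ≤ p.eval (lay layBin (d x)).length) :
    PT (fun x => inWord (d x)) (fun x => outWord (tickCount (d x) + 1) (d x)) := by
  let num : ℕ → List Sy := fun m => .commaN :: .fin :: (encodeNat m).reverse.map Sy.bit
  have hnum : ∀ m, IsNum (num m) := by
    intro m b hb
    simp only [num, List.mem_cons, List.mem_map] at hb
    rcases hb with h | h | ⟨b, -, h⟩
    · exact Or.inl h
    · exact Or.inr (Or.inl h)
    · exact Or.inr (Or.inr ⟨b, h.symm⟩)
  have hnum' : ∀ m, (num m).reverse.flatMap numLetter = encNat m := by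
    intro m
    simp [num, numLetter, encNat, List.flatMap_append, List.flatMap_map,
      ← List.map_eq_flatMap, ← List.map_reverse]
  let nums : D → List Sy := fun x => (num ((d x).den * (tickCount (d x) + 1))).tail ++
    num (d x).num ++ (d x).pre.flatMap num
  have hnums : ∀ x, Sy.commaN :: nums x = num ((d x).den * (tickCount (d x) + 1)) ++
    num (d x).num ++ (d x).pre.flatMap num := fun x => rfl
  have hlay : ∀ x, lay (layOut (tickCount (d x) + 1)) (d x) = .commaN :: nums x ++
      tabMark (d x).n (fun v => (d x).ω v * (tickCount (d x) + 1)) (d x).c 0 := by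
    intro x
    rw [hnums, lay, tabMark]
    have hpre : layOut (tickCount (d x) + 1) .pre = num := rfl
    simp [tabRow, layOut, num, hpre]
  refine (PT.mark d).trans ((PT.unary d p hp).trans ((PT.tag d).trans ((PT.ticks d).trans
    ((PT.mul _ _ fun x => tick_notMem_lay (d x)).trans ((PT.relabel d _).trans
    (((PT.binary d _).of_eq hlay).trans ((PT.blowUp (fun x => (d x).n)
      (fun x v => (d x).ω v * (tickCount (d x) + 1)) (fun x => (d x).c) nums
      fun x b hb => ?_).of_eq fun x => ?_)))))))
  · have hb' : b ∈ Sy.commaN :: nums x := List.mem_cons_of_mem _ hb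
    rw [hnums, List.mem_append, List.mem_append, List.mem_flatMap] at hb'
    rcases hb' with (hb' | hb') | ⟨m, -, hb'⟩ <;> exact hnum _ b hb'
  · rw [hnums, outWord]
    simp only [List.reverse_append, List.flatMap_append, hnum', encNats, List.flatMap_cons,
      List.flatMap_nil, List.append_nil, flatMap_reverse, List.flatMap_assoc]

end PolyTime

/-! ## Blowing up the vertices of a weighted graph to cliques -/

namespace WeightedGraph

/-- `H` is an unweighted graph in which each vertex `v` of `G` is replaced by a clique of
`ω(v) * M` vertices and each edge by a matching. -/
structure IsBlowUp (G H : WeightedGraph) (M : ℕ) (π : Fin H.n → Fin G.n) (pos : Fin H.n → ℕ) :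
    Prop where
  unweighted : H.IsUnweighted
  pos_lt : ∀ p, pos p < G.ω (π p) * M
  inj : ∀ p q, π p = π q → pos p = pos q → p = q
  surj : ∀ v i, i < G.ω v * M → ∃ p, π p = v ∧ pos p = i
  adj : ∀ p q, H.graph.Adj p q ↔
    if π p = π q then pos p ≠ pos q else pos p = pos q ∧ pos p < G.pairWeight (π p) (π q)

open Classical in
theorem IsUnweighted.pairWeight {H : WeightedGraph} (h : H.IsUnweighted) (p q : Fin H.n) :
    H.pairWeight p q = if H.graph.Adj p q then 1 else 0 := by
  unfold WeightedGraph.pairWeight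
  split_ifs
  · rw [h.2]; rfl
  · rfl

theorem IsUnweighted.vol {H : WeightedGraph} (h : H.IsUnweighted) (A : Finset (Fin H.n)) :
    H.vol A = A.card := by
  simp [WeightedGraph.vol, h.1]

/-- The vertices of the cliques of the vertices in `B`. -/
def lift {G H : WeightedGraph} (π : Fin H.n → Fin G.n) (B : Finset (Fin G.n)) :
    Finset (Fin H.n) :=
  Finset.univ.filter fun p => π p ∈ B

/-- `A` splits the clique of some vertex. -/
def Splits {G H : WeightedGraph} (π : Fin H.n → Fin G.n) (A : Finset (Fin H.n)) : Prop :=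
  ∃ p ∈ A, ∃ q ∉ A, π p = π q

namespace IsBlowUp

variable {G H : WeightedGraph} {M : ℕ} {π : Fin H.n → Fin G.n} {pos : Fin H.n → ℕ}

theorem sum_fiber (h : IsBlowUp G H M π pos) (v : Fin G.n) (f : ℕ → ℕ) :
    ∑ p ∈ Finset.univ.filter (fun p => π p = v), f (pos p) =
      ∑ i ∈ Finset.range (G.ω v * M), f i := by
  refine Finset.sum_nbij pos (fun p hp => ?_) (fun p hp q hq e => ?_) (fun i hi => ?_)
    fun _ _ => rfl
  · rw [Finset.mem_filter] at hp
    rw [Finset.mem_range, ← hp.2]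
    exact h.pos_lt p
  · simp only [Finset.coe_filter, Finset.mem_univ, true_and, Set.mem_ofPred_eq] at hp hq
    exact h.inj p q (hp.trans hq.symm) e
  · obtain ⟨p, hp, hi⟩ := h.surj v i (by simpa using hi)
    exact ⟨p, by simpa using hp, hi⟩

theorem card_fiber (h : IsBlowUp G H M π pos) (v : Fin G.n) :
    (Finset.univ.filter (fun p => π p = v)).card = G.ω v * M := by
  have := h.sum_fiber v fun _ => 1
  simpa using this

theorem sum_lift (π : Fin H.n → Fin G.n) (B : Finset (Fin G.n)) (f : Fin H.n → ℕ) :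
    ∑ p ∈ lift π B, f p = ∑ v ∈ B, ∑ p ∈ Finset.univ.filter (fun p => π p = v), f p := by
  rw [← Finset.sum_fiberwise_of_maps_to (g := π) (t := B) (s := lift π B)
    fun p hp => (Finset.mem_filter.1 hp).2]
  refine Finset.sum_congr rfl fun v hv => Finset.sum_congr ?_ fun _ _ => rfl
  ext p
  simp only [lift, Finset.mem_filter, Finset.mem_univ, true_and]
  exact ⟨fun hp => hp.2, fun hp => ⟨hp ▸ hv, hp⟩⟩

theorem vol_lift (h : IsBlowUp G H M π pos) (B : Finset (Fin G.n)) :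
    H.vol (lift π B) = G.vol B * M := by
  rw [h.unweighted.vol, Finset.card_eq_sum_ones, sum_lift, vol, Finset.sum_mul]
  refine Finset.sum_congr rfl fun v _ => ?_
  rw [← h.card_fiber v, Finset.card_eq_sum_ones]

/-- No clique is cut, and an edge `uv` across the cut contributes the pairs at equal positions below
its weight. Both cliques have at least `M` vertices, so by `hM` the whole matching fits and has
exactly that many edges. -/
theorem cut_lift (h : IsBlowUp G H M π pos) (hM : ∀ u v, G.pairWeight u v ≤ M)
    (B : Finset (Fin G.n)) : H.cut (lift π B) = G.cut B := by
  have hc : (lift π B)ᶜ = lift π Bᶜ := by ext p; simp [lift]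
  rw [cut, cut, hc]
  simp only [sum_lift]
  have hle : ∀ u v w, G.pairWeight u v ≤ G.ω w * M := fun u v w =>
    (hM u v).trans (Nat.le_mul_of_pos_left _ (G.ω w).pos)
  refine Finset.sum_congr rfl fun u hu => ?_
  rw [Finset.sum_comm]
  refine Finset.sum_congr rfl fun v hv => ?_
  have hne : u ≠ v := by rintro rfl; exact Finset.mem_compl.1 hv hu
  have e : ∀ p ∈ Finset.univ.filter (fun p => π p = u),
      ∑ q ∈ Finset.univ.filter (fun q => π q = v), H.pairWeight p q =
        if pos p < G.pairWeight u v then 1 else 0 := by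
    intro p hp
    rw [Finset.mem_filter] at hp
    have e' : ∀ q ∈ Finset.univ.filter (fun q => π q = v), H.pairWeight p q =
        if pos p = pos q then (if pos p < G.pairWeight u v then 1 else 0) else 0 := by
      intro q hq
      rw [Finset.mem_filter] at hq
      rw [h.unweighted.pairWeight, ← ite_and]
      congr 1
      rw [h.adj, hp.2, hq.2, if_neg hne]
    rw [Finset.sum_congr rfl e', h.sum_fiber v
      fun j => if pos p = j then (if pos p < G.pairWeight u v then 1 else 0) else 0,
      Finset.sum_ite_eq]
    have := hle u v v
    simp only [Finset.mem_range]
    split_ifs <;> omega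
  rw [Finset.sum_congr rfl e, h.sum_fiber u fun i => if i < G.pairWeight u v then 1 else 0,
    ← Finset.sum_filter, ← Finset.card_eq_sum_ones]
  have : (Finset.range (G.ω u * M)).filter (fun i => i < G.pairWeight u v) =
      Finset.range (G.pairWeight u v) := by
    ext i
    have := hle u v u
    simp only [Finset.mem_filter, Finset.mem_range]
    omega
  rw [this, Finset.card_range]

theorem flow_lift (h : IsBlowUp G H M π pos) (hM : ∀ u v, G.pairWeight u v ≤ M)
    (B : Finset (Fin G.n)) : H.flow (lift π B) = G.flow B / M := by
  rw [flow, flow, h.vol_lift, h.cut_lift hM, Nat.cast_mul, div_div]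

theorem lift_image {A : Finset (Fin H.n)} (hA : ¬ Splits π A) : lift π (A.image π) = A := by
  ext p
  simp only [lift, Finset.mem_filter, Finset.mem_univ, true_and, Finset.mem_image]
  refine ⟨?_, fun hp => ⟨p, hp, rfl⟩⟩
  rintro ⟨q, hq, e⟩
  by_contra hp
  exact hA ⟨q, hq, p, hp, e⟩

/-- If `1 + x` vertices of a clique lie inside `A` and `1 + y` outside, the cut contains all `(1 +
x) * (1 + y) ≥ 1 + x + y` edges between them, and the clique has at least `M` vertices. -/
theorem le_cut_of_splits (h : IsBlowUp G H M π pos) {A : Finset (Fin H.n)} (hA : Splits π A) :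
    M ≤ H.cut A + 1 := by
  obtain ⟨p, hp, q, hq, e⟩ := hA
  set C := Finset.univ.filter fun r => π r = π p with hC
  have h1 : (A.filter fun r => π r = π p).card * (Aᶜ.filter fun r => π r = π p).card ≤
      H.cut A := by
    rw [cut]
    refine le_trans ?_ (Finset.sum_le_sum_of_subset (Finset.filter_subset (fun r => π r = π p) A))
    rw [← smul_eq_mul]
    refine Finset.card_nsmul_le_sum _ _ _ fun r hr => ?_
    refine le_trans ?_ (Finset.sum_le_sum_of_subset (Finset.filter_subset (fun r => π r = π p) Aᶜ))
    rw [Finset.card_eq_sum_ones]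
    refine Finset.sum_le_sum fun t ht => ?_
    rw [Finset.mem_filter] at hr ht
    rw [h.unweighted.pairWeight, if_pos]
    rw [h.adj, if_pos (hr.2.trans ht.2.symm)]
    intro e'
    have := h.inj r t (hr.2.trans ht.2.symm) e'
    subst this
    exact Finset.mem_compl.1 ht.1 hr.1
  have h2 : (A.filter fun r => π r = π p).card + (Aᶜ.filter fun r => π r = π p).card =
      G.ω (π p) * M := by
    rw [← h.card_fiber, ← Finset.card_union_of_disjoint, ← Finset.filter_union,
      Finset.union_compl]
    exact Finset.disjoint_filter_filter disjoint_compl_right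
  have h3 : 1 ≤ (A.filter fun r => π r = π p).card :=
    Finset.card_pos.2 ⟨p, by simp [hp]⟩
  have h4 : 1 ≤ (Aᶜ.filter fun r => π r = π p).card :=
    Finset.card_pos.2 ⟨q, by simp [hq, e]⟩
  have h5 : M ≤ G.ω (π p) * M := Nat.le_mul_of_pos_left _ (G.ω _).pos
  obtain ⟨x, hx⟩ := Nat.exists_eq_add_of_le h3
  obtain ⟨y, hy⟩ := Nat.exists_eq_add_of_le h4
  rw [hx, hy] at h1 h2
  nlinarith [Nat.zero_le (x * y)]

theorem vol_le (h : IsBlowUp G H M π pos) (A : Finset (Fin H.n)) :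
    H.vol A ≤ G.vol Finset.univ * M := by
  rw [← h.vol_lift]
  exact Finset.sum_le_sum_of_subset fun p _ => by simp [lift]

theorem le_flow_of_splits (h : IsBlowUp G H M π pos) {A : Finset (Fin H.n)} (hA : Splits π A) :
    ((M - 1 : ℕ) : ℚ≥0) / (G.vol Finset.univ * M : ℕ) ≤ H.flow A := by
  have hpos : 0 < H.vol A := by
    obtain ⟨p, hp, -⟩ := hA
    rw [h.unweighted.vol]
    exact Finset.card_pos.2 ⟨p, hp⟩
  rw [flow]
  refine div_le_div₀ zero_le ?_ (by exact_mod_cast hpos) (by exact_mod_cast h.vol_le A)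
  have := h.le_cut_of_splits hA
  exact_mod_cast (by omega : M - 1 ≤ H.cut A)

/-- Few sets split cliques only if there are few sets. -/
theorem card_le_of_splits {k : ℕ} {A : Fin k → Finset (Fin H.n)} (hA : H.IsSubpartition A)
    (s : Finset (Fin k)) (hs : ∀ i, i ∈ s ↔ Splits π (A i)) (hne : s.Nonempty) :
    k ≤ s.card * (G.n + 1) := by
  have h1 : sᶜ.card ≤ G.n := by
    choose p hp using hA.1
    have : sᶜ.card ≤ (Finset.univ : Finset (Fin G.n)).card := by
      -- Representatives of two different unsplit parts lie in different cliques, as otherwise the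
      -- first part would contain its own representative but not the other one.
      refine Finset.card_le_card_of_injOn (fun i => π (p i)) (fun _ _ => Finset.mem_univ _) ?_
      intro i hi j _ e
      by_contra hij
      refine Finset.mem_compl.1 (Finset.mem_coe.1 hi) ((hs i).2 ⟨p i, hp i, p j, fun hj => ?_, e⟩)
      exact Finset.disjoint_left.1 (hA.2 i j hij) hj (hp j)
    simpa using this
  have h2 := Finset.card_add_card_compl s
  rw [Fintype.card_fin] at h2
  have h3 : 1 ≤ s.card := hne.card_pos
  nlinarith

/-- The splitting parts alone have flow at least `s * (num * X) / (ω(V) * M)`, where `s` is their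
number, while `hk` allows at most `s * (n + 1) * num / M`. Cancelling `s * num / M` contradicts
`hX`. Bounding `k` through `s` makes the required `X` independent of `k`. -/
theorem not_splits (h : IsBlowUp G H M π pos) {k : ℕ} {A : Fin k → Finset (Fin H.n)}
    (hA : H.IsSubpartition A) {N : ℚ≥0} (hN : 0 < N) {X : ℕ} (hM : M = N.num * X + 1)
    (hX : (G.n + 1) * G.vol Finset.univ < X) (hk : ∑ i, H.flow (A i) ≤ k * (N / M)) (i : Fin k) :
    ¬ Splits π (A i) := by
  classical
  intro hi
  set s := Finset.univ.filter fun i => Splits π (A i) with hs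
  have hcard : k ≤ s.card * (G.n + 1) :=
    card_le_of_splits (π := π) hA s (by simp [hs]) ⟨i, by simp [hs, hi]⟩
  have hM0 : (0 : ℚ≥0) < M := by rw [hM]; exact_mod_cast Nat.succ_pos _
  have hnum : (0 : ℚ≥0) < N.num := by exact_mod_cast NNRat.num_pos.2 hN
  have hΩ : 0 < G.vol Finset.univ := by
    obtain ⟨p, -⟩ := hi
    refine Finset.sum_pos (fun v _ => (G.ω v).pos) ⟨π p, Finset.mem_univ _⟩
  have hs0 : (0 : ℚ≥0) < s.card := by
    exact_mod_cast Finset.card_pos.2 ⟨i, by simp [hs, hi]⟩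
  have h1 : (s.card : ℚ≥0) * (((M - 1 : ℕ) : ℚ≥0) / (G.vol Finset.univ * M : ℕ)) ≤
      ∑ i, H.flow (A i) := by
    rw [← nsmul_eq_mul]
    refine (Finset.card_nsmul_le_sum s _ _ fun j hj => ?_).trans
      (Finset.sum_le_sum_of_subset (Finset.subset_univ s))
    exact h.le_flow_of_splits (by simpa [hs] using hj)
  -- Dropping the denominator leaves the factor `num` that also occurs in `M - 1 = num * X`, so it
  -- cancels.
  have h2 : N ≤ N.num := by
    conv_lhs => rw [← NNRat.num_div_den N]
    exact div_le_self zero_le (by exact_mod_cast N.den_pos)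
  have h3 : (k : ℚ≥0) * (N / M) ≤ (s.card * (G.n + 1) : ℕ) * (N.num / M) := by
    gcongr
  have h4 := (h1.trans hk).trans h3
  have h5 : (s.card : ℚ≥0) * (((M - 1 : ℕ) : ℚ≥0) / (G.vol Finset.univ * M : ℕ)) =
      (s.card * N.num / M) * (X / G.vol Finset.univ) := by
    rw [hM, Nat.add_sub_cancel]
    push_cast
    field_simp
  have h6 : ((s.card * (G.n + 1) : ℕ) : ℚ≥0) * (N.num / M) =
      (s.card * N.num / M) * (G.n + 1) := by
    push_cast
    field_simp
  rw [h5, h6] at h4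
  have h7 : (0 : ℚ≥0) < s.card * N.num / M := by positivity
  have h8 := le_of_mul_le_mul_left h4 h7
  rw [div_le_iff₀ (by exact_mod_cast hΩ)] at h8
  have h9 : X ≤ (G.n + 1) * G.vol Finset.univ := by exact_mod_cast h8
  omega

end IsBlowUp

/-- The common consequence of the max and the mean condition; the counting argument against split
cliques uses nothing more. -/
theorem sum_flow_le_of_value_le {m : CutVersion} {H : WeightedGraph} {k : ℕ} (hk : 0 < k)
    {A : Fin k → Finset (Fin H.n)} {x : ℚ≥0} (h : m.value H A ≤ x) :
    ∑ i, H.flow (A i) ≤ k * x := by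
  cases m with
  | max =>
    have h' : ∀ i ∈ Finset.univ, H.flow (A i) ≤ x := Finset.sup_le_iff.1 h
    simpa using Finset.sum_le_card_nsmul _ _ _ h'
  | mean =>
    have h' : (1 / (k : ℚ≥0)) * ∑ i, H.flow (A i) ≤ x := h
    rwa [one_div, inv_mul_le_iff₀ (by exact_mod_cast hk)] at h'

theorem value_le_div_iff {m : CutVersion} {G H : WeightedGraph} {k : ℕ}
    {A : Fin k → Finset (Fin H.n)} {B : Fin k → Finset (Fin G.n)} {c : ℚ≥0} (hc : 0 < c)
    (h : ∀ i, H.flow (A i) = G.flow (B i) / c) (x : ℚ≥0) :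
    m.value H A ≤ x / c ↔ m.value G B ≤ x := by
  cases m with
  | max =>
    change (Finset.univ.sup fun i => H.flow (A i)) ≤ _ ↔
      (Finset.univ.sup fun i => G.flow (B i)) ≤ _
    simp only [Finset.sup_le_iff, h, div_le_div_iff_of_pos_right hc]
  | mean =>
    change (1 / (k : ℚ≥0)) * ∑ i, H.flow (A i) ≤ _ ↔ (1 / (k : ℚ≥0)) * ∑ i, G.flow (B i) ≤ _
    simp only [h]
    rw [← Finset.sum_div, ← mul_div_assoc, div_le_div_iff_of_pos_right hc]

/-- Lifting and projecting are inverse to each other on parts that split no clique, and `not_splits`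
shows that all parts below the threshold are of this kind. Nonemptiness and covering transfer
because every clique contains a vertex at position `0`. -/
theorem IsBlowUp.cutAtMost_iff {G H : WeightedGraph} {M : ℕ} {π : Fin H.n → Fin G.n}
    {pos : Fin H.n → ℕ} (h : IsBlowUp G H M π pos) {N : ℚ≥0} (hN : 0 < N) {X : ℕ}
    (hM : M = N.num * X + 1) (hX : (G.n + 1) * G.vol Finset.univ < X)
    (hc : ∀ u v, G.pairWeight u v ≤ M) (T : CutKind) (m : CutVersion) {k : ℕ} (hk : 0 < k) :
    CutAtMost T m G k N ↔ CutAtMost T m H k (N / M) := by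
  have hM1 : 0 < M := by omega
  have hM0 : (0 : ℚ≥0) < M := by exact_mod_cast hM1
  constructor
  · rintro ⟨B, hB, hv⟩
    refine ⟨fun i => lift π (B i), ?_,
      (value_le_div_iff hM0 (fun i => h.flow_lift hc (B i)) N).2 hv⟩
    have hsub : G.IsSubpartition B → H.IsSubpartition fun i => lift π (B i) := by
      intro hB
      refine ⟨fun i => ?_, fun i j hij => ?_⟩
      · obtain ⟨v, hv⟩ := hB.1 i
        obtain ⟨p, hp, -⟩ := h.surj v 0 (Nat.mul_pos (G.ω v).pos hM1)
        exact ⟨p, by simp [lift, hp, hv]⟩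
      · rw [Finset.disjoint_left]
        intro p hp hp'
        exact Finset.disjoint_left.1 (hB.2 i j hij) (Finset.mem_filter.1 hp).2
          (Finset.mem_filter.1 hp').2
    cases T with
    | IPP => exact hsub hB
    | NCP =>
      refine ⟨hsub hB.1, fun p => ?_⟩
      obtain ⟨i, hi⟩ := hB.2 (π p)
      exact ⟨i, by simp [lift, hi]⟩
  · rintro ⟨A, hA, hv⟩
    have hsub : H.IsSubpartition A := by
      cases T with
      | IPP => exact hA
      | NCP => exact hA.1
    have hns := h.not_splits hsub hN hM hX (sum_flow_le_of_value_le hk hv)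
    have hflow : ∀ i, H.flow (A i) = G.flow ((A i).image π) / M := fun i => by
      rw [← h.flow_lift hc, IsBlowUp.lift_image (hns i)]
    refine ⟨fun i => (A i).image π, ?_, (value_le_div_iff hM0 hflow N).1 hv⟩
    have hsub' : G.IsSubpartition fun i => (A i).image π := by
      refine ⟨fun i => (hsub.1 i).image π, fun i j hij => ?_⟩
      rw [Finset.disjoint_left]
      intro v hv hv'
      obtain ⟨p, hp, e⟩ := Finset.mem_image.1 hv
      obtain ⟨q, hq, e'⟩ := Finset.mem_image.1 hv'
      refine hns i ⟨p, hp, q, fun hq' => ?_, e.trans e'.symm⟩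
      exact Finset.disjoint_left.1 (hsub.2 i j hij) hq' hq
    cases T with
    | IPP => exact hsub'
    | NCP =>
      refine ⟨hsub', fun v => ?_⟩
      obtain ⟨p, hp, -⟩ := h.surj v 0 (Nat.mul_pos (G.ω v).pos hM1)
      obtain ⟨i, hi⟩ := hA.2 p
      exact ⟨i, Finset.mem_image.2 ⟨p, hi, hp⟩⟩

end WeightedGraph

/-! ## The reduction to unweighted graphs -/

namespace PolyTime

open Computability InstanceCode WeightedGraph

/-- The numbers in an instance. -/
noncomputable def cutData (G : WeightedGraph) (N : ℚ≥0) (pre : List ℕ) : CutData where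
  n := G.n
  ω i := if h : i < G.n then G.ω (Fin.rev ⟨i, h⟩) else 0
  c i j := if h : i < G.n ∧ j < G.n then
    G.pairWeight (Fin.rev ⟨i, h.1⟩) (Fin.rev ⟨j, h.2⟩) else 0
  den := N.den
  num := N.num
  pre := pre.reverse

/-! ### The order of the vertices and the blown-up graph -/

theorem reverse_range_eq (n : ℕ) :
    (List.range n).reverse = (List.finRange n).map fun u => (Fin.rev u : ℕ) := by
  refine List.ext_getElem (by simp) fun i h₁ h₂ => ?_
  simp
  omega

theorem cutData_ω_rev (G : WeightedGraph) (N : ℚ≥0) (pre : List ℕ) (v : Fin G.n) :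
    (cutData G N pre).ω (Fin.rev v : Fin G.n) = G.ω v :=
  (dif_pos (Fin.rev v).2).trans (by rw [Fin.eta, Fin.rev_rev])

theorem cutData_c_rev (G : WeightedGraph) (N : ℚ≥0) (pre : List ℕ) (u v : Fin G.n) :
    (cutData G N pre).c (Fin.rev u : Fin G.n) (Fin.rev v : Fin G.n) = G.pairWeight u v :=
  (dif_pos ⟨(Fin.rev u).2, (Fin.rev v).2⟩).trans
    (by rw [Fin.eta, Fin.eta, Fin.rev_rev, Fin.rev_rev])

/-- `cutData` numbers the vertices backwards and `inWord` lists them backwards; the two reversals,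
and likewise those of `pre`, cancel. -/
theorem inWord_cutData (G : WeightedGraph) (N : ℚ≥0) (pre : List ℕ) :
    inWord (cutData G N pre) = encGraph G (pre ++ [N.num, N.den]) := by
  rw [inWord, encGraph]
  congr 1
  · rw [encTable, table, List.ofFn_eq_map, List.flatMap_map,
      show (cutData G N pre).n = G.n from rfl, reverse_range_eq, List.flatMap_map]
    refine flatMap_congr' fun u _ => ?_
    simp only [encNats, List.flatMap_cons, List.ofFn_eq_map, List.flatMap_map]
    congr 3
    · rw [cutData_ω_rev]
    · refine flatMap_congr' fun v _ => ?_
      rw [cutData_c_rev]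
  · simp [cutData]

theorem pairWeight_comm (G : WeightedGraph) (u v : Fin G.n) :
    G.pairWeight u v = G.pairWeight v u := by
  unfold WeightedGraph.pairWeight
  by_cases h : G.graph.Adj u v
  · rw [dif_pos h, dif_pos h.symm]
    congr 3
    exact Sym2.eq_swap
  · rw [dif_neg h, dif_neg fun h' => h h'.symm]

theorem cutData_c_comm (G : WeightedGraph) (N : ℚ≥0) (pre : List ℕ) (i j : ℕ) :
    (cutData G N pre).c i j = (cutData G N pre).c j i := by
  simp only [cutData]
  by_cases h : i < G.n ∧ j < G.n
  · rw [dif_pos h, dif_pos h.symm, pairWeight_comm]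
  · rw [dif_neg h, dif_neg fun h' => h h'.symm]

theorem mem_blowVertices {n : ℕ} {a : ℕ → ℕ} {p : ℕ × ℕ} :
    p ∈ blowVertices n a ↔ p.1 < n ∧ p.2 < a p.1 := by
  obtain ⟨t, i⟩ := p
  simp [blowVertices]

theorem nodup_blowVertices (n : ℕ) (a : ℕ → ℕ) : (blowVertices n a).Nodup := by
  rw [blowVertices, List.nodup_flatMap]
  refine ⟨fun t _ => ?_, ?_⟩
  · exact (List.nodup_reverse.2 List.nodup_range).map fun i j h => (Prod.mk.inj h).2
  · refine List.Pairwise.imp (fun {s t} hst => ?_) (List.nodup_reverse.2 List.nodup_range)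
    intro p hp hq
    simp only [List.mem_map] at hp hq
    obtain ⟨i, -, rfl⟩ := hp
    obtain ⟨j, -, h⟩ := hq
    exact hst (Prod.mk.inj h).1.symm

/-- The vertices of the unweighted graph, in the order of the output. -/
noncomputable def vertexList (G : WeightedGraph) (N : ℚ≥0) (pre : List ℕ) (M : ℕ) :
    List (ℕ × ℕ) :=
  blowVertices G.n fun v => (cutData G N pre).ω v * M

/-- The unweighted graph of the reduction. -/
noncomputable def blowGraph (G : WeightedGraph) (N : ℚ≥0) (pre : List ℕ) (M : ℕ) :
    WeightedGraph where
  n := (vertexList G N pre M).length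
  graph :=
    { Adj := fun p q => blowAdj (cutData G N pre).c ((vertexList G N pre M).get p)
        ((vertexList G N pre M).get q)
      symm := ⟨by
        intro p q h
        unfold blowAdj at h ⊢
        split_ifs at h ⊢ with h₁ h₂ h₂
        · exact h.symm
        · exact absurd h₁.symm h₂
        · exact absurd h₂.symm h₁
        · rw [cutData_c_comm, ← h.1]
          exact ⟨rfl, h.2⟩⟩
      loopless := ⟨by
        intro p h
        unfold blowAdj at h
        rw [if_pos rfl] at h
        exact h rfl⟩ }
  ω _ := 1
  c _ := 1

theorem isUnweighted_blowGraph (G : WeightedGraph) (N : ℚ≥0) (pre : List ℕ) (M : ℕ) :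
    (blowGraph G N pre M).IsUnweighted :=
  ⟨fun _ => rfl, fun _ => rfl⟩

theorem encGraph_blowGraph (G : WeightedGraph) (N : ℚ≥0) (pre : List ℕ) (M : ℕ) (l : List ℕ) :
    encGraph (blowGraph G N pre M) l =
      blowTable G.n (fun v => (cutData G N pre).ω v * M) (cutData G N pre).c ++ encNats l := by
  have hofFn : ∀ {A : Type} (f : ℕ × ℕ → A), (List.ofFn fun q : Fin (blowGraph G N pre M).n =>
      f ((vertexList G N pre M).get q)) = (vertexList G N pre M).map f := by
    intro A f
    have := List.map_ofFn (f := (vertexList G N pre M).get) (g := f)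
    rw [List.ofFn_get] at this
    exact this.symm
  rw [encGraph]
  congr 1
  have ht : table (blowGraph G N pre M) = (vertexList G N pre M).map fun p =>
      1 :: (vertexList G N pre M).map fun q =>
        if blowAdj (cutData G N pre).c p q then 1 else 0 := by
    rw [← hofFn]
    refine congrArg _ (funext fun u => ?_)
    rw [← hofFn]
    refine congrArg₂ _ rfl (congrArg _ (funext fun v => ?_))
    rw [(isUnweighted_blowGraph G N pre M).pairWeight]
    by_cases h : blowAdj (cutData G N pre).c ((vertexList G N pre M).get u)
      ((vertexList G N pre M).get v)
    · rw [if_pos h]; exact if_pos h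
    · rw [if_neg h]; exact if_neg h
  rw [encTable, ht, List.flatMap_map, blowTable]
  refine flatMap_congr' fun p _ => ?_
  rw [encNats, List.flatMap_cons, List.flatMap_map]
  rfl

/-- The entry of the list of vertices. -/
noncomputable def vertexAt {G : WeightedGraph} {N : ℚ≥0} {pre : List ℕ} {M : ℕ}
    (p : Fin (blowGraph G N pre M).n) : ℕ × ℕ :=
  (vertexList G N pre M).get p

theorem vertexAt_lt {G : WeightedGraph} {N : ℚ≥0} {pre : List ℕ} {M : ℕ}
    (p : Fin (blowGraph G N pre M).n) :
    (vertexAt p).1 < G.n ∧ (vertexAt p).2 < (cutData G N pre).ω (vertexAt p).1 * M :=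
  mem_blowVertices.1 (List.get_mem _ _)

/-- A vertex is a pair of a clique number and a position in the clique; `Fin.rev` undoes the
backward numbering of `cutData`. -/
theorem isBlowUp_blowGraph (G : WeightedGraph) (N : ℚ≥0) (pre : List ℕ) (M : ℕ) :
    ∃ π pos, IsBlowUp G (blowGraph G N pre M) M π pos := by
  have hπ : ∀ p q : Fin (blowGraph G N pre M).n,
      Fin.rev (⟨(vertexAt p).1, (vertexAt_lt p).1⟩ : Fin G.n) =
        Fin.rev ⟨(vertexAt q).1, (vertexAt_lt q).1⟩ ↔ (vertexAt p).1 = (vertexAt q).1 := by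
    intro p q
    rw [Fin.rev_inj, Fin.mk.injEq]
  refine ⟨fun p => Fin.rev ⟨(vertexAt p).1, (vertexAt_lt p).1⟩, fun p => (vertexAt p).2,
    isUnweighted_blowGraph G N pre M, fun p => ?_, fun p q h₁ h₂ => ?_, fun v i hi => ?_,
    fun p q => ?_⟩
  · have h := (vertexAt_lt p).2
    rwa [show (cutData G N pre).ω (vertexAt p).1 =
      G.ω (Fin.rev ⟨(vertexAt p).1, (vertexAt_lt p).1⟩) from dif_pos (vertexAt_lt p).1] at h
  · exact List.nodup_iff_injective_get.1 (nodup_blowVertices _ _)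
      (Prod.ext ((hπ p q).1 h₁) h₂)
  · have h : (((Fin.rev v : Fin G.n) : ℕ), i) ∈ vertexList G N pre M :=
      mem_blowVertices.2 ⟨(Fin.rev v).2, by simpa only [cutData_ω_rev] using hi⟩
    obtain ⟨p, hp⟩ := List.mem_iff_get.1 h
    have h₁ : (vertexAt (p : Fin (blowGraph G N pre M).n)).1 = (Fin.rev v : Fin G.n) :=
      congrArg Prod.fst hp
    have h₂ : (vertexAt (p : Fin (blowGraph G N pre M).n)).2 = i := congrArg Prod.snd hp
    refine ⟨p, ?_, h₂⟩
    rw [← Fin.rev_rev v, Fin.rev_inj]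
    exact Fin.ext h₁
  · have hc : (cutData G N pre).c (vertexAt q).1 (vertexAt p).1 =
        G.pairWeight (Fin.rev ⟨(vertexAt p).1, (vertexAt_lt p).1⟩)
          (Fin.rev ⟨(vertexAt q).1, (vertexAt_lt q).1⟩) := by
      rw [cutData_c_comm]
      exact dif_pos ⟨(vertexAt_lt p).1, (vertexAt_lt q).1⟩
    change blowAdj (cutData G N pre).c (vertexAt p) (vertexAt q) ↔ _
    unfold blowAdj
    by_cases h : (vertexAt p).1 = (vertexAt q).1
    · rw [if_pos h.symm, if_pos ((hπ p q).2 h)]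
    · rw [if_neg fun h' => h h'.symm, if_neg fun h' => h ((hπ p q).1 h'), hc]

/-! ### Arithmetic of the threshold and of the blow-up factor -/

theorem num_den_div {a b : ℕ} (hb : 0 < b) (h : a.Coprime b) :
    ((a : ℚ≥0) / b).num = a ∧ ((a : ℚ≥0) / b).den = b := by
  have e : (((a : ℚ≥0) / b : ℚ≥0) : ℚ) = ((a : ℤ) : ℚ) / ((b : ℤ) : ℚ) := by push_cast; rfl
  constructor
  · have := Rat.num_div_eq_of_coprime (a := a) (b := b) (by exact_mod_cast hb) (by simpa using h)
    rw [NNRat.num, e, this]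
    rfl
  · have := Rat.den_div_eq_of_coprime (a := a) (b := b) (by exact_mod_cast hb) (by simpa using h)
    rw [← e] at this
    exact_mod_cast this

/-- `M` is `1` modulo the numerator, hence coprime to it. The new threshold is obtained by
multiplying the denominator, and no fraction has to be reduced by the machine. -/
theorem num_den_div_of_eq {N : ℚ≥0} {M X : ℕ} (hM : M = N.num * X + 1) :
    (N / M).num = N.num ∧ (N / M).den = N.den * M := by
  have e : N / M = (N.num : ℚ≥0) / (N.den * M : ℕ) := by
    rw [Nat.cast_mul, ← div_div, NNRat.num_div_den]
  rw [e]
  refine num_den_div (Nat.mul_pos N.den_pos (by omega)) (Nat.Coprime.mul_right N.coprime_num_den ?_)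
  rw [hM]
  simp

/-- The factor of the reduction. -/
noncomputable def blowFactor (G : WeightedGraph) (N : ℚ≥0) (pre : List ℕ) : ℕ :=
  tickCount (cutData G N pre) + 1

theorem vol_univ_le (G : WeightedGraph) (N : ℚ≥0) (pre : List ℕ) :
    G.vol Finset.univ ≤ (lay layTag (cutData G N pre)).length := by
  have h1 : ∀ (n : ℕ) (f : ℕ → ℕ),
      ((List.range n).flatMap fun i => List.replicate (f i) ()).length =
        ∑ i ∈ Finset.range n, f i := by
    intro n f
    induction n with
    | zero => rfl
    | succ n ih => simp [List.range_succ, Finset.sum_range_succ, ← ih]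
  have h2 : G.vol Finset.univ = ∑ i ∈ Finset.range G.n, (cutData G N pre).ω i := by
    rw [Finset.sum_range, vol, ← Equiv.sum_comp Fin.revPerm]
    simp [cutData]
  rw [h2, ← h1]
  have h3 := length_flatMap_le (l := List.range G.n) (B := 1)
    (f := fun i => Sy.ket false :: ((List.range G.n).flatMap
      (fun j => layTag .c ((cutData G N pre).c i j)) ++ layTag .w ((cutData G N pre).ω i) ++
        [Sy.bra])) (g := fun i => List.replicate ((cutData G N pre).ω i) ()) fun i _ => by
    simp only [layTag, List.length_append, List.length_cons, List.length_replicate]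
    omega
  refine h3.trans ?_
  rw [mul_one]
  simp only [lay, List.length_append, List.length_cons, show (cutData G N pre).n = G.n from rfl]
  omega

/-- The length `w` of the unary word bounds `n + 1`, the total vertex weight and every edge weight.
The cofactor produced by the two pumps is at least `w + w * w`, hence larger than `(n + 1) * ω(V)`.
-/
theorem exists_blowFactor_eq (G : WeightedGraph) {N : ℚ≥0} (hN : 0 < N) (pre : List ℕ) :
    ∃ X, blowFactor G N pre = N.num * X + 1 ∧ (G.n + 1) * G.vol Finset.univ < X ∧
      ∀ u v, G.pairWeight u v ≤ blowFactor G N pre := by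
  set w := (lay layTag (cutData G N pre)).length with hw
  have hvol := vol_univ_le G N pre
  rw [← hw] at hvol
  have hn : G.n + 1 ≤ w := by
    have := length_le_length_flatMap G.n (fun i => Sy.ket false :: ((List.range G.n).flatMap
      (fun j => layTag .c ((cutData G N pre).c i j)) ++ layTag .w ((cutData G N pre).ω i) ++
        [Sy.bra])) fun i => by simp
    simp only [hw, lay, List.length_append, List.length_cons,
      show (cutData G N pre).n = G.n from rfl] at this ⊢
    omega
  have hnum : 1 ≤ N.num := NNRat.num_pos.2 hN
  have hX : w ≤ w + w * (1 + N.num) * (1 + w) := Nat.le_add_right _ _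
  have he : blowFactor G N pre = N.num * (w + w * (1 + N.num) * (1 + w)) + 1 := rfl
  refine ⟨w + w * (1 + N.num) * (1 + w), he, ?_, fun u v => ?_⟩
  · have h1 : (G.n + 1) * G.vol Finset.univ ≤ w * w := Nat.mul_le_mul hn hvol
    have h2 : w * w ≤ w * (1 + N.num) * (1 + w) :=
      Nat.mul_le_mul (Nat.le_mul_of_pos_right _ (by omega)) (by omega)
    omega
  · have h1 : (cutData G N pre).Occ .c (G.pairWeight u v) :=
      ⟨Fin.rev u, (Fin.rev u).2, Fin.rev v, (Fin.rev v).2, (cutData_c_rev G N pre u v).symm⟩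
    have h2 := length_le_lay layTag h1
    simp only [layTag, List.length_append, List.length_cons, List.length_replicate] at h2
    rw [he]
    calc G.pairWeight u v ≤ w := by omega
      _ ≤ w + w * (1 + N.num) * (1 + w) := hX
      _ ≤ N.num * (w + w * (1 + N.num) * (1 + w)) := Nat.le_mul_of_pos_left _ hnum
      _ ≤ _ := Nat.le_succ _

/-- `markTr` writes at least one letter for every letter other than `blank`. A bound on the numbers
in terms of the length of the instance therefore also holds in terms of the marked word. -/
theorem length_inWord_le (d : CutData) : (inWord d).length ≤ (lay layBin d).length := by
  have h : ∀ (w : List Γ') (s : Zone × Bool), Γ'.blank ∉ w → w.length ≤ (run markTr s w).length := by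
    intro w
    induction w with
    | nil => simp
    | cons a w ih =>
      intro s hw
      rw [List.mem_cons, not_or] at hw
      have h1 := ih (markTr s a).1 hw.2
      have h2 : 1 ≤ (markTr s a).2.length := by
        cases a with
        | blank => exact absurd rfl hw.1
        | _ => simp [markTr]
      rw [run_cons, List.length_append, List.length_cons]
      omega
  have hb : ∀ m, Γ'.blank ∉ encNat m := by intro m; simp [encNat]
  have := h (inWord d) (.before, false) (by simp [inWord, encNats, hb])
  rwa [← run_markTr, List.length_reverse]

theorem PT.blowGraph {D : Type} (G : D → WeightedGraph) (N : D → ℚ≥0) (hN : ∀ x, 0 < N x)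
    (pre : D → List ℕ) (p : Polynomial ℕ)
    (hp : ∀ x, ∀ m, (m ∈ (G x).weights ∨ m = (N x).num ∨ m = (N x).den ∨ m ∈ pre x) →
      m ≤ p.eval (encGraph (G x) (pre x ++ [(N x).num, (N x).den])).length) :
    PT (fun x => encGraph (G x) (pre x ++ [(N x).num, (N x).den]))
      (fun x => encGraph (blowGraph (G x) (N x) (pre x) (blowFactor (G x) (N x) (pre x)))
        (pre x ++ [(N x / blowFactor (G x) (N x) (pre x)).num,
          (N x / blowFactor (G x) (N x) (pre x)).den])) := by
  have hin : (fun x => encGraph (G x) (pre x ++ [(N x).num, (N x).den])) =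
      fun x => inWord (cutData (G x) (N x) (pre x)) :=
    funext fun x => (inWord_cutData _ _ _).symm
  rw [hin]
  refine (PT.reduction (fun x => cutData (G x) (N x) (pre x)) p fun x ρ m hm => ?_).of_eq
    fun x => ?_
  · have h0 := length_inWord_le (cutData (G x) (N x) (pre x))
    rw [inWord_cutData] at h0
    refine le_trans ?_ (eval_mono p h0)
    cases ρ with
    | den => exact hp x m (Or.inr (Or.inr (Or.inl hm)))
    | num => exact hp x m (Or.inr (Or.inl hm))
    | pre => exact hp x m (Or.inr (Or.inr (Or.inr (List.mem_reverse.1 hm))))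
    | c =>
      obtain ⟨i, hi, j, hj, rfl⟩ := hm
      have h1 : (cutData (G x) (N x) (pre x)).c i j =
        (G x).pairWeight (Fin.rev ⟨i, hi⟩) (Fin.rev ⟨j, hj⟩) := dif_pos ⟨hi, hj⟩
      rw [h1, pairWeight]
      split_ifs with h
      · exact hp x _ (Or.inl (Or.inr ⟨_, rfl⟩))
      · exact Nat.zero_le _
    | w =>
      obtain ⟨i, hi, rfl⟩ := hm
      have h1 : (cutData (G x) (N x) (pre x)).ω i = (G x).ω (Fin.rev ⟨i, hi⟩) := dif_pos hi
      rw [h1]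
      exact hp x _ (Or.inl (Or.inl ⟨_, rfl⟩))
  · obtain ⟨X, hX, -⟩ := exists_blowFactor_eq (G x) (hN x) (pre x)
    obtain ⟨h1, h2⟩ := num_den_div_of_eq hX
    rw [encGraph_blowGraph, h1, h2, outWord]
    simp only [cutData, List.reverse_reverse]
    rfl

theorem cutAtMost_blowGraph (T : CutKind) (m : CutVersion) (G : WeightedGraph) {N : ℚ≥0}
    (hN : 0 < N) (pre : List ℕ) {k : ℕ} (hk : 0 < k) :
    CutAtMost T m G k N ↔
      CutAtMost T m (PolyTime.blowGraph G N pre (blowFactor G N pre)) k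
        (N / blowFactor G N pre) := by
  obtain ⟨X, hX, h, hc⟩ := exists_blowFactor_eq G hN pre
  obtain ⟨π, pos, hπ⟩ := isBlowUp_blowGraph G N pre (blowFactor G N pre)
  exact hπ.cutAtMost_iff hN hX h hc T m hk

theorem div_blowFactor_pos (G : WeightedGraph) {N : ℚ≥0} (hN : 0 < N) (pre : List ℕ) :
    0 < N / blowFactor G N pre :=
  div_pos hN (Nat.cast_pos.2 (Nat.succ_pos _))

end PolyTime

/-! ### Restriction of problems and the conclusion -/

namespace DecisionProblem

/-- The encoding is unchanged, so the same machine verifies the same certificates on fewer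
instances. -/
theorem InNP.restrict {P : DecisionProblem} (h : P.InNP) (S : Set P.Inst) :
    (P.restrict S).InNP := by
  obtain ⟨V, q, hV, h⟩ := h
  refine ⟨fun x => V (x.1.1, x.2), q, ?_, fun x => h x.1⟩
  exact PolyTime.PT.to_computable ((PolyTime.PT.of_computable hV).comp_right
    fun x : (P.restrict S).Inst × List Bool => (x.1.1, x.2))

/-- A polynomial-time transformation of instances preserves hardness. -/
theorem npComplete_restrict_of_PT {P : DecisionProblem} {S U : Set P.Inst} (hP : P.InNP)
    (hS : (P.restrict S).NPComplete) (g : {x // x ∈ S} → {x // x ∈ U})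
    (hg : PolyTime.PT (fun x : {x // x ∈ S} => P.enc x.1) (fun x => P.enc (g x).1))
    (hy : ∀ x, x.1 ∈ P.Yes ↔ (g x).1 ∈ P.Yes) : (P.restrict U).NPComplete := by
  refine ⟨hP.restrict U, fun L hL => ?_⟩
  obtain ⟨f, hf, hf'⟩ := hS.2 L hL
  refine ⟨fun x => g (f x), ?_, fun x => (hf' x).trans (hy (f x))⟩
  have : Fintype (P.restrict S).Sym := P.symFintype
  exact PolyTime.PT.to_computable (D' := {x // x ∈ U}) (e' := fun y => P.enc y.1)
    ((PolyTime.PT.of_computable hf).trans (hg.comp_right f))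

end DecisionProblem

theorem mainTheorem8 (P : ISO) (hP : P.weighted.StronglyNPComplete) :
    P.unweighted.NPComplete := by
  obtain ⟨⟨hNP, -⟩, p, hp⟩ := hP
  cases P with
  | inputK T m =>
    -- Hardness is transferred from the instances with polynomially bounded numbers. The number `k`
    -- is carried along unchanged as the only element of `pre`; for constant `k` that list is empty.
    let S : Set CutInstance := {x | ∀ a ∈ (cutProblem T m).params x,
      a ≤ p.eval ((cutProblem T m).toDecisionProblem.size x)}
    refine DecisionProblem.npComplete_restrict_of_PT
      (P := (cutProblem T m).toDecisionProblem) (S := S)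
      (U := {x : CutInstance | x.G.IsUnweighted}) hNP hp
      (fun x => ⟨⟨PolyTime.blowGraph x.1.G x.1.N [x.1.k] (PolyTime.blowFactor x.1.G x.1.N [x.1.k]),
        x.1.k, x.1.two_le, x.1.N / PolyTime.blowFactor x.1.G x.1.N [x.1.k],
        PolyTime.div_blowFactor_pos _ x.1.N_pos _⟩, PolyTime.isUnweighted_blowGraph _ _ _ _⟩)
      (PolyTime.PT.blowGraph (fun x : {x // x ∈ S} => x.1.G) (fun x => x.1.N) (fun x => x.1.N_pos)
        (fun x => [x.1.k]) p fun x m hm => x.2 m ?_)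
      fun x => PolyTime.cutAtMost_blowGraph T m x.1.G x.1.N_pos _
        (lt_of_lt_of_le two_pos x.1.two_le)
    rcases hm with h | h | h | h
    · exact Or.inl h
    · exact Or.inr (Or.inr (Or.inl h))
    · exact Or.inr (Or.inr (Or.inr h))
    · exact Or.inr (Or.inl (List.mem_singleton.1 h))
  | constK T m k hk =>
    let S : Set FixedCutInstance := {x | ∀ a ∈ (fixedCutProblem T m k).params x,
      a ≤ p.eval ((fixedCutProblem T m k).toDecisionProblem.size x)}
    refine DecisionProblem.npComplete_restrict_of_PT
      (P := (fixedCutProblem T m k).toDecisionProblem) (S := S)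
      (U := {x : FixedCutInstance | x.G.IsUnweighted}) hNP hp
      (fun x => ⟨⟨PolyTime.blowGraph x.1.G x.1.N [] (PolyTime.blowFactor x.1.G x.1.N []),
        x.1.N / PolyTime.blowFactor x.1.G x.1.N [],
        PolyTime.div_blowFactor_pos _ x.1.N_pos _⟩, PolyTime.isUnweighted_blowGraph _ _ _ _⟩)
      (PolyTime.PT.blowGraph (fun x : {x // x ∈ S} => x.1.G) (fun x => x.1.N) (fun x => x.1.N_pos)
        (fun _ => []) p fun x m hm => x.2 m ?_)
      fun x => PolyTime.cutAtMost_blowGraph T m x.1.G x.1.N_pos _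
        (lt_of_lt_of_le two_pos hk)
    rcases hm with h | h | h | h
    · exact Or.inl h
    · exact Or.inr (Or.inl h)
    · exact Or.inr (Or.inr h)
    · exact absurd h List.not_mem_nil
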